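/- **Setting.** Let $\mathcal A^\omega=\mathrm{WE}\text{-}\mathrm{PA}^\omega+\mathrm{QF}\text{-}\mathrm{AC}+\mathrm{DC}$ be weakly extensional Peano arithmetic in all finite types (classical logic, combinators, simultaneous primitive recursion, full induction, the quantifier-free rule of extensionality) with quantifier-free choice and dependent choice for tuples, formulated over the types generated from $0$ (natural numbers) and an abstract type $X$ by $\rho,\tau\mapsto\tau(\rho)$. Only $=_0$ is primitive; real numbers are represented by objects of type $1=0(0)$ via fast converging Cauchy sequences of rationals. $\mathcal A^\omega[X,\|\cdot\|]$ adds constants $0_X,1_X,+_X,-_X,\cdot_X,\|\cdot\|_X$ with the usual axioms of a real normed space, $\|1_X\|=_{\mathbb R}1$, and $x=_Xy:\equiv\|x-_Xy\|_X=_{\mathbb R}0$; $\mathcal A^\omega[X,\langle\cdot,\cdot\rangle]$ adds the parallelogram law, with $\langle x,y\rangle:=\frac14(\|x+y\|^2-\|x-y\|^2)$. Add constants $\chi_A$ of type $0(X)(X)$, $J$ of type $X(X)(1)$, $\tilde\gamma$ of type $1$, $m_{\tilde\gamma}$ of type $0$ and $c_X$ of type $X$. Write $u\in Ax$ for $\chi_Axu=_00$,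 $J_\gamma x$ for $J\gamma x$, and $x\in\mathrm{dom}J_\gamma$ for $\exists y^X(\gamma^{-1}(x-y)\in Ay)$. Any statement involving $\gamma^{-1}$ for $\gamma>0$ is an abbreviation in which a further number variable $l$ is universally quantified, the premise $\gamma>_{\mathbb R}2^{-l}$ stands for $\gamma>0$, and $\gamma^{-1}$ is a closed term $(\gamma)^{-1}_l$ that represents the reciprocal whenever $|\gamma|>2^{-l}$ (also for $\gamma=1$, in $\mathrm{dom}J_1$). * $\mathcal V^\omega_p$ is $\mathcal A^\omega[X,\|\cdot\|]$ with the axioms: $\forall x,y(\chi_Axy\leq_01)$; $\forall\gamma^1,x(\gamma>0\wedge x\in\mathrm{dom}J_\gamma\to\gamma^{-1}(x-J_\gamma x)\in A(J_\gamma x))$; $\forall x,y,u,v,\lambda^1(u\in Ax\wedge v\in Ay\to\|x-y+|\lambda|(u-v)\|\geq\|x-y\|)$; $\tilde\gamma\geq2^{-m_{\tilde\gamma}}$; $\forall\gamma^1(\gamma>0\to\gamma^{-1}(c_X-J_\gamma c_X)\in A(J_\gamma c_X))$. * $\mathcal T^\omega_p$ is $\mathcal V^\omega_p$ with the parallelogram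 law. * $\mathcal U^\omega_p$ is obtained from $\mathcal T^\omega_p$ by adding constants $\tilde\rho$ of type $1$ and $n_{\tilde\gamma}$ of type $0$, replacing the third axiom by $\forall x,y,u,v(u\in Ax\wedge v\in Ay\to\langle x-y,u-v\rangle\geq\tilde\rho\|u-v\|^2)$, and adding $\tilde\rho\geq-\tilde\gamma+2^{-n_{\tilde\gamma}}$. * $\mathcal U^{*\omega}_p$ is obtained from $\mathcal U^\omega_p$ by adding the premise $\tilde\rho>-\gamma/2$ to the second axiom and to the axiom on $c_X$, and replacing $\tilde\rho\geq-\tilde\gamma+2^{-n_{\tilde\gamma}}$ by $\tilde\rho\geq-\tilde\gamma/2+2^{-n_{\tilde\gamma}}$. **Theorem.** Over $\mathcal V^\omega_p$ the following are equivalent (that is, $\mathcal V^\omega_p$ proves the equivalences): 1. Extensionality of $A$: $\forall x,y,x',y'\,(x=_Xx'\wedge y=_Xy'\to\chi_Axy=_0\chi_Ax'y')$. 2. The strong domain axiom $$\forall\gamma^1,x\,\big(\gamma>0\wedge\exists y,z(z\in Ay\wedge x=_Xy+\gamma z)\to\gamma^{-1}(x-J_\gamma x)\in A(J_\gamma x)\big)$$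 together with the strong partial resolvent axiom $$\forall x,p,\gamma^1\,\big(\gamma>0\wedge x\in\mathrm{dom}J_\gamma\wedge p=_XJ_\gamma x\to|\gamma|^{-1}(x-p)\in Ap\big).$$ 3. The strong domain axiom for $\gamma=1$, $$\forall x\,\big(\exists y,z(z\in Ay\wedge x=_Xy+z)\to(x-J_1x)\in A(J_1x)\big),$$ together with the strong partial resolvent axiom for $\gamma=1$, $$\forall x,p\,\big(x\in\mathrm{dom}J_1\wedge p=_XJ_1x\to(x-p)\in Ap\big).$$ Further, $\mathcal V^\omega_p$ proves that the strong domain axiom implies strong extensionality of $J$: $$\forall x,x',\gamma^1,\gamma'^1\,\big(\gamma>0\wedge x\in\mathrm{dom}J_\gamma\wedge\gamma=_{\mathbb R}\gamma'\wedge x=_Xx'\to J_\gamma x=_XJ_{\gamma'}x'\big).$$ The same statements hold for $\mathcal T^\omega_p$. Over $\mathcal U^\omega_p$, extensionality of $A$ is equivalent to the strong domain axiom for all $\gamma>0$ with $\tilde\rho>-\gamma$, $$\forall\gamma^1,x\,\big(\gamma>0\wedge\tilde\rho>-\gamma\wedge\exists y,z(z\in Ay\wedge x=_Xy+\gamma z)\to\gamma^{-1}(x-J_\gamma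 x)\in A(J_\gamma x)\big),$$ together with the strong partial resolvent axiom for all $\gamma>0$ with $\tilde\rho>-\gamma$, $$\forall x,p,\gamma^1\,\big(\gamma>0\wedge\tilde\rho>-\gamma\wedge x\in\mathrm{dom}J_\gamma\wedge p=_XJ_\gamma x\to\gamma^{-1}(x-p)\in Ap\big),$$ and this strong domain axiom implies $$\forall x,x',\gamma^1,\gamma'^1\,\big(\gamma>0\wedge\tilde\rho>-\gamma\wedge x\in\mathrm{dom}J_\gamma\wedge\gamma=_{\mathbb R}\gamma'\wedge x=_Xx'\to J_\gamma x=_XJ_{\gamma'}x'\big).$$ The same claims hold over $\mathcal U^{*\omega}_p$ with $\tilde\rho>-\gamma/2$ in place of $\tilde\rho>-\gamma$ throughout. -/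

import Mathlib

namespace ProofMining

/-! ## Finite types over the ground types `0` and `X` -/

/-- The finite types `T^X`. The type written `τ(ρ)` in the literature is `ρ ⇒ τ` here. -/
inductive Ty : Type
  | nat : Ty
  | X : Ty
  | arr : Ty → Ty → Ty

infixr:60 " ⇒ " => Ty.arr

/-- The type `0` of natural numbers. -/
abbrev N : Ty := Ty.nat

/-- The abstract type `X`. -/
abbrev X : Ty := Ty.X

/-- The type `1 = 0(0)`; its objects represent real numbers. -/
abbrev N1 : Ty := N ⇒ N

/-- `arrows [ρ₁, …, ρₖ] τ` is the type `ρ₁ ⇒ … ⇒ ρₖ ⇒ τ`. -/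
abbrev arrows : List Ty → Ty → Ty
  | [], τ => τ
  | ρ :: ρs, τ => ρ ⇒ arrows ρs τ

/-- Typed de Bruijn variables: `Var Γ τ` are the variables of type `τ` declared in the list `Γ`. -/
inductive Var : List Ty → Ty → Type
  | z {Γ : List Ty} {τ : Ty} : Var (τ :: Γ) τ
  | s {Γ : List Ty} {σ τ : Ty} : Var Γ τ → Var (σ :: Γ) τ

namespace Var

def inl : {Γ : List Ty} → {τ : Ty} → (Δ : List Ty) → Var Γ τ → Var (Γ ++ Δ) τ
  | _, _, _, .z => .z
  | _, _, Δ, .s v => .s (inl Δ v)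

def inr : (Γ : List Ty) → {Δ : List Ty} → {τ : Ty} → Var Δ τ → Var (Γ ++ Δ) τ
  | [], _, _, v => v
  | _ :: Γ, _, _, v => .s (inr Γ v)

def map (F : Ty → Ty) : {Γ : List Ty} → {τ : Ty} → Var Γ τ → Var (Γ.map F) (F τ)
  | _, _, .z => .z
  | _, _, .s v => .s (map F v)

end Var

/-! ## Constants and terms -/

/-- The two languages: the one for accretive and monotone operators, and its extension for
`ρ`-comonotone operators. -/
inductive Lang : Type
  | accretive : Lang
  | comonotone : Lang

/-- The type of the `i`-th step functional of a simultaneous recursion of types `ρs`. -/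
abbrev stepTy (ρs : List Ty) (ρ : Ty) : Ty := arrows ρs (N ⇒ ρ)

/-- The constants, indexed by their type. -/
inductive Cn : Lang → Ty → Type
  | zero {L : Lang} : Cn L N
  | succ {L : Lang} : Cn L (N ⇒ N)
  /-- the combinator `Π` -/
  | K {L : Lang} (ρ τ : Ty) : Cn L (ρ ⇒ τ ⇒ ρ)
  /-- the combinator `Σ` -/
  | S {L : Lang} (δ ρ τ : Ty) : Cn L ((δ ⇒ ρ ⇒ τ) ⇒ (δ ⇒ ρ) ⇒ δ ⇒ τ)
  /-- the simultaneous recursor `(R_i)` for the tuple of types `ρs` -/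
  | R {L : Lang} (ρs : List Ty) {ρ : Ty} (i : Var ρs ρ) :
      Cn L (N ⇒ arrows ρs (arrows (ρs.map (stepTy ρs)) ρ))
  | zeroX {L : Lang} : Cn L X
  | oneX {L : Lang} : Cn L X
  | addX {L : Lang} : Cn L (X ⇒ X ⇒ X)
  | negX {L : Lang} : Cn L (X ⇒ X)
  | smulX {L : Lang} : Cn L (N1 ⇒ X ⇒ X)
  | normX {L : Lang} : Cn L (X ⇒ N1)
  /-- the characteristic function `χ_A` of the graph of the operator -/
  | chi {L : Lang} : Cn L (X ⇒ X ⇒ N)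
  /-- the resolvent `J` -/
  | J {L : Lang} : Cn L (N1 ⇒ X ⇒ X)
  /-- the index `γ̃` -/
  | gam {L : Lang} : Cn L N1
  /-- the number `m_γ̃` -/
  | mGam {L : Lang} : Cn L N
  /-- the point `c_X` -/
  | cX {L : Lang} : Cn L X
  /-- the name `ρ̃` of the comonotonicity parameter -/
  | rho : Cn Lang.comonotone N1
  /-- the number `n_γ̃` -/
  | nGam : Cn Lang.comonotone N

/-- Terms with free variables in `Γ`, built from variables and constants by application. -/
inductive Tm (L : Lang) (Γ : List Ty) : Ty → Type
  | var {τ : Ty} : Var Γ τ → Tm L Γ τ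
  | cn {τ : Ty} : Cn L τ → Tm L Γ τ
  | app {σ τ : Ty} : Tm L Γ (σ ⇒ τ) → Tm L Γ σ → Tm L Γ τ

infixl:100 " ⬝ " => Tm.app

/-- Simultaneous substitutions; also used for tuples of terms of types `Γ`. -/
abbrev Sub (L : Lang) (Γ Δ : List Ty) : Type := ∀ τ : Ty, Var Γ τ → Tm L Δ τ

variable {L : Lang} {Γ Δ : List Ty}

def Tm.subst (f : Sub L Γ Δ) : {τ : Ty} → Tm L Γ τ → Tm L Δ τ
  | _, .var v => f _ v
  | _, .cn c => .cn c
  | _, .app t u => .app (Tm.subst f t) (Tm.subst f u)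

/-- Weakening by one variable. -/
def Tm.shift {σ τ : Ty} (t : Tm L Γ τ) : Tm L (σ :: Γ) τ := t.subst fun _ v => .var (.s v)

namespace Sub

/-- The empty substitution. -/
def nil : Sub L [] Γ := fun _ v => nomatch v

/-- The substitution `t` for the variable `0`. -/
def inst {σ : Ty} (t : Tm L Γ σ) : Sub L (σ :: Γ) Γ
  | _, .z => t
  | _, .s v => .var v

/-- The substitution under a binder. -/
def lift {σ : Ty} (f : Sub L Γ Δ) : Sub L (σ :: Γ) (σ :: Δ)
  | _, .z => .var .z
  | _, .s v => (f _ v).shift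

def append {Θ : List Ty} : (Γ : List Ty) → Sub L Γ Θ → Sub L Δ Θ → Sub L (Γ ++ Δ) Θ
  | [], _, g => g
  | σ :: Γ, f, g => fun τ v =>
      match τ, v with
      | _, .z => f σ .z
      | τ, .s v => append Γ (fun τ v => f τ (.s v)) g τ v

end Sub

/-- Application of a term to a tuple of arguments. -/
def Tm.apps {τ : Ty} : (ρs : List Ty) → Tm L Γ (arrows ρs τ) → Sub L ρs Γ → Tm L Γ τ
  | [], t, _ => t
  | ρ :: ρs, t, a => Tm.apps ρs (t ⬝ a ρ .z) fun σ v => a σ (.s v)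

/-- A closed term, regarded as a term over `Γ`. -/
def cl {τ : Ty} (t : Tm L [] τ) : Tm L Γ τ := t.subst Sub.nil

/-- Abstraction `λx.t` of the variable `0`, defined from the combinators. -/
def lam {ρ : Ty} : {τ : Ty} → Tm L (ρ :: Γ) τ → Tm L Γ (ρ ⇒ τ)
  | _, .var .z => .cn (.S ρ (ρ ⇒ ρ) ρ) ⬝ .cn (.K ρ (ρ ⇒ ρ)) ⬝ .cn (.K ρ ρ)
  | τ, .var (.s v) => .cn (.K τ ρ) ⬝ .var v
  | τ, .cn c => .cn (.K τ ρ) ⬝ .cn c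
  | τ, .app (σ := σ) t u => .cn (.S ρ σ τ) ⬝ lam t ⬝ lam u

section Variables
variable {a b c d e : Ty}

def v0 : Tm L (a :: Γ) a := .var .z
def v1 : Tm L (a :: b :: Γ) b := .var (.s .z)
def v2 : Tm L (a :: b :: c :: Γ) c := .var (.s (.s .z))
def v3 : Tm L (a :: b :: c :: d :: Γ) d := .var (.s (.s (.s .z)))
def v4 : Tm L (a :: b :: c :: d :: e :: Γ) e := .var (.s (.s (.s (.s .z))))

end Variables

/-! ## Closed terms for arithmetic on natural numbers -/

def zero : Tm L Γ N := .cn .zero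

def succ (t : Tm L Γ N) : Tm L Γ N := .cn .succ ⬝ t

def num : ℕ → Tm L Γ N
  | 0 => zero
  | n + 1 => succ (num n)

/-- Recursion of type `0`; the step takes the previous value and the index. -/
def recN (n b : Tm L Γ N) (f : Tm L Γ (N ⇒ N ⇒ N)) : Tm L Γ N :=
  .app (.app (.cn (.R [N] .z) ⬝ n) b) f

def addT : Tm L [] (N ⇒ N ⇒ N) := lam (lam (recN v0 v1 (lam (lam (succ v1)))))
def add (s t : Tm L Γ N) : Tm L Γ N := cl addT ⬝ s ⬝ t

def mulT : Tm L [] (N ⇒ N ⇒ N) := lam (lam (recN v0 zero (lam (lam (add v1 v3)))))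
def mul (s t : Tm L Γ N) : Tm L Γ N := cl mulT ⬝ s ⬝ t

def predT : Tm L [] (N ⇒ N) := lam (recN v0 zero (lam (lam v0)))
def pred (s : Tm L Γ N) : Tm L Γ N := cl predT ⬝ s

/-- Truncated subtraction. -/
def monusT : Tm L [] (N ⇒ N ⇒ N) := lam (lam (recN v0 v1 (lam (lam (pred v1)))))
def monus (s t : Tm L Γ N) : Tm L Γ N := cl monusT ⬝ s ⬝ t

/-- `cond r s t` is `s` if `r = 0`, and `t` otherwise. -/
def condT : Tm L [] (N ⇒ N ⇒ N ⇒ N) := lam (lam (lam (recN v2 v1 (lam (lam v2)))))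
def cond (r s t : Tm L Γ N) : Tm L Γ N := cl condT ⬝ r ⬝ s ⬝ t

/-- The powers of `2`. -/
def pow2T : Tm L [] (N ⇒ N) := lam (recN v0 (num 1) (lam (lam (add v1 v1))))
def pow2 (s : Tm L Γ N) : Tm L Γ N := cl pow2T ⬝ s

/-- The remainder modulo `2`. -/
def parityT : Tm L [] (N ⇒ N) := lam (recN v0 zero (lam (lam (monus (num 1) v1))))
def parity (s : Tm L Γ N) : Tm L Γ N := cl parityT ⬝ s

/-- The quotient by `2`, rounded down. -/
def halfT : Tm L [] (N ⇒ N) := lam (recN v0 zero (lam (lam (add v1 (parity v0)))))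
def half (s : Tm L Γ N) : Tm L Γ N := cl halfT ⬝ s

/-- The pairing function `j(n,m) = ((n+m)² + 3n + m)/2`. -/
def pairT : Tm L [] (N ⇒ N ⇒ N) :=
  lam (lam (half
    (add (add (mul (add v1 v0) (add v1 v0)) (add v1 (add v1 v1))) v0)))
def pair (s t : Tm L Γ N) : Tm L Γ N := cl pairT ⬝ s ⬝ t

/-- The step functions of the simultaneous recursion that enumerates all pairs in the order of
their codes: `(n, m + 1)` is followed by `(n + 1, m)` and `(n, 0)` by `(0, n + 1)`. -/
def pairStep₁ : Tm L [] (N ⇒ N ⇒ N ⇒ N) := lam (lam (lam (cond v1 zero (succ v2))))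
def pairStep₂ : Tm L [] (N ⇒ N ⇒ N ⇒ N) := lam (lam (lam (cond v1 (succ v2) (pred v1))))

/-- The projections of `pair`. -/
def fstT : Tm L [] (N ⇒ N) :=
  lam (.app (.app (.app (.app (.cn (.R [N, N] .z) ⬝ v0) zero) zero) (cl pairStep₁)) (cl pairStep₂))
def fst (s : Tm L Γ N) : Tm L Γ N := cl fstT ⬝ s
def sndT : Tm L [] (N ⇒ N) :=
  lam (.app (.app (.app (.app (.cn (.R [N, N] (.s .z)) ⬝ v0) zero) zero)
    (cl pairStep₁)) (cl pairStep₂))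
def snd (s : Tm L Γ N) : Tm L Γ N := cl sndT ⬝ s

/-! ## Rational numbers
The number `j(n,m)` codes `(n/2)/(m+1)` if `n` is even and `-((n+1)/2)/(m+1)` if `n` is odd. -/

/-- The coded rational is `(qpos q - qneg q) / qden q`, where `qpos q = 0` or `qneg q = 0`. -/
def qposT : Tm L [] (N ⇒ N) := lam (cond (parity (fst v0)) (half (fst v0)) zero)
def qpos (q : Tm L Γ N) : Tm L Γ N := cl qposT ⬝ q
def qnegT : Tm L [] (N ⇒ N) := lam (cond (parity (fst v0)) zero (half (succ (fst v0))))
def qneg (q : Tm L Γ N) : Tm L Γ N := cl qnegT ⬝ q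
def qden (q : Tm L Γ N) : Tm L Γ N := succ (snd q)

/-- A code of `(a - b) / d`, for `d > 0`. -/
def qmkT : Tm L [] (N ⇒ N ⇒ N ⇒ N) :=
  lam (lam (lam (pair
    (cond (monus v1 v2) (mul (num 2) (monus v2 v1)) (pred (mul (num 2) (monus v1 v2))))
    (pred v0))))
def qmk (a b d : Tm L Γ N) : Tm L Γ N := cl qmkT ⬝ a ⬝ b ⬝ d

def qaddT : Tm L [] (N ⇒ N ⇒ N) :=
  lam (lam (qmk (add (mul (qpos v1) (qden v0)) (mul (qpos v0) (qden v1)))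
    (add (mul (qneg v1) (qden v0)) (mul (qneg v0) (qden v1))) (mul (qden v1) (qden v0))))
def qadd (q r : Tm L Γ N) : Tm L Γ N := cl qaddT ⬝ q ⬝ r

def qoppT : Tm L [] (N ⇒ N) := lam (qmk (qneg v0) (qpos v0) (qden v0))
def qopp (q : Tm L Γ N) : Tm L Γ N := cl qoppT ⬝ q

def qabsT : Tm L [] (N ⇒ N) := lam (qmk (add (qpos v0) (qneg v0)) zero (qden v0))
def qabs (q : Tm L Γ N) : Tm L Γ N := cl qabsT ⬝ q

def qmulT : Tm L [] (N ⇒ N ⇒ N) :=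
  lam (lam (qmk (add (mul (qpos v1) (qpos v0)) (mul (qneg v1) (qneg v0)))
    (add (mul (qpos v1) (qneg v0)) (mul (qneg v1) (qpos v0))) (mul (qden v1) (qden v0))))
def qmul (q r : Tm L Γ N) : Tm L Γ N := cl qmulT ⬝ q ⬝ r

/-- The reciprocal of a rational number (with value `0` at `0`). -/
def qinvT : Tm L [] (N ⇒ N) :=
  lam (qmk (cond (qpos v0) zero (qden v0)) (cond (qneg v0) zero (qden v0))
    (add (qpos v0) (qneg v0)))
def qinv (q : Tm L Γ N) : Tm L Γ N := cl qinvT ⬝ q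

/-- The characteristic term of `q ≤ r` on rational numbers: it is `0` if and only if `q ≤ r`. -/
def qleT : Tm L [] (N ⇒ N ⇒ N) :=
  lam (lam (monus (add (mul (qpos v1) (qden v0)) (mul (qneg v0) (qden v1)))
    (add (mul (qpos v0) (qden v1)) (mul (qneg v1) (qden v0)))))
def qleChar (q r : Tm L Γ N) : Tm L Γ N := cl qleT ⬝ q ⬝ r

/-- The characteristic term of `q < r` on rational numbers: it is `0` if and only if `q < r`. -/
def qltT : Tm L [] (N ⇒ N ⇒ N) :=
  lam (lam (monus (succ (add (mul (qpos v1) (qden v0)) (mul (qneg v0) (qden v1))))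
    (add (mul (qpos v0) (qden v1)) (mul (qneg v1) (qden v0)))))
def qltChar (q r : Tm L Γ N) : Tm L Γ N := cl qltT ⬝ q ⬝ r

/-- A code of `2⁻ⁿ`. -/
def q2neg (n : Tm L Γ N) : Tm L Γ N := qmk (num 1) zero (pow2 n)

/-! ## Real numbers
Every object of type `1` represents a real number, through the fast Cauchy sequence `hat f`. -/

/-- The largest `i ≤ n` such that `|f k - f (k+1)| < 2^(-k-1)` for all `k < i`. -/
def goodT : Tm L [] (N1 ⇒ N ⇒ N) :=
  lam (lam (recN v0 zero (lam (lam
    (cond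
      (add (monus v0 v1)
        (qltChar (qabs (qadd (v3 ⬝ v0) (qopp (v3 ⬝ succ v0)))) (q2neg (succ v0))))
      (succ v0) v1)))))

/-- `hat f n` is `f n` if `|f k - f (k+1)| < 2^(-k-1)` for all `k < n`, and `f k` for the least
`k < n` that violates this inequality otherwise. -/
def hatT : Tm L [] (N1 ⇒ N1) := lam (lam (v1 ⬝ (cl goodT ⬝ v1 ⬝ v0)))
def hat (f : Tm L Γ N1) (n : Tm L Γ N) : Tm L Γ N := cl hatT ⬝ f ⬝ n

/-- The real number given by a rational number: the constant sequence. -/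
def ratR (q : Tm L Γ N) : Tm L Γ N1 := .cn (.K N N) ⬝ q

def zeroR : Tm L Γ N1 := ratR (qmk zero zero (num 1))
def oneR : Tm L Γ N1 := ratR (qmk (num 1) zero (num 1))
def halfR : Tm L Γ N1 := ratR (qmk (num 1) zero (num 2))
def quarterR : Tm L Γ N1 := ratR (qmk (num 1) zero (num 4))
def twoR : Tm L Γ N1 := ratR (qmk (num 2) zero (num 1))

/-- The real number `2⁻ⁿ`. -/
def r2neg (n : Tm L Γ N) : Tm L Γ N1 := ratR (q2neg n)

def addRT : Tm L [] (N1 ⇒ N1 ⇒ N1) :=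
  lam (lam (lam (qadd (hat v2 (succ v0)) (hat v1 (succ v0)))))
def addR (f g : Tm L Γ N1) : Tm L Γ N1 := cl addRT ⬝ f ⬝ g

def negRT : Tm L [] (N1 ⇒ N1) := lam (lam (qopp (hat v1 v0)))
def negR (f : Tm L Γ N1) : Tm L Γ N1 := cl negRT ⬝ f

def subR (f g : Tm L Γ N1) : Tm L Γ N1 := addR f (negR g)

def absRT : Tm L [] (N1 ⇒ N1) := lam (lam (qabs (hat v1 v0)))
def absR (f : Tm L Γ N1) : Tm L Γ N1 := cl absRT ⬝ f

/-- The index shift that makes the product sequence a fast Cauchy sequence. -/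
def mulShiftT : Tm L [] (N1 ⇒ N1 ⇒ N) :=
  lam (lam (succ (add (add (qpos (hat v1 zero)) (qneg (hat v1 zero)))
    (add (qpos (hat v0 zero)) (qneg (hat v0 zero))))))

def mulRT : Tm L [] (N1 ⇒ N1 ⇒ N1) :=
  lam (lam (lam (qmul (hat v2 (add v0 (cl mulShiftT ⬝ v2 ⬝ v1)))
    (hat v1 (add v0 (cl mulShiftT ⬝ v2 ⬝ v1))))))
def mulR (f g : Tm L Γ N1) : Tm L Γ N1 := cl mulRT ⬝ f ⬝ g

/-- `invR f l` represents the reciprocal of the real number represented by `f` whenever the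
absolute value of the latter exceeds `2⁻ˡ`. -/
def invRT : Tm L [] (N1 ⇒ N ⇒ N1) :=
  lam (lam (lam (qinv (hat v2 (add v0 (succ (succ (add v1 v1))))))))
def invR (f : Tm L Γ N1) (l : Tm L Γ N) : Tm L Γ N1 := cl invRT ⬝ f ⬝ l

/-! ## Operations on `X` -/

def addX (x y : Tm L Γ X) : Tm L Γ X := .cn .addX ⬝ x ⬝ y
def negX (x : Tm L Γ X) : Tm L Γ X := .cn .negX ⬝ x
def subX (x y : Tm L Γ X) : Tm L Γ X := addX x (negX y)
def smulX (r : Tm L Γ N1) (x : Tm L Γ X) : Tm L Γ X := .cn .smulX ⬝ r ⬝ x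
def normX (x : Tm L Γ X) : Tm L Γ N1 := .cn .normX ⬝ x
def normSq (x : Tm L Γ X) : Tm L Γ N1 := mulR (normX x) (normX x)

/-- `⟨x,y⟩ = (‖x+y‖² - ‖x-y‖²)/4`. -/
def innerX (x y : Tm L Γ X) : Tm L Γ N1 :=
  mulR quarterR (subR (normSq (addX x y)) (normSq (subX x y)))

/-- The resolvent `J_γ x`. -/
def res (r : Tm L Γ N1) (x : Tm L Γ X) : Tm L Γ X := .cn .J ⬝ r ⬝ x

/-! ## Formulas -/

/-- Formulas with free variables in `Γ`; the only prime formulas are equations of type `0`. -/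
inductive Fm (L : Lang) : List Ty → Type
  | eq {Γ : List Ty} : Tm L Γ N → Tm L Γ N → Fm L Γ
  | and {Γ : List Ty} : Fm L Γ → Fm L Γ → Fm L Γ
  | or {Γ : List Ty} : Fm L Γ → Fm L Γ → Fm L Γ
  | imp {Γ : List Ty} : Fm L Γ → Fm L Γ → Fm L Γ
  | all {Γ : List Ty} (σ : Ty) : Fm L (σ :: Γ) → Fm L Γ
  | ex {Γ : List Ty} (σ : Ty) : Fm L (σ :: Γ) → Fm L Γ

infixr:35 " ⋏ " => Fm.and
infixr:25 " ⇾ " => Fm.imp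

/-- Capture-avoiding simultaneous substitution. -/
def Fm.subst : {Γ : List Ty} → Fm L Γ → {Δ : List Ty} → Sub L Γ Δ → Fm L Δ
  | _, .eq s t, _, f => .eq (s.subst f) (t.subst f)
  | _, .and A B, _, f => .and (A.subst f) (B.subst f)
  | _, .or A B, _, f => .or (A.subst f) (B.subst f)
  | _, .imp A B, _, f => .imp (A.subst f) (B.subst f)
  | _, .all σ A, _, f => .all σ (A.subst (Sub.lift f))
  | _, .ex σ A, _, f => .ex σ (A.subst (Sub.lift f))

def Fm.shift {σ : Ty} (A : Fm L Γ) : Fm L (σ :: Γ) := A.subst fun _ v => .var (.s v)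

/-- A sentence, regarded as a formula over `Γ`. -/
def Fm.cl (A : Fm L []) : Fm L Γ := A.subst Sub.nil

/-- Quantifier-free formulas. -/
def Fm.QF : {Γ : List Ty} → Fm L Γ → Prop
  | _, .eq _ _ => True
  | _, .and A B => A.QF ∧ B.QF
  | _, .or A B => A.QF ∧ B.QF
  | _, .imp A B => A.QF ∧ B.QF
  | _, .all _ _ => False
  | _, .ex _ _ => False

/-- Falsity is `0 = 1`. -/
def Fm.bot : Fm L Γ := .eq zero (num 1)

def Fm.neg (A : Fm L Γ) : Fm L Γ := A ⇾ .bot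

def Fm.iff (A B : Fm L Γ) : Fm L Γ := (A ⇾ B) ⋏ (B ⇾ A)

/-- Blocks of quantifiers. -/
def allCtx : (Δ : List Ty) → Fm L (Δ ++ Γ) → Fm L Γ
  | [], A => A
  | σ :: Δ, A => allCtx Δ (.all σ A)

def exCtx : (Δ : List Ty) → Fm L (Δ ++ Γ) → Fm L Γ
  | [], A => A
  | σ :: Δ, A => exCtx Δ (.ex σ A)

/-- `f <_ℝ g`. -/
def ltR (f g : Tm L Γ N1) : Fm L Γ :=
  .ex N (.eq (qleChar (q2neg v0)
    (qadd (hat g.shift (succ v0)) (qopp (hat f.shift (succ v0))))) zero)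

/-- `f ≤_ℝ g`. -/
def leR (f g : Tm L Γ N1) : Fm L Γ := (ltR g f).neg

/-- `f =_ℝ g`. -/
def eqR (f g : Tm L Γ N1) : Fm L Γ :=
  .all N (.eq (qltChar
    (qabs (qadd (hat f.shift (succ v0)) (qopp (hat g.shift (succ v0))))) (q2neg v0)) zero)

/-- Equality at all types: primitive at type `0`, `‖s - t‖ =_ℝ 0` at type `X`, and pointwise at
the higher types. -/
def eqT : (τ : Ty) → {Γ : List Ty} → Tm L Γ τ → Tm L Γ τ → Fm L Γ
  | .nat, _, s, t => .eq s t
  | .X, _, s, t => eqR (normX (subX s t)) zeroR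
  | .arr σ τ, _, s, t => .all σ (eqT τ (s.shift ⬝ v0) (t.shift ⬝ v0))

abbrev eqX (s t : Tm L Γ X) : Fm L Γ := eqT X s t

/-! ## Derivability -/

/-- The recursor `R_i n y z`. -/
def recT (ρs : List Ty) {ρ : Ty} (i : Var ρs ρ) (n : Tm L Γ N) (y : Sub L ρs Γ)
    (z : Sub L (ρs.map (stepTy ρs)) Γ) : Tm L Γ ρ :=
  Tm.apps (ρs.map (stepTy ρs)) (Tm.apps ρs (.cn (.R ρs i) ⬝ n) y) z

/-- The substitution that turns `A(x,y)` into `A(x, Y x)`, for tuples `x`, `y`, `Y`. -/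
def choiceSub (L : Lang) (xs ys Γ : List Ty) :
    Sub L (ys ++ (xs ++ Γ)) (xs ++ (ys.map (arrows xs) ++ Γ)) :=
  Sub.append ys
    (fun _ v => Tm.apps xs (.var (.inr xs (.inl Γ (v.map (arrows xs)))))
      fun _ w => .var (.inl _ w))
    (Sub.append xs (fun _ w => .var (.inl _ w))
      fun _ g => .var (.inr xs (.inr (ys.map (arrows xs)) g)))

/-- The substitution that turns `A(x,y,z)` into `A(x, f x, f (S x))`, for tuples `y`, `z`, `f`. -/
def depSub (L : Lang) (ρs Γ : List Ty) :
    Sub L (ρs ++ (ρs ++ (N :: Γ))) (N :: (ρs.map (Ty.arr N) ++ Γ)) :=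
  Sub.append ρs (fun _ v => .var (.s (.inl Γ (v.map (Ty.arr N)))) ⬝ succ v0)
    (Sub.append ρs (fun _ v => .var (.s (.inl Γ (v.map (Ty.arr N)))) ⬝ v0)
      fun _ g => match g with
        | .z => v0
        | .s g => .var (.s (.inr (ρs.map (Ty.arr N)) g)))

/-- `Prf T H A`: the formula `A` is derivable from the hypotheses `H` in the theory with the
nonlogical sentences `T` over `WE-PA^ω + QF-AC + DC` formulated for all types of `T^X`.
The logic is classical natural deduction; the weak rule of extensionality `qfER` applies only to
premises that are derived without open hypotheses. -/
inductive Prf (T : Set (Fm L [])) : {Γ : List Ty} → List (Fm L Γ) → Fm L Γ → Prop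
  -- logic
  | hyp {Γ : List Ty} {H : List (Fm L Γ)} {A : Fm L Γ} : A ∈ H → Prf T H A
  | andI {Γ : List Ty} {H : List (Fm L Γ)} {A B : Fm L Γ} :
      Prf T H A → Prf T H B → Prf T H (.and A B)
  | andE₁ {Γ : List Ty} {H : List (Fm L Γ)} {A B : Fm L Γ} : Prf T H (.and A B) → Prf T H A
  | andE₂ {Γ : List Ty} {H : List (Fm L Γ)} {A B : Fm L Γ} : Prf T H (.and A B) → Prf T H B
  | orI₁ {Γ : List Ty} {H : List (Fm L Γ)} {A B : Fm L Γ} : Prf T H A → Prf T H (.or A B)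
  | orI₂ {Γ : List Ty} {H : List (Fm L Γ)} {A B : Fm L Γ} : Prf T H B → Prf T H (.or A B)
  | orE {Γ : List Ty} {H : List (Fm L Γ)} {A B C : Fm L Γ} :
      Prf T H (.or A B) → Prf T (A :: H) C → Prf T (B :: H) C → Prf T H C
  | impI {Γ : List Ty} {H : List (Fm L Γ)} {A B : Fm L Γ} :
      Prf T (A :: H) B → Prf T H (.imp A B)
  | impE {Γ : List Ty} {H : List (Fm L Γ)} {A B : Fm L Γ} :
      Prf T H (.imp A B) → Prf T H A → Prf T H B
  | raa {Γ : List Ty} {H : List (Fm L Γ)} {A : Fm L Γ} :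
      Prf T (A.neg :: H) .bot → Prf T H A
  | allI {Γ : List Ty} {H : List (Fm L Γ)} {σ : Ty} {A : Fm L (σ :: Γ)} :
      Prf T (H.map Fm.shift) A → Prf T H (.all σ A)
  | allE {Γ : List Ty} {H : List (Fm L Γ)} {σ : Ty} {A : Fm L (σ :: Γ)} (t : Tm L Γ σ) :
      Prf T H (.all σ A) → Prf T H (A.subst (Sub.inst t))
  | exI {Γ : List Ty} {H : List (Fm L Γ)} {σ : Ty} {A : Fm L (σ :: Γ)} (t : Tm L Γ σ) :
      Prf T H (A.subst (Sub.inst t)) → Prf T H (.ex σ A)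
  | exE {Γ : List Ty} {H : List (Fm L Γ)} {σ : Ty} {A : Fm L (σ :: Γ)} {C : Fm L Γ} :
      Prf T H (.ex σ A) → Prf T (A :: H.map Fm.shift) C.shift → Prf T H C
  -- equality of type 0, successor, induction
  | eqRefl {Γ : List Ty} {H : List (Fm L Γ)} (s : Tm L Γ N) : Prf T H (.eq s s)
  | eqSymm {Γ : List Ty} {H : List (Fm L Γ)} (s t : Tm L Γ N) :
      Prf T H (.imp (.eq s t) (.eq t s))
  | eqTrans {Γ : List Ty} {H : List (Fm L Γ)} (r s t : Tm L Γ N) :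
      Prf T H (.imp (.and (.eq r s) (.eq s t)) (.eq r t))
  | succNe {Γ : List Ty} {H : List (Fm L Γ)} (s : Tm L Γ N) :
      Prf T H (Fm.neg (.eq (succ s) zero))
  | succInj {Γ : List Ty} {H : List (Fm L Γ)} (s t : Tm L Γ N) :
      Prf T H (.imp (.eq (succ s) (succ t)) (.eq s t))
  | induction {Γ : List Ty} {H : List (Fm L Γ)} (A : Fm L (N :: Γ)) :
      Prf T H (.imp
        (.and (A.subst (Sub.inst zero))
          (.all N (.imp A (A.subst fun _ v => match v with
            | .z => succ v0
            | .s v => .var (.s v)))))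
        (.all N A))
  -- combinators and simultaneous recursion
  | combK {Γ : List Ty} {H : List (Fm L Γ)} {ρ τ : Ty} (s : Tm L Γ ρ) (t : Tm L Γ τ) :
      Prf T H (eqT ρ (.cn (.K ρ τ) ⬝ s ⬝ t) s)
  | combS {Γ : List Ty} {H : List (Fm L Γ)} {δ ρ τ : Ty}
      (r : Tm L Γ (δ ⇒ ρ ⇒ τ)) (s : Tm L Γ (δ ⇒ ρ)) (t : Tm L Γ δ) :
      Prf T H (eqT τ (.cn (.S δ ρ τ) ⬝ r ⬝ s ⬝ t) (r ⬝ t ⬝ (s ⬝ t)))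
  | recZero {Γ : List Ty} {H : List (Fm L Γ)} (ρs : List Ty) {ρ : Ty} (i : Var ρs ρ)
      (y : Sub L ρs Γ) (z : Sub L (ρs.map (stepTy ρs)) Γ) :
      Prf T H (eqT ρ (recT ρs i zero y z) (y ρ i))
  | recSucc {Γ : List Ty} {H : List (Fm L Γ)} (ρs : List Ty) {ρ : Ty} (i : Var ρs ρ)
      (n : Tm L Γ N) (y : Sub L ρs Γ) (z : Sub L (ρs.map (stepTy ρs)) Γ) :
      Prf T H (eqT ρ (recT ρs i (succ n) y z)
        (Tm.apps ρs (z _ (i.map (stepTy ρs))) (fun _ k => recT ρs k n y z) ⬝ n))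
  -- the quantifier-free rule of extensionality
  | qfER {Γ : List Ty} {H : List (Fm L Γ)} {ρ τ : Ty} {A : Fm L Γ} (hA : A.QF)
      (s t : Tm L Γ ρ) (r : Tm L (ρ :: Γ) τ) :
      Prf T [] (.imp A (eqT ρ s t)) →
      Prf T H (.imp A (eqT τ (r.subst (Sub.inst s)) (r.subst (Sub.inst t))))
  -- quantifier-free choice and dependent choice, for tuples
  | qfAC {Γ : List Ty} {H : List (Fm L Γ)} (xs ys : List Ty) (A : Fm L (ys ++ (xs ++ Γ)))
      (hA : A.QF) :
      Prf T H (.imp (allCtx xs (exCtx ys A))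
        (exCtx (ys.map (arrows xs)) (allCtx xs (A.subst (choiceSub L xs ys Γ)))))
  | dc {Γ : List Ty} {H : List (Fm L Γ)} (ρs : List Ty) (A : Fm L (ρs ++ (ρs ++ (N :: Γ)))) :
      Prf T H (.imp (.all N (allCtx ρs (exCtx ρs A)))
        (exCtx (ρs.map (Ty.arr N)) (.all N (A.subst (depSub L ρs Γ)))))
  -- nonlogical sentences
  | ax {Γ : List Ty} {H : List (Fm L Γ)} {A : Fm L []} : A ∈ T → Prf T H A.cl

/-- Provability of a sentence in a theory. -/
def Provable (T : Set (Fm L [])) (A : Fm L []) : Prop := Prf T [] A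

/-! ## Normed spaces and inner product spaces -/

/-- The sentences stating that `X` is a real normed space with a vector of norm one. -/
def normedSpace (L : Lang) : Set (Fm L []) :=
  { A | A ∈ ([
    -- ∀ x y z, (x + y) + z = x + (y + z)
    .all X (.all X (.all X (eqX (addX (addX v2 v1) v0) (addX v2 (addX v1 v0))))),
    -- ∀ x y, x + y = y + x
    .all X (.all X (eqX (addX v1 v0) (addX v0 v1))),
    -- ∀ x, x + 0 = x
    .all X (eqX (addX v0 (.cn .zeroX)) v0),
    -- ∀ x, x + (-x) = 0
    .all X (eqX (addX v0 (negX v0)) (.cn .zeroX)),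
    -- ∀ α x y, α (x + y) = α x + α y
    .all N1 (.all X (.all X (eqX (smulX v2 (addX v1 v0)) (addX (smulX v2 v1) (smulX v2 v0))))),
    -- ∀ α β x, (α + β) x = α x + β x
    .all N1 (.all N1 (.all X (eqX (smulX (addR v2 v1) v0) (addX (smulX v2 v0) (smulX v1 v0))))),
    -- ∀ α β x, (α β) x = α (β x)
    .all N1 (.all N1 (.all X (eqX (smulX (mulR v2 v1) v0) (smulX v2 (smulX v1 v0))))),
    -- ∀ x, 1 x = x
    .all X (eqX (smulX oneR v0) v0),
    -- ∀ x, ‖x - x‖ = 0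
    .all X (eqR (normX (subX v0 v0)) zeroR),
    -- ∀ x y, ‖x - y‖ = ‖y - x‖
    .all X (.all X (eqR (normX (subX v1 v0)) (normX (subX v0 v1)))),
    -- ∀ x y z, ‖x - z‖ ≤ ‖x - y‖ + ‖y - z‖
    .all X (.all X (.all X
      (leR (normX (subX v2 v0)) (addR (normX (subX v2 v1)) (normX (subX v1 v0)))))),
    -- ∀ α x y, ‖α x - α y‖ = |α| ‖x - y‖
    .all N1 (.all X (.all X
      (eqR (normX (subX (smulX v2 v1) (smulX v2 v0))) (mulR (absR v2) (normX (subX v1 v0)))))),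
    -- ∀ α β x, ‖α x - β x‖ = |α - β| ‖x‖
    .all N1 (.all N1 (.all X
      (eqR (normX (subX (smulX v2 v0) (smulX v1 v0))) (mulR (absR (subR v2 v1)) (normX v0))))),
    -- ∀ x y u v, ‖(x + y) - (u + v)‖ ≤ ‖x - u‖ + ‖y - v‖
    .all X (.all X (.all X (.all X
      (leR (normX (subX (addX v3 v2) (addX v1 v0)))
        (addR (normX (subX v3 v1)) (normX (subX v2 v0))))))),
    -- ∀ x y, ‖(-x) - (-y)‖ = ‖x - y‖
    .all X (.all X (eqR (normX (subX (negX v1) (negX v0))) (normX (subX v1 v0)))),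
    -- ∀ x y, |‖x‖ - ‖y‖| ≤ ‖x - y‖
    .all X (.all X (leR (absR (subR (normX v1) (normX v0))) (normX (subX v1 v0)))),
    -- ‖1_X‖ = 1
    eqR (normX (.cn .oneX)) oneR] : List (Fm L [])) }

/-- The parallelogram law `∀ x y, ‖x + y‖² + ‖x - y‖² = 2 (‖x‖² + ‖y‖²)`. -/
def parallelogram : Fm L [] :=
  .all X (.all X (eqR (addR (normSq (addX v1 v0)) (normSq (subX v1 v0)))
    (mulR twoR (addR (normSq v1) (normSq v0)))))

/-! ## The operator and its partial resolvent
A statement about `γ⁻¹` for `γ > 0` is read with an additional universally quantified number `l`,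
the premise `γ > 2⁻ˡ` in place of `γ > 0`, and `invR γ l` for `γ⁻¹`. -/

/-- `u ∈ A x`. -/
def mem (u x : Tm L Γ X) : Fm L Γ := .eq (.cn .chi ⬝ x ⬝ u) zero

/-- `γ > 2⁻ˡ`. -/
def posW (r : Tm L Γ N1) (l : Tm L Γ N) : Fm L Γ := ltR (r2neg l) r

/-- `γ⁻¹ (x - p) ∈ A p`. -/
def resIn (r : Tm L Γ N1) (l : Tm L Γ N) (x p : Tm L Γ X) : Fm L Γ :=
  mem (smulX (invR r l) (subX x p)) p

/-- `x ∈ dom J_γ`, that is, `∃ y, γ⁻¹ (x - y) ∈ A y`. -/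
def domJ (r : Tm L Γ N1) (l : Tm L Γ N) (x : Tm L Γ X) : Fm L Γ :=
  .ex X (resIn r.shift l.shift x.shift v0)

/-- The strong form of the domain of `J_γ`: `∃ y z, z ∈ A y ∧ x = y + γ z`. -/
def strongDomJ (r : Tm L Γ N1) (x : Tm L Γ X) : Fm L Γ :=
  .ex X (.ex X (mem v0 v1 ⋏ eqX x.shift.shift (addX v1 (smulX r.shift.shift v0))))

/-- `∀ x y, χ_A x y ≤ 1`. -/
def chiLeOne : Fm L [] :=
  .all X (.all X (.eq (monus (.cn .chi ⬝ v1 ⬝ v0) (num 1)) zero))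

/-- `∀ γ x, γ > 0 ∧ x ∈ dom J_γ → γ⁻¹ (x - J_γ x) ∈ A (J_γ x)`. -/
def partialRes : Fm L [] :=
  .all N1 (.all X (.all N (posW v2 v0 ⋏ domJ v2 v0 v1 ⇾ resIn v2 v0 v1 (res v2 v1))))

/-- `∀ x y u v λ, u ∈ A x ∧ v ∈ A y → ‖x - y + |λ| (u - v)‖ ≥ ‖x - y‖`. -/
def accretivity : Fm L [] :=
  .all X (.all X (.all X (.all X (.all N1 (mem v2 v4 ⋏ mem v1 v3 ⇾
    leR (normX (subX v4 v3))
      (normX (addX (subX v4 v3) (smulX (absR v0) (subX v2 v1)))))))))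

/-- `γ̃ ≥ 2^(-m_γ̃)`. -/
def gamPos : Fm L [] := leR (r2neg (.cn .mGam)) (.cn .gam)

/-- `∀ γ, γ > 0 → γ⁻¹ (c_X - J_γ c_X) ∈ A (J_γ c_X)`. -/
def anchor : Fm L [] :=
  .all N1 (.all N (posW v1 v0 ⇾ resIn v1 v0 (.cn .cX) (res v1 (.cn .cX))))

/-- The theory `V_p = A^ω[X,‖·‖,A,J^A]_p` of accretive operators with partial resolvents. -/
def Vp : Set (Fm .accretive []) :=
  normedSpace .accretive ∪ {chiLeOne, partialRes, accretivity, gamPos, anchor}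

/-- The theory `T_p = A^ω[X,⟨·,·⟩,A,J^A]_p` of monotone operators with partial resolvents. -/
def Tp : Set (Fm .accretive []) := Vp ∪ {parallelogram}

/-- `∀ x y u v, u ∈ A x ∧ v ∈ A y → ⟨x - y, u - v⟩ ≥ ρ̃ ‖u - v‖²`. -/
def comonotonicity : Fm .comonotone [] :=
  .all X (.all X (.all X (.all X (mem v1 v3 ⋏ mem v0 v2 ⇾
    leR (mulR (.cn .rho) (normSq (subX v1 v0))) (innerX (subX v3 v2) (subX v1 v0))))))

/-- `ρ̃ > -γ`. -/
def rhoGt (Γ : List Ty) (r : Tm .comonotone Γ N1) : Fm .comonotone Γ :=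
  ltR (negR r) (.cn .rho)

/-- `ρ̃ > -γ/2`. -/
def rhoGtHalf (Γ : List Ty) (r : Tm .comonotone Γ N1) : Fm .comonotone Γ :=
  ltR (negR (mulR r halfR)) (.cn .rho)

/-- `ρ̃ ≥ -γ̃ + 2^(-n_γ̃)`. -/
def rhoGam : Fm .comonotone [] :=
  leR (addR (negR (.cn .gam)) (r2neg (.cn .nGam))) (.cn .rho)

/-- `ρ̃ ≥ -γ̃/2 + 2^(-n_γ̃)`. -/
def rhoGamHalf : Fm .comonotone [] :=
  leR (addR (negR (mulR (.cn .gam) halfR)) (r2neg (.cn .nGam))) (.cn .rho)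

/-- `∀ γ x, ρ̃ > -γ/2 ∧ γ > 0 ∧ x ∈ dom J_γ → γ⁻¹ (x - J_γ x) ∈ A (J_γ x)`. -/
def partialResHalf : Fm .comonotone [] :=
  .all N1 (.all X (.all N (rhoGtHalf _ v2 ⋏ posW v2 v0 ⋏ domJ v2 v0 v1 ⇾
    resIn v2 v0 v1 (res v2 v1))))

/-- `∀ γ, γ > 0 ∧ ρ̃ > -γ/2 → γ⁻¹ (c_X - J_γ c_X) ∈ A (J_γ c_X)`. -/
def anchorHalf : Fm .comonotone [] :=
  .all N1 (.all N (posW v1 v0 ⋏ rhoGtHalf _ v1 ⇾ resIn v1 v0 (.cn .cX) (res v1 (.cn .cX))))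

/-- The theory `U_p = A^ω[X,⟨·,·⟩,A,J^A,ρ̃]_p` of comonotone operators with partial resolvents. -/
def Up : Set (Fm .comonotone []) :=
  normedSpace .comonotone ∪
    {parallelogram, chiLeOne, partialRes, comonotonicity, gamPos, rhoGam, anchor}

/-- The theory `U*_p = A^ω[X,⟨·,·⟩,A,J^A,ρ̃*]_p`, in which resolvents are only specified for
`ρ̃ > -γ/2`. -/
def Ustarp : Set (Fm .comonotone []) :=
  normedSpace .comonotone ∪
    {parallelogram, chiLeOne, partialResHalf, comonotonicity, gamPos, rhoGamHalf, anchorHalf}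

/-! ## The principles -/

/-- Extensionality of `A`: `∀ x y x' y', x = x' ∧ y = y' → χ_A x y = χ_A x' y'`. -/
def extA : Fm L [] :=
  .all X (.all X (.all X (.all X (eqX v3 v1 ⋏ eqX v2 v0 ⇾
    .eq (.cn .chi ⬝ v3 ⬝ v2) (.cn .chi ⬝ v1 ⬝ v0)))))

/-- The strong domain principle:
`∀ γ x, γ > 0 ∧ ∃ y z (z ∈ A y ∧ x = y + γ z) → γ⁻¹ (x - J_γ x) ∈ A (J_γ x)`. -/
def strongDomain : Fm L [] :=
  .all N1 (.all X (.all N (posW v2 v0 ⋏ strongDomJ v2 v1 ⇾ resIn v2 v0 v1 (res v2 v1))))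

/-- The strong partial resolvent principle:
`∀ x p γ, γ > 0 ∧ x ∈ dom J_γ ∧ p = J_γ x → |γ|⁻¹ (x - p) ∈ A p`. -/
def strongPartialRes : Fm L [] :=
  .all X (.all X (.all N1 (.all N (posW v1 v0 ⋏ domJ v1 v0 v3 ⋏ eqX v2 (res v1 v3) ⇾
    resIn (absR v1) v0 v3 v2))))

/-- The strong domain principle for `γ = 1`:
`∀ x, ∃ y z (z ∈ A y ∧ x = y + z) → (x - J_1 x) ∈ A (J_1 x)`. -/
def strongDomainOne : Fm L [] :=
  .all X (.ex X (.ex X (mem v0 v1 ⋏ eqX v2 (addX v1 v0))) ⇾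
    mem (subX v0 (res oneR v0)) (res oneR v0))

/-- The strong partial resolvent principle for `γ = 1`:
`∀ x p, x ∈ dom J_1 ∧ p = J_1 x → (x - p) ∈ A p`. -/
def strongPartialResOne : Fm L [] :=
  .all X (.all X (.all N (posW oneR v0 ⋏ domJ oneR v0 v2 ⋏ eqX v1 (res oneR v2) ⇾
    mem (subX v2 v1) v1)))

/-- Strong extensionality of `J`:
`∀ x x' γ γ', γ > 0 ∧ x ∈ dom J_γ ∧ γ = γ' ∧ x = x' → J_γ x = J_γ' x'`. -/
def strongExtJ : Fm L [] :=
  .all X (.all X (.all N1 (.all N1 (.all N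
    (posW v2 v0 ⋏ domJ v2 v0 v4 ⋏ eqR v2 v1 ⋏ eqX v4 v3 ⇾
      eqX (res v2 v4) (res v1 v3))))))

/-- A condition on an index of the resolvent. -/
abbrev IndexCond : Type := ∀ Γ : List Ty, Tm .comonotone Γ N1 → Fm .comonotone Γ

/-- The strong domain principle for all `γ > 0` with the property `C`. -/
def strongDomainOn (C : IndexCond) : Fm .comonotone [] :=
  .all N1 (.all X (.all N (posW v2 v0 ⋏ C _ v2 ⋏ strongDomJ v2 v1 ⇾
    resIn v2 v0 v1 (res v2 v1))))

/-- The strong partial resolvent principle for all `γ > 0` with the property `C`. -/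
def strongPartialResOn (C : IndexCond) : Fm .comonotone [] :=
  .all X (.all X (.all N1 (.all N
    (posW v1 v0 ⋏ C _ v1 ⋏ domJ v1 v0 v3 ⋏ eqX v2 (res v1 v3) ⇾ resIn v1 v0 v3 v2))))

/-- Strong extensionality of `J` for all `γ > 0` with the property `C`. -/
def strongExtJOn (C : IndexCond) : Fm .comonotone [] :=
  .all X (.all X (.all N1 (.all N1 (.all N
    (posW v2 v0 ⋏ C _ v2 ⋏ domJ v2 v0 v4 ⋏ eqR v2 v1 ⋏ eqX v4 v3 ⇾
      eqX (res v2 v4) (res v1 v3))))))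

end ProofMining

open ProofMining

namespace ProofMining

variable {L : Lang} {Γ Δ : List Ty}

/-! ## Substitution -/

/-! The mathematical core is short. If `u ∈ Ap`, `v ∈ Aq` and `p + γu = q + γv`, then `p = q`: by
accretivity with `λ = γ`, or by comonotonicity as soon as `ρ̃ > -γ` (`uniqueAt_of_accretivity`,
`uniqueAt_of_comonotonicity`). Extensionality of `A` clearly upgrades the axiom on partial
resolvents to the strong principles. Conversely, let `x = x'`, `y = y'` and `y ∈ Ax`, and put `w =
x' + γy'`. Since `w = x + γy`, the strong domain principle gives `γ⁻¹(w - J_γ w) ∈ A(J_γ w)`;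
uniqueness gives `J_γ w = x = x'`; the strong partial resolvent principle then gives `γ⁻¹(w - x') ∈
Ax'`. What remains is to replace `γ⁻¹((x' + γy') - x')` by `y'` inside `χ_A`, before extensionality
is available. For a closed index that is provably positive this equation is derivable without
hypotheses, so the quantifier-free rule of extensionality performs the replacement
(`extA_of_strong`). The index is `1` in the accretive case (`lit_one`) and `γ̃` in the comonotone
case (`lit_gam`), where `1` may violate the condition on `ρ̃`. Strong extensionality of `J` follows
from `x' = J_γ x + γ'(γ⁻¹(x - J_γ x))`, the strong domain principle at `γ'`, and uniqueness
(`StrongDomainAt.ext`).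

The bulk of the work replaces formal derivations by arguments in models, through a completeness
theorem (`Prf.complete`). The models are Henkin term models in which two terms are identified when
no numerical context distinguishes them. The rule of extensionality then says that terms which are
provably equal under a true quantifier-free assumption denote the same element (`Model.leib`), and
by completeness it is enough to check such an equation in all models (`Model.ev_eq_of_forall`).

The natural numbers of a model may be nonstandard, but internal induction makes them a discretely
ordered semiring. It is embedded in an ordered field, and that field in one where Cauchy functions
indexed by the natural numbers of the model converge. Each object of type `1` receives a value
there, and the closed terms for real arithmetic and the formulas `<_ℝ`, `=_ℝ` translate into field
operations and order (`val_addR`, `val_mulR`, `val_invR`, `sat_ltR`, `sat_eqR`). Finally `X` modulo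
`=_X` becomes a normed abelian group with scalar multiplication, in which the core argument is
ordinary algebra. -/

theorem Tm.subst_subst {Θ : List Ty} (f : Sub L Γ Δ) (g : Sub L Δ Θ) {τ : Ty} (t : Tm L Γ τ) :
    (t.subst f).subst g = t.subst fun τ v => (f τ v).subst g := by
  induction t with
  | var v => rfl
  | cn c => rfl
  | app t u iht ihu => simp only [Tm.subst, iht, ihu]

theorem Tm.subst_id {τ : Ty} (t : Tm L Γ τ) : t.subst (fun _ v => .var v) = t := by
  induction t with
  | var v => rfl
  | cn c => rfl
  | app t u iht ihu => simp only [Tm.subst, iht, ihu]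

theorem Tm.shift_subst_lift {σ τ : Ty} (f : Sub L Γ Δ) (t : Tm L Γ τ) :
    (t.shift (σ := σ)).subst (Sub.lift f) = (t.subst f).shift := by
  simp only [Tm.shift, Tm.subst_subst]; rfl

theorem Tm.shift_inst {σ τ : Ty} (u : Tm L Γ σ) (t : Tm L Γ τ) :
    t.shift.subst (Sub.inst u) = t := by
  simp only [Tm.shift, Tm.subst_subst]; exact t.subst_id

@[simp]
theorem cl_subst {τ : Ty} (t : Tm L [] τ) (f : Sub L Γ Δ) : (cl t).subst f = cl t := by
  simp only [cl, Tm.subst_subst]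
  congr 1; funext τ v; cases v

theorem Sub.lift_comp {Θ : List Ty} {σ : Ty} (f : Sub L Γ Δ) (g : Sub L Δ Θ) :
    (fun τ v => (Sub.lift (σ := σ) f τ v).subst (Sub.lift g)) =
      Sub.lift fun τ v => (f τ v).subst g := by
  funext τ v
  cases v with
  | z => rfl
  | s v => exact Tm.shift_subst_lift g _

theorem Sub.lift_id {σ : Ty} :
    Sub.lift (fun _ v => .var v : Sub L Γ Γ) = (fun _ v => .var v : Sub L (σ :: Γ) (σ :: Γ)) := by
  funext τ v
  cases v <;> rfl

theorem Fm.subst_subst (A : Fm L Γ) {Δ Θ : List Ty} (f : Sub L Γ Δ) (g : Sub L Δ Θ) :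
    (A.subst f).subst g = A.subst fun τ v => (f τ v).subst g := by
  induction A generalizing Δ Θ with
  | eq s t => simp only [Fm.subst, Tm.subst_subst]
  | and A B ihA ihB => simp only [Fm.subst, ihA, ihB]
  | or A B ihA ihB => simp only [Fm.subst, ihA, ihB]
  | imp A B ihA ihB => simp only [Fm.subst, ihA, ihB]
  | all σ A ih => simp only [Fm.subst, ih, Sub.lift_comp]
  | ex σ A ih => simp only [Fm.subst, ih, Sub.lift_comp]

theorem Fm.subst_id (A : Fm L Γ) : A.subst (fun _ v => .var v) = A := by
  induction A with
  | eq s t => simp only [Fm.subst, Tm.subst_id]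
  | and A B ihA ihB => simp only [Fm.subst, ihA, ihB]
  | or A B ihA ihB => simp only [Fm.subst, ihA, ihB]
  | imp A B ihA ihB => simp only [Fm.subst, ihA, ihB]
  | all σ A ih => simp only [Fm.subst, Sub.lift_id, ih]
  | ex σ A ih => simp only [Fm.subst, Sub.lift_id, ih]

theorem Fm.shift_subst_lift {σ : Ty} (f : Sub L Γ Δ) (A : Fm L Γ) :
    (A.shift (σ := σ)).subst (Sub.lift f) = (A.subst f).shift := by
  simp only [Fm.shift, Fm.subst_subst]; rfl

theorem Fm.shift_inst {σ : Ty} (u : Tm L Γ σ) (A : Fm L Γ) : A.shift.subst (Sub.inst u) = A := by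
  simp only [Fm.shift, Fm.subst_subst]; exact A.subst_id

theorem Sub.lift_inst {σ : Ty} (f : Sub L Γ Δ) (t : Tm L Γ σ) :
    (fun τ v => (Sub.inst t τ v).subst f) =
      fun τ v => (Sub.lift f τ v).subst (Sub.inst (t.subst f)) := by
  funext τ v
  cases v with
  | z => rfl
  | s v => exact (Tm.shift_inst _ _).symm

theorem Fm.inst_subst {σ : Ty} (f : Sub L Γ Δ) (A : Fm L (σ :: Γ)) (t : Tm L Γ σ) :
    (A.subst (Sub.inst t)).subst f = (A.subst (Sub.lift f)).subst (Sub.inst (t.subst f)) := by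
  simp only [Fm.subst_subst, Sub.lift_inst]

theorem Tm.inst_subst {σ τ : Ty} (f : Sub L Γ Δ) (r : Tm L (σ :: Γ) τ) (t : Tm L Γ σ) :
    (r.subst (Sub.inst t)).subst f = (r.subst (Sub.lift f)).subst (Sub.inst (t.subst f)) := by
  simp only [Tm.subst_subst, Sub.lift_inst]

theorem Fm.QF.subst {A : Fm L Γ} (h : A.QF) {Δ : List Ty} (f : Sub L Γ Δ) : (A.subst f).QF := by
  induction A generalizing Δ with
  | eq s t => trivial
  | and A B ihA ihB => exact ⟨ihA h.1 f, ihB h.2 f⟩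
  | or A B ihA ihB => exact ⟨ihA h.1 f, ihB h.2 f⟩
  | imp A B ihA ihB => exact ⟨ihA h.1 f, ihB h.2 f⟩
  | all σ A ih => exact h.elim
  | ex σ A ih => exact h.elim

theorem eqR_subst (f : Sub L Γ Δ) (s t : Tm L Γ N1) :
    (eqR s t).subst f = eqR (s.subst f) (t.subst f) := by
  simp only [eqR, Fm.subst, qltChar, qabs, qadd, qopp, q2neg, qmk, hat, pow2, succ, zero, num, v0,
    Tm.subst, cl_subst, Tm.shift_subst_lift, Sub.lift]

/-- Besides the two sides, an equality formula contains only closed terms and the bound variables it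
introduces. This lets the axioms for combinators and recursors and the extensionality rule be
instantiated freely. -/
theorem eqT_subst {τ : Ty} (f : Sub L Γ Δ) (s t : Tm L Γ τ) :
    (eqT τ s t).subst f = eqT τ (s.subst f) (t.subst f) := by
  induction τ generalizing Γ Δ with
  | nat => rfl
  | X =>
    simp only [eqT, eqR_subst, zeroR, ratR, qmk, num, zero, succ, normX, subX, addX, negX,
      Tm.subst, cl_subst]
  | arr σ τ _ ih => simp only [eqT, Fm.subst, ih, Tm.subst, Tm.shift_subst_lift, v0, Sub.lift]

/-! ## Derivability that is stable under substitution and weakening -/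

/-- `RPrf T H A`: all substitution instances of `A` are derivable from the corresponding instances
of `H`, and possibly more hypotheses. -/
def RPrf (T : Set (Fm L [])) (H : List (Fm L Γ)) (A : Fm L Γ) : Prop :=
  ∀ (Δ : List Ty) (f : Sub L Γ Δ) (H' : List (Fm L Δ)), (∀ B ∈ H, B.subst f ∈ H') →
    Prf T H' (A.subst f)

namespace RPrf

variable {T : Set (Fm L [])} {H : List (Fm L Γ)} {A B C : Fm L Γ}

/-- The identity substitution recovers plain derivability. Building stability into the notion avoids
an induction over derivations; each rule that is needed is reproved in stable form below. The two
choice schemata are not among them. -/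
theorem prf (h : RPrf T H A) : Prf T H A := by
  have := h Γ (fun _ v => .var v) H fun B hB => by rwa [B.subst_id]
  rwa [A.subst_id] at this

theorem mono {H' : List (Fm L Γ)} (h : RPrf T H A) (hH : ∀ B ∈ H, B ∈ H') : RPrf T H' A :=
  fun Δ f K hK => h Δ f K fun B hB => hK B (hH B hB)

theorem subst (h : RPrf T H A) (f : Sub L Γ Δ) : RPrf T (H.map (·.subst f)) (A.subst f) := by
  intro Θ g K hK
  rw [Fm.subst_subst]
  refine h Θ _ K fun B hB => ?_
  rw [← Fm.subst_subst]
  exact hK _ (List.mem_map_of_mem hB)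

theorem hyp (h : A ∈ H) : RPrf T H A := fun _ _ _ hK => .hyp (hK _ h)

theorem andI (hA : RPrf T H A) (hB : RPrf T H B) : RPrf T H (.and A B) :=
  fun Δ f K hK => .andI (hA Δ f K hK) (hB Δ f K hK)

theorem andE₁ (h : RPrf T H (.and A B)) : RPrf T H A := fun Δ f K hK => .andE₁ (h Δ f K hK)

theorem andE₂ (h : RPrf T H (.and A B)) : RPrf T H B := fun Δ f K hK => .andE₂ (h Δ f K hK)

theorem orI₁ (h : RPrf T H A) : RPrf T H (.or A B) := fun Δ f K hK => .orI₁ (h Δ f K hK)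

theorem orI₂ (h : RPrf T H B) : RPrf T H (.or A B) := fun Δ f K hK => .orI₂ (h Δ f K hK)

theorem cons_mem {f : Sub L Γ Δ} {K : List (Fm L Δ)} (hK : ∀ B ∈ H, B.subst f ∈ K) :
    ∀ B ∈ A :: H, B.subst f ∈ A.subst f :: K := by
  intro B hB
  rcases List.mem_cons.1 hB with rfl | hB
  · exact List.mem_cons_self
  · exact List.mem_cons_of_mem _ (hK B hB)

theorem shift_mem {σ : Ty} {f : Sub L Γ Δ} {K : List (Fm L Δ)} (hK : ∀ B ∈ H, B.subst f ∈ K) :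
    ∀ B ∈ H.map (Fm.shift (σ := σ)), B.subst (Sub.lift f) ∈ K.map (Fm.shift (σ := σ)) := by
  intro _ hB
  obtain ⟨C, hC, rfl⟩ := List.mem_map.1 hB
  rw [Fm.shift_subst_lift]
  exact List.mem_map_of_mem (hK C hC)

theorem orE (h : RPrf T H (.or A B)) (hA : RPrf T (A :: H) C) (hB : RPrf T (B :: H) C) :
    RPrf T H C :=
  fun Δ f K hK => .orE (h Δ f K hK) (hA Δ f _ (cons_mem hK)) (hB Δ f _ (cons_mem hK))

theorem impI (h : RPrf T (A :: H) B) : RPrf T H (.imp A B) :=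
  fun Δ f _ hK => .impI (h Δ f _ (cons_mem hK))

theorem impE (h : RPrf T H (.imp A B)) (hA : RPrf T H A) : RPrf T H B :=
  fun Δ f K hK => .impE (h Δ f K hK) (hA Δ f K hK)

theorem cut (h : RPrf T (A :: H) B) (hA : RPrf T H A) : RPrf T H B := h.impI.impE hA

theorem raa (h : RPrf T (A.neg :: H) .bot) : RPrf T H A :=
  fun Δ f _ hK => .raa (h Δ f _ (cons_mem hK))

theorem allI {σ : Ty} {A : Fm L (σ :: Γ)} (h : RPrf T (H.map Fm.shift) A) : RPrf T H (.all σ A) :=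
  fun _ f _ hK => .allI (h _ (Sub.lift f) _ (shift_mem hK))

theorem allE {σ : Ty} {A : Fm L (σ :: Γ)} (h : RPrf T H (.all σ A)) (t : Tm L Γ σ) :
    RPrf T H (A.subst (Sub.inst t)) := by
  intro Δ f K hK
  rw [Fm.inst_subst]
  exact .allE _ (h Δ f K hK)

theorem exI {σ : Ty} {A : Fm L (σ :: Γ)} (t : Tm L Γ σ) (h : RPrf T H (A.subst (Sub.inst t))) :
    RPrf T H (.ex σ A) := by
  intro Δ f K hK
  refine .exI (t.subst f) ?_
  rw [← Fm.inst_subst]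
  exact h Δ f K hK

theorem exE {σ : Ty} {A : Fm L (σ :: Γ)} (h : RPrf T H (.ex σ A))
    (hC : RPrf T (A :: H.map Fm.shift) C.shift) : RPrf T H C := by
  intro Δ f K hK
  refine .exE (h Δ f K hK) ?_
  rw [← Fm.shift_subst_lift]
  exact hC _ (Sub.lift f) _ (cons_mem (shift_mem hK))

theorem eqRefl (s : Tm L Γ N) : RPrf T H (.eq s s) := fun _ _ _ _ => .eqRefl _

theorem eqSymm {s t : Tm L Γ N} (h : RPrf T H (.eq s t)) : RPrf T H (.eq t s) :=
  fun Δ f K hK => .impE (.eqSymm _ _) (h Δ f K hK)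

theorem eqTrans {r s t : Tm L Γ N} (h : RPrf T H (.eq r s)) (h' : RPrf T H (.eq s t)) :
    RPrf T H (.eq r t) :=
  fun Δ f K hK => .impE (.eqTrans _ _ _) (.andI (h Δ f K hK) (h' Δ f K hK))

theorem succNe (s : Tm L Γ N) : RPrf T H (Fm.neg (.eq (succ s) zero)) := fun _ _ _ _ => .succNe _

theorem succInj (s t : Tm L Γ N) : RPrf T H (.imp (.eq (succ s) (succ t)) (.eq s t)) :=
  fun _ _ _ _ => .succInj _ _

/-- The substitution of `n + 1` for the variable `n`. -/
def succSub (L : Lang) (Γ : List Ty) : Sub L (N :: Γ) (N :: Γ)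
  | _, .z => succ v0
  | _, .s v => .var (.s v)

theorem induction (A : Fm L (N :: Γ)) :
    RPrf T H (.imp (.and (A.subst (Sub.inst zero)) (.all N (.imp A (A.subst (succSub L Γ)))))
      (.all N A)) := by
  intro Δ f K _
  have h := Prf.induction (T := T) (H := K) (A.subst (Sub.lift f))
  have e : (A.subst (succSub L Γ)).subst (Sub.lift f) =
      (A.subst (Sub.lift f)).subst (succSub L Δ) := by
    simp only [Fm.subst_subst]
    congr 1
    funext τ v
    cases v with
    | z => rfl
    | s v =>
      simp only [succSub, Sub.lift, Tm.subst, Tm.shift, Tm.subst_subst]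
  simp only [Fm.subst, e, Fm.inst_subst]
  refine cast ?_ h
  congr! 7

theorem qfER {ρ τ : Ty} (hA : A.QF) {s t : Tm L Γ ρ} (r : Tm L (ρ :: Γ) τ)
    (h : RPrf T [] (.imp A (eqT ρ s t))) :
    RPrf T H (.imp A (eqT τ (r.subst (Sub.inst s)) (r.subst (Sub.inst t)))) := by
  intro Δ f K _
  have h' := h Δ f [] (by simp)
  simp only [Fm.subst, eqT_subst, Tm.inst_subst] at h' ⊢
  exact .qfER (hA.subst f) _ _ _ h'

theorem ax {A : Fm L []} (hA : A ∈ T) : RPrf T H A.cl := by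
  intro Δ f K _
  have : (A.cl (Γ := Γ)).subst f = A.cl := by
    simp only [Fm.cl, Fm.subst_subst]
    congr 1; funext τ v; cases v
  rw [this]; exact .ax hA

theorem combK {ρ τ : Ty} (s : Tm L Γ ρ) (t : Tm L Γ τ) :
    RPrf T H (eqT ρ (.cn (.K ρ τ) ⬝ s ⬝ t) s) := by
  intro Δ f K _
  rw [eqT_subst]; exact .combK _ _

theorem combS {δ ρ τ : Ty} (r : Tm L Γ (δ ⇒ ρ ⇒ τ)) (s : Tm L Γ (δ ⇒ ρ)) (t : Tm L Γ δ) :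
    RPrf T H (eqT τ (.cn (.S δ ρ τ) ⬝ r ⬝ s ⬝ t) (r ⬝ t ⬝ (s ⬝ t))) := by
  intro Δ f K _
  rw [eqT_subst]; exact .combS _ _ _

/-- The tuple with the single component `t`. -/
def tup₁ {ρ : Ty} (t : Tm L Γ ρ) : Sub L [ρ] Γ
  | _, .z => t

/-- The tuple with the components `t` and `u`. -/
def tup₂ {ρ σ : Ty} (t : Tm L Γ ρ) (u : Tm L Γ σ) : Sub L [ρ, σ] Γ
  | _, .z => t
  | _, .s .z => u

theorem recZero {ρ : Ty} (b : Tm L Γ ρ) (f : Tm L Γ (ρ ⇒ N ⇒ ρ)) :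
    RPrf T H (eqT ρ (.app (.app (.cn (.R [ρ] .z) ⬝ zero) b) f) b) := by
  intro Δ g K _
  rw [eqT_subst]; exact .recZero [ρ] .z (tup₁ (b.subst g)) (tup₁ (f.subst g))

theorem recSucc {ρ : Ty} (n : Tm L Γ N) (b : Tm L Γ ρ) (f : Tm L Γ (ρ ⇒ N ⇒ ρ)) :
    RPrf T H (eqT ρ (.app (.app (.cn (.R [ρ] .z) ⬝ succ n) b) f)
      (f ⬝ .app (.app (.cn (.R [ρ] .z) ⬝ n) b) f ⬝ n)) := by
  intro Δ g K _
  rw [eqT_subst]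
  exact .recSucc [ρ] .z (n.subst g) (tup₁ (b.subst g)) (tup₁ (f.subst g))

/-- The simultaneous recursor for two functions of type `0(0)`. -/
def recNN (i : Var [N, N] N) (n b c : Tm L Γ N) (f g : Tm L Γ (N ⇒ N ⇒ N ⇒ N)) : Tm L Γ N :=
  .app (.app (.app (.app (.cn (.R [N, N] i) ⬝ n) b) c) f) g

theorem recNN_zero (i : Var [N, N] N) (b c : Tm L Γ N) (f g : Tm L Γ (N ⇒ N ⇒ N ⇒ N)) :
    RPrf T H (.eq (recNN i zero b c f g) (tup₂ b c _ i)) := by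
  intro Δ h K _
  have := Prf.recZero (T := T) (H := K) [N, N] i (tup₂ (b.subst h) (c.subst h))
    (tup₂ (f.subst h) (g.subst h))
  cases i with
  | z => exact this
  | s i => cases i with
    | z => exact this
    | s i => cases i

theorem recNN_succ (i : Var [N, N] N) (n b c : Tm L Γ N) (f g : Tm L Γ (N ⇒ N ⇒ N ⇒ N)) :
    RPrf T H (.eq (recNN i (succ n) b c f g)
      (tup₂ f g _ (i.map (stepTy [N, N])) ⬝ recNN .z n b c f g ⬝ recNN (.s .z) n b c f g ⬝ n)) := by
  intro Δ h K _
  have := Prf.recSucc (T := T) (H := K) [N, N] i (n.subst h) (tup₂ (b.subst h) (c.subst h))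
    (tup₂ (f.subst h) (g.subst h))
  cases i with
  | z => exact this
  | s i => cases i with
    | z => exact this
    | s i => cases i

end RPrf

/-- Every type has a closed term. -/
def inhab : (τ : Ty) → Tm L Γ τ
  | .nat => zero
  | .X => .cn .zeroX
  | .arr σ τ => .cn (.K τ σ) ⬝ inhab τ


/-! ## Countability of the language -/

def Ty.code : Ty → ℕ
  | .nat => 0
  | .X => 1
  | .arr σ τ => Nat.pair σ.code τ.code + 2

theorem Ty.code_injective : Function.Injective Ty.code := by
  intro σ
  induction σ with
  | nat => intro τ h; cases τ <;> simp_all [Ty.code]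
  | X => intro τ h; cases τ <;> simp_all [Ty.code]
  | arr σ τ ihσ ihτ =>
    intro τ' h
    cases τ' with
    | nat => simp [Ty.code] at h
    | X => simp [Ty.code] at h
    | arr σ' τ' =>
      simp only [Ty.code, Nat.add_right_cancel_iff, Nat.pair_eq_pair] at h
      rw [ihσ h.1, ihτ h.2]

instance : Countable Ty := Ty.code_injective.countable

def Var.idx : {Γ : List Ty} → {τ : Ty} → Var Γ τ → ℕ
  | _, _, .z => 0
  | _, _, .s v => v.idx + 1

theorem Var.idx_injective {τ : Ty} : Function.Injective (Var.idx : Var Γ τ → ℕ) := by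
  intro v
  induction v with
  | z => intro w h; cases w <;> simp_all [Var.idx]
  | s v ih =>
    intro w h
    cases w with
    | z => simp [Var.idx] at h
    | s w => rw [ih (Nat.succ_injective h)]

/-- The tag together with the type parameters determines the type of the constant, so equality of
codes can be compared across different types. -/
def Cn.code : {τ : Ty} → Cn L τ → ℕ × List Ty × Ty × Ty × ℕ
  | _, .zero => (0, [], N, N, 0)
  | _, .succ => (1, [], N, N, 0)
  | _, .K ρ τ => (2, [], ρ, τ, 0)
  | _, .S δ ρ τ => (3, [δ], ρ, τ, 0)
  | _, .R ρs (ρ := ρ) i => (4, ρs, ρ, N, i.idx)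
  | _, .zeroX => (5, [], N, N, 0)
  | _, .oneX => (6, [], N, N, 0)
  | _, .addX => (7, [], N, N, 0)
  | _, .negX => (8, [], N, N, 0)
  | _, .smulX => (9, [], N, N, 0)
  | _, .normX => (10, [], N, N, 0)
  | _, .chi => (11, [], N, N, 0)
  | _, .J => (12, [], N, N, 0)
  | _, .gam => (13, [], N, N, 0)
  | _, .mGam => (14, [], N, N, 0)
  | _, .cX => (15, [], N, N, 0)
  | _, .rho => (16, [], N, N, 0)
  | _, .nGam => (17, [], N, N, 0)

theorem Cn.code_inj {τ τ' : Ty} (c : Cn L τ) (c' : Cn L τ') (h : c.code = c'.code) : c ≍ c' := by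
  cases c <;> cases c' <;> simp [Cn.code] at h <;> try exact HEq.rfl
  · obtain ⟨rfl, rfl⟩ := h; rfl
  · obtain ⟨rfl, rfl, rfl⟩ := h; rfl
  · obtain ⟨rfl, rfl, h⟩ := h
    cases Var.idx_injective h; rfl

instance {τ : Ty} : Countable (Cn L τ) :=
  Function.Injective.countable (f := Cn.code) fun c c' h => eq_of_heq (Cn.code_inj c c' h)

noncomputable def Cn.num {τ : Ty} (c : Cn L τ) : ℕ := (exists_injective_nat (Cn L τ)).choose c

theorem Cn.num_injective {τ : Ty} : Function.Injective (Cn.num : Cn L τ → ℕ) :=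
  (exists_injective_nat (Cn L τ)).choose_spec

/-- The argument type of an application is recorded because it cannot be read off from the type of
the result. -/
noncomputable def Tm.code : {τ : Ty} → Tm L Γ τ → ℕ × ℕ
  | _, .var v => (0, v.idx)
  | _, .cn c => (1, c.num)
  | _, .app (σ := σ) t u =>
      (2, Nat.pair σ.code (Nat.pair (Nat.pair t.code.1 t.code.2) (Nat.pair u.code.1 u.code.2)))

theorem Tm.code_injective {τ : Ty} : Function.Injective (Tm.code : Tm L Γ τ → ℕ × ℕ) := by
  intro t
  induction t with
  | var v =>
    intro u h
    cases u with
    | var w => rw [Var.idx_injective (congrArg Prod.snd h)]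
    | cn c => simp [Tm.code] at h
    | app t u => simp [Tm.code] at h
  | cn c =>
    intro u h
    cases u with
    | var w => simp [Tm.code] at h
    | cn c' => rw [Cn.num_injective (congrArg Prod.snd h)]
    | app t u => simp [Tm.code] at h
  | app t u iht ihu =>
    intro u' h
    cases u' with
    | var w => simp [Tm.code] at h
    | cn c => simp [Tm.code] at h
    | app t' u' =>
      simp only [Tm.code, Prod.mk.injEq, true_and, Nat.pair_eq_pair] at h
      obtain ⟨h, ht, hu⟩ := h
      cases Ty.code_injective h
      rw [iht (Prod.ext ht.1 ht.2), ihu (Prod.ext hu.1 hu.2)]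

noncomputable def Tm.gnum {τ : Ty} (t : Tm L Γ τ) : ℕ := Nat.pair t.code.1 t.code.2

theorem Tm.gnum_injective {τ : Ty} : Function.Injective (Tm.gnum : Tm L Γ τ → ℕ) := by
  intro t u h
  have h := Nat.pair_eq_pair.1 h
  exact Tm.code_injective (Prod.ext h.1 h.2)

noncomputable def Fm.code : {Γ : List Ty} → Fm L Γ → List ℕ
  | _, .eq s t => [0, s.gnum, t.gnum]
  | _, .and A B => [1, Encodable.encode A.code, Encodable.encode B.code]
  | _, .or A B => [2, Encodable.encode A.code, Encodable.encode B.code]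
  | _, .imp A B => [3, Encodable.encode A.code, Encodable.encode B.code]
  | _, .all σ A => [4, σ.code, Encodable.encode A.code]
  | _, .ex σ A => [5, σ.code, Encodable.encode A.code]

theorem Fm.code_injective : Function.Injective (Fm.code : Fm L Γ → List ℕ) := by
  intro A
  induction A with
  | eq s t =>
    intro B h
    cases B <;> simp [Fm.code] at h
    rw [Tm.gnum_injective h.1, Tm.gnum_injective h.2]
  | and A A' ih ih' =>
    intro B h
    cases B <;> simp [Fm.code] at h
    rw [ih h.1, ih' h.2]
  | or A A' ih ih' =>
    intro B h
    cases B <;> simp [Fm.code] at h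
    rw [ih h.1, ih' h.2]
  | imp A A' ih ih' =>
    intro B h
    cases B <;> simp [Fm.code] at h
    rw [ih h.1, ih' h.2]
  | all σ A ih =>
    intro B h
    cases B <;> simp [Fm.code] at h
    cases Ty.code_injective h.1
    rw [ih h.2]
  | ex σ A ih =>
    intro B h
    cases B <;> simp [Fm.code] at h
    cases Ty.code_injective h.1
    rw [ih h.2]

instance : Countable (Fm L Γ) := Fm.code_injective.countable

/-- Countability of the language serves only this purpose: the Henkin construction handles one
existential formula per stage and must reach all of them. -/
theorem exists_enum (L : Lang) (Γ : List Ty) :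
    ∃ e : ℕ → Σ σ : Ty, Fm L (σ :: Γ), Function.Surjective e :=
  haveI : Nonempty (Σ σ : Ty, Fm L (σ :: Γ)) := ⟨⟨N, .bot⟩⟩
  exists_surjective_nat _

/-- An enumeration of the formulas with one more free variable. -/
noncomputable def enum (L : Lang) (Γ : List Ty) : ℕ → Σ σ : Ty, Fm L (σ :: Γ) :=
  (exists_enum L Γ).choose

theorem enum_surjective : Function.Surjective (enum L Γ) := (exists_enum L Γ).choose_spec

/-! ## Structures -/

/-- A structure for the language; `=` of type `0` is interpreted by equality. -/
structure PreModel (L : Lang) where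
  carrier : Ty → Type
  app : {σ τ : Ty} → carrier (σ ⇒ τ) → carrier σ → carrier τ
  cn : {τ : Ty} → Cn L τ → carrier τ

namespace PreModel

variable (M : PreModel L)

/-- Valuations of the variables in `Γ`. -/
abbrev Val (Γ : List Ty) : Type := ∀ τ : Ty, Var Γ τ → M.carrier τ

variable {M}

def Val.nil : M.Val [] := fun _ v => nomatch v

def Val.cons {σ : Ty} (a : M.carrier σ) (ρ : M.Val Γ) : M.Val (σ :: Γ)
  | _, .z => a
  | _, .s v => ρ _ v

variable (M)

def ev {τ : Ty} : Tm L Γ τ → M.Val Γ → M.carrier τ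
  | .var v, ρ => ρ _ v
  | .cn c, _ => M.cn c
  | .app t u, ρ => M.app (ev t ρ) (ev u ρ)

def sat : {Γ : List Ty} → Fm L Γ → M.Val Γ → Prop
  | _, .eq s t, ρ => M.ev s ρ = M.ev t ρ
  | _, .and A B, ρ => sat A ρ ∧ sat B ρ
  | _, .or A B, ρ => sat A ρ ∨ sat B ρ
  | _, .imp A B, ρ => sat A ρ → sat B ρ
  | _, .all _ A, ρ => ∀ a, sat A (ρ.cons a)
  | _, .ex _ A, ρ => ∃ a, sat A (ρ.cons a)

theorem ev_subst {τ : Ty} (t : Tm L Γ τ) (f : Sub L Γ Δ) (ρ : M.Val Δ) :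
    M.ev (t.subst f) ρ = M.ev t fun τ v => M.ev (f τ v) ρ := by
  induction t with
  | var v => rfl
  | cn c => rfl
  | app t u iht ihu => simp only [Tm.subst, ev, iht, ihu]

@[simp]
theorem ev_shift {σ τ : Ty} (t : Tm L Γ τ) (a : M.carrier σ) (ρ : M.Val Γ) :
    M.ev t.shift (ρ.cons a) = M.ev t ρ := M.ev_subst t _ _

theorem val_nil (ρ : M.Val []) : ρ = Val.nil := by
  funext τ v; cases v

@[simp]
theorem ev_cl {τ : Ty} (t : Tm L [] τ) (ρ : M.Val Γ) : M.ev (cl t) ρ = M.ev t Val.nil := by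
  rw [cl, ev_subst]; congr 1; exact M.val_nil _

theorem val_lift {σ : Ty} (f : Sub L Γ Δ) (a : M.carrier σ) (ρ : M.Val Δ) :
    (fun τ v => M.ev (Sub.lift f τ v) (ρ.cons a)) =
      Val.cons a (fun τ v => M.ev (f τ v) ρ : M.Val Γ) := by
  funext τ v
  cases v with
  | z => rfl
  | s v => exact M.ev_shift _ _ _

theorem val_inst {σ : Ty} (t : Tm L Γ σ) (ρ : M.Val Γ) :
    (fun τ v => M.ev (Sub.inst t τ v) ρ) = Val.cons (M.ev t ρ) ρ := by
  funext τ v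
  cases v <;> rfl

theorem sat_subst (A : Fm L Γ) {Δ : List Ty} (f : Sub L Γ Δ) (ρ : M.Val Δ) :
    M.sat (A.subst f) ρ ↔ M.sat A fun τ v => M.ev (f τ v) ρ := by
  induction A generalizing Δ with
  | eq s t => simp only [Fm.subst, sat, ev_subst]
  | and A B ihA ihB => simp only [Fm.subst, sat, ihA, ihB]
  | or A B ihA ihB => simp only [Fm.subst, sat, ihA, ihB]
  | imp A B ihA ihB => simp only [Fm.subst, sat, ihA, ihB]
  | all σ A ih => simp only [Fm.subst, sat, ih, val_lift]
  | ex σ A ih => simp only [Fm.subst, sat, ih, val_lift]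

end PreModel

/-- A model of the theory `T`, in which terms that are provably equal under a true quantifier-free
assumption have the same value. -/
structure Model (T : Set (Fm L [])) extends PreModel L where
  sound : ∀ {Γ : List Ty} {A : Fm L Γ}, RPrf T [] A → ∀ ρ, toPreModel.sat A ρ
  leib : ∀ {Γ : List Ty} {A : Fm L Γ}, A.QF → ∀ {τ : Ty} {s t : Tm L Γ τ},
    RPrf T [] (.imp A (eqT τ s t)) → ∀ ρ, toPreModel.sat A ρ →
      toPreModel.ev s ρ = toPreModel.ev t ρ
  con : ¬ toPreModel.sat (.bot : Fm L []) PreModel.Val.nil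

/-! ## The Henkin construction -/

/-- The substitution of a term for the variable `0` that keeps the other variables. -/
def Sub.head {σ τ : Ty} (t : Tm L (σ :: Γ) τ) : Sub L (τ :: Γ) (σ :: Γ)
  | _, .z => t
  | _, .s v => .var (.s v)

/-- Contexts compose. This is why indistinguishability in numerical contexts is respected by
application: applying to an argument, or feeding into a function, is absorbed into the context. -/
theorem Tm.head_inst {σ τ υ : Ty} (r : Tm L (τ :: Γ) υ) (t : Tm L (σ :: Γ) τ) (u : Tm L Γ σ) :
    (r.subst (Sub.head t)).subst (Sub.inst u) = r.subst (Sub.inst (t.subst (Sub.inst u))) := by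
  rw [Tm.subst_subst]
  congr 1
  funext τ v
  cases v <;> rfl

theorem RPrf.cuts {T : Set (Fm L [])} {H K : List (Fm L Γ)} {A : Fm L Γ} (h : RPrf T K A)
    (hK : ∀ B ∈ K, RPrf T H B) : RPrf T H A := by
  induction K generalizing A with
  | nil => exact h.mono (by simp)
  | cons B K ih =>
    exact (ih h.impI fun C hC => hK C (by simp [hC])).impE (hK B (by simp))

/-- A finite consistent set of hypotheses together with a queue of existential formulas. -/
structure Stage (T : Set (Fm L [])) where
  ctx : List Ty
  hyps : List (Fm L ctx)
  con : ¬ RPrf T hyps .bot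
  task : ℕ → Σ σ : Ty, Fm L (σ :: ctx)

namespace Stage

variable {T : Set (Fm L [])}

-- One step both supplies a witness and decides the existential formula. Deciding arbitrary formulas
-- is then the case of a vacuous quantifier.
open Classical in
noncomputable def nextHyps (H : List (Fm L Γ)) (p : Σ σ : Ty, Fm L (σ :: Γ)) (T : Set (Fm L [])) :
    List (Fm L (p.1 :: Γ)) :=
  if RPrf T (.ex p.1 p.2 :: H) .bot then ((Fm.ex p.1 p.2).neg :: H).map Fm.shift
  else p.2 :: (Fm.ex p.1 p.2 :: H).map Fm.shift

theorem nextHyps_con {H : List (Fm L Γ)} (hH : ¬ RPrf T H .bot) (p : Σ σ : Ty, Fm L (σ :: Γ)) :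
    ¬ RPrf T (nextHyps H p T) .bot := by
  intro h
  unfold nextHyps at h
  split_ifs at h with h'
  · refine hH (RPrf.cut ?_ h'.impI)
    -- In the refuted case the fresh variable does no work. It is discharged against a trivially
    -- true existential statement, which requires a closed term of its type.
    refine RPrf.exE (σ := p.1) (A := .eq zero zero) (.exI (inhab _) (.eqRefl _)) ?_
    exact h.mono fun B hB => List.mem_cons_of_mem _ hB
  · exact h' (RPrf.exE (.hyp List.mem_cons_self) h)

/-- Weakening under a binder. -/
def taskShift {τ : Ty} (p : Σ σ : Ty, Fm L (σ :: Γ)) : Σ σ : Ty, Fm L (σ :: τ :: Γ) :=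
  ⟨p.1, p.2.subst (Sub.lift fun _ v => .var (.s v))⟩

/-- The task with number `Nat.pair n k` is the `k`-th formula over the context of stage `n`. Before
that stage its entry is a placeholder, which is overwritten at each step; from that stage on it is
merely weakened. -/
noncomputable def step (S : Stage T) (n : ℕ) : Stage T where
  ctx := (S.task n).1 :: S.ctx
  hyps := nextHyps S.hyps (S.task n) T
  con := nextHyps_con S.con _
  task i := if i.unpair.1 ≤ n then taskShift (S.task i) else enum L _ i.unpair.2

end Stage

/-- A consistent set of hypotheses, from which the construction starts. -/
structure Seed (T : Set (Fm L [])) (Γ : List Ty) where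
  hyps : List (Fm L Γ)
  con : ¬ RPrf T hyps .bot

namespace Seed

variable {T : Set (Fm L [])} {Γ₀ : List Ty} (s : Seed T Γ₀)

noncomputable def stage : ℕ → Stage T
  | 0 => ⟨Γ₀, s.hyps, s.con, fun i => enum L Γ₀ i.unpair.2⟩
  | n + 1 => (stage n).step n

noncomputable abbrev G (n : ℕ) : List Ty := (s.stage n).ctx

noncomputable abbrev H (n : ℕ) : List (Fm L (s.G n)) := (s.stage n).hyps

/-- The weakening from one stage to a later one. -/
noncomputable def up {n m : ℕ} (h : n ≤ m) : Sub L (s.G n) (s.G m) :=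
  Nat.leRec (motive := fun m _ => Sub L (s.G n) (s.G m)) (fun _ v => .var v)
    (fun m _ f τ v => (f τ v).shift (σ := ((s.stage m).task m).1)) h

theorem up_self (n : ℕ) : s.up (le_refl n) = fun _ v => .var v := Nat.leRec_self _ _

theorem up_succ {n m : ℕ} (h : n ≤ m) :
    s.up (h.trans m.le_succ) = fun τ v => (s.up h τ v).shift (σ := ((s.stage m).task m).1) :=
  Nat.leRec_succ _ _ h

theorem up_one (n : ℕ) : s.up n.le_succ = fun _ v => .var (.s v) := by
  rw [s.up_succ (le_refl n), up_self]; rfl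

theorem up_up {n m k : ℕ} (h : n ≤ m) (h' : m ≤ k) {τ : Ty} (v : Var (s.G n) τ) :
    (s.up h τ v).subst (s.up h') = s.up (h.trans h') τ v := by
  induction k, h' using Nat.le_induction with
  | base => rw [up_self, Tm.subst_id]
  | succ k h' ih =>
    refine (congrArg (fun g => Tm.subst g (s.up h τ v)) (s.up_succ h')).trans (Eq.trans ?_
      (congrFun (congrFun (s.up_succ (h.trans h')) τ) v).symm)
    exact (Tm.subst_subst _ _ _).symm.trans (congrArg Tm.shift ih)

theorem tm_up_up {n m k : ℕ} (h : n ≤ m) (h' : m ≤ k) {τ : Ty} (t : Tm L (s.G n) τ) :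
    (t.subst (s.up h)).subst (s.up h') = t.subst (s.up (h.trans h')) := by
  rw [Tm.subst_subst]; congr 1; funext τ v; exact s.up_up h h' v

theorem fm_up_up {n m k : ℕ} (h : n ≤ m) (h' : m ≤ k) (A : Fm L (s.G n)) :
    (A.subst (s.up h)).subst (s.up h') = A.subst (s.up (h.trans h')) := by
  rw [Fm.subst_subst]; congr 1; funext τ v; exact s.up_up h h' v

theorem hyps_succ {n : ℕ} {B : Fm L (s.G n)} (hB : B ∈ s.H n) :
    B.subst (s.up n.le_succ) ∈ s.H (n + 1) := by
  rw [up_one]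
  change B.shift ∈ Stage.nextHyps _ _ _
  unfold Stage.nextHyps
  split_ifs
  · exact List.mem_map_of_mem (List.mem_cons_of_mem _ hB)
  · exact List.mem_cons_of_mem _ (List.mem_map_of_mem (List.mem_cons_of_mem _ hB))

theorem hyps_up {n m : ℕ} (h : n ≤ m) {B : Fm L (s.G n)} (hB : B ∈ s.H n) :
    B.subst (s.up h) ∈ s.H m := by
  induction m, h using Nat.le_induction with
  | base => rwa [up_self, Fm.subst_id]
  | succ m h ih => rw [← s.fm_up_up h m.le_succ]; exact s.hyps_succ ih

theorem rprf_up {n m : ℕ} (h : n ≤ m) {A : Fm L (s.G n)} (hA : RPrf T (s.H n) A) :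
    RPrf T (s.H m) (A.subst (s.up h)) :=
  (hA.subst (s.up h)).mono fun _ hB => by
    obtain ⟨C, hC, rfl⟩ := List.mem_map.1 hB
    exact s.hyps_up h hC

/-- Truth of a formula over the context of a stage: it is derivable at some later stage. -/
def Tr (n : ℕ) (A : Fm L (s.G n)) : Prop := ∃ m, ∃ h : n ≤ m, RPrf T (s.H m) (A.subst (s.up h))

theorem tr_up {n m : ℕ} (h : n ≤ m) {A : Fm L (s.G n)} : s.Tr m (A.subst (s.up h)) ↔ s.Tr n A := by
  constructor
  · rintro ⟨k, hk, hA⟩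
    rw [fm_up_up] at hA
    exact ⟨k, _, hA⟩
  · rintro ⟨k, hk, hA⟩
    refine ⟨max m k, le_max_left _ _, ?_⟩
    have := s.rprf_up (le_max_right m k) hA
    rwa [fm_up_up] at this ⊢

/-- Finitely many true formulas are all derivable at one common later stage, so truth is closed
under derivability. -/
theorem tr_of_rprf {n : ℕ} {K : List (Fm L (s.G n))} {A : Fm L (s.G n)} (h : RPrf T K A)
    (hK : ∀ B ∈ K, s.Tr n B) : s.Tr n A := by
  have : ∃ m, ∃ h : n ≤ m, ∀ B ∈ K, RPrf T (s.H m) (B.subst (s.up h)) := by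
    clear h
    induction K with
    | nil => exact ⟨n, le_refl n, by simp⟩
    | cons B K ih =>
      obtain ⟨m, hm, h⟩ := ih fun C hC => hK C (List.mem_cons_of_mem _ hC)
      obtain ⟨k, hk, h'⟩ := hK B List.mem_cons_self
      refine ⟨max m k, hm.trans (le_max_left _ _), fun C hC => ?_⟩
      rcases List.mem_cons.1 hC with rfl | hC
      · have := s.rprf_up (le_max_right m k) h'
        rwa [fm_up_up] at this
      · have := s.rprf_up (le_max_left m k) (h C hC)
        rwa [fm_up_up] at this
  obtain ⟨m, hm, hK⟩ := this
  refine ⟨m, hm, (h.subst (s.up hm)).cuts fun B hB => ?_⟩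
  obtain ⟨C, hC, rfl⟩ := List.mem_map.1 hB
  exact hK C hC

theorem tr_hyp {n : ℕ} {A : Fm L (s.G n)} (h : A ∈ s.H n) : s.Tr n A :=
  ⟨n, le_refl n, by rw [up_self, Fm.subst_id]; exact .hyp h⟩

theorem tr_valid {n : ℕ} {A : Fm L (s.G n)} (h : RPrf T [] A) : s.Tr n A :=
  s.tr_of_rprf h (by simp)

theorem tr_mp {n : ℕ} {A B : Fm L (s.G n)} (h : RPrf T [A] B) (hA : s.Tr n A) : s.Tr n B :=
  s.tr_of_rprf h (by simpa using hA)

theorem tr_mp₂ {n : ℕ} {A B C : Fm L (s.G n)} (h : RPrf T [A, B] C) (hA : s.Tr n A)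
    (hB : s.Tr n B) : s.Tr n C :=
  s.tr_of_rprf h (by simpa using ⟨hA, hB⟩)

theorem not_tr_bot (n : ℕ) : ¬ s.Tr n .bot := fun ⟨m, _, h⟩ => (s.stage m).con h

/-- Induction from stage `n` on, where the entry has its final content; later stages only compose
weakenings. -/
theorem task_eq {n k m : ℕ} (h : n ≤ m) :
    (s.stage m).task (Nat.pair n k) =
      ⟨(enum L (s.G n) k).1, (enum L (s.G n) k).2.subst (Sub.lift (s.up h))⟩ := by
  induction m, h using Nat.le_induction with
  | base =>
    rw [up_self, Sub.lift_id, Fm.subst_id]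
    cases n with
    | zero => simp [stage]; rfl
    | succ n => simp [stage, Stage.step]; rfl
  | succ m h ih =>
    simp only [stage, Stage.step]
    rw [if_pos (by simpa using h), ih]
    simp only [Stage.taskShift, Fm.subst_subst]
    congr 2
    rw [s.up_succ h]
    exact Sub.lift_comp _ _

theorem tr_task (n : ℕ) :
    s.Tr n (Fm.ex _ ((s.stage n).task n).2).neg ∨
      ∃ t, s.Tr (n + 1) ((((s.stage n).task n).2.subst (Sub.lift (s.up n.le_succ))).subst
        (Sub.inst t)) := by
  by_cases h : RPrf T (.ex _ ((s.stage n).task n).2 :: s.H n) .bot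
  · left
    exact ⟨n, le_refl n, by rw [up_self, Fm.subst_id]; exact h.impI⟩
  · right
    -- The witness is the variable that this step has just added.
    refine ⟨.var .z, s.tr_hyp ?_⟩
    have : ∀ A : Fm L (((s.stage n).task n).1 :: s.G n),
        (A.subst (Sub.lift (s.up n.le_succ))).subst (Sub.inst (.var .z)) = A := by
      intro A
      rw [up_one, Fm.subst_subst]
      refine Eq.trans ?_ A.subst_id
      congr 1
      funext τ v
      cases v <;> rfl
    rw [this]
    change _ ∈ Stage.nextHyps _ _ _
    unfold Stage.nextHyps
    rw [if_neg h]
    exact List.mem_cons_self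

/-- The formula has some number `k` over the context of stage `n`, and its turn comes at stage
`Nat.pair n k`, which is at least `n` and hence not already past. -/
theorem tr_henkin {n : ℕ} {σ : Ty} (A : Fm L (σ :: s.G n)) :
    s.Tr n (Fm.ex σ A).neg ∨
      ∃ m, ∃ h : n ≤ m, ∃ t, s.Tr m ((A.subst (Sub.lift (s.up h))).subst (Sub.inst t)) := by
  obtain ⟨k, hk⟩ := enum_surjective (⟨σ, A⟩ : Σ σ : Ty, Fm L (σ :: s.G n))
  have hn : n ≤ Nat.pair n k := Nat.left_le_pair n k
  have h := s.tr_task (Nat.pair n k)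
  rw [s.task_eq hn, hk] at h
  rcases h with h | ⟨t, h⟩
  · left; exact (s.tr_up hn (A := (Fm.ex σ A).neg)).1 h
  · right
    refine ⟨_, hn.trans (Nat.le_succ _), t, ?_⟩
    dsimp only at h
    rw [Fm.subst_subst _ (Sub.lift (s.up hn)) (Sub.lift _), Sub.lift_comp] at h
    simpa only [s.up_up] using h

/-- Apply the Henkin property to a vacuous numerical quantifier. -/
theorem tr_em {n : ℕ} (A : Fm L (s.G n)) : s.Tr n A ∨ s.Tr n A.neg := by
  rcases s.tr_henkin (A.shift (σ := N)) with h | ⟨m, hm, t, h⟩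
  · right
    refine s.tr_mp (.impI ?_) h
    refine .impE (.hyp (List.mem_cons_of_mem _ List.mem_cons_self)) (.exI zero ?_)
    rw [Fm.shift_inst]; exact .hyp List.mem_cons_self
  · left
    rw [Fm.shift_subst_lift, Fm.shift_inst] at h
    exact (s.tr_up hm).1 h

theorem tr_imp {n : ℕ} {A B : Fm L (s.G n)} : s.Tr n (.imp A B) ↔ (s.Tr n A → s.Tr n B) := by
  constructor
  · exact fun h hA => s.tr_mp₂ (.impE (A := A) (.hyp (by simp)) (.hyp (by simp))) h hA
  · intro h
    rcases s.tr_em A with hA | hA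
    · exact s.tr_mp (.impI (.hyp (by simp))) (h hA)
    · refine s.tr_mp (.impI (.raa ?_)) hA
      exact .impE (A := A) (.hyp (by simp [Fm.neg])) (.hyp (by simp))

theorem tr_neg {n : ℕ} {A : Fm L (s.G n)} : s.Tr n A.neg ↔ ¬ s.Tr n A :=
  s.tr_imp.trans ⟨fun h hA => s.not_tr_bot n (h hA), fun h hA => (h hA).elim⟩

theorem tr_and {n : ℕ} {A B : Fm L (s.G n)} : s.Tr n (.and A B) ↔ s.Tr n A ∧ s.Tr n B :=
  ⟨fun h => ⟨s.tr_mp (.andE₁ (B := B) (.hyp (by simp))) h, s.tr_mp (.andE₂ (A := A) (.hyp (by simp))) h⟩,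
    fun h => s.tr_mp₂ (.andI (.hyp (by simp)) (.hyp (by simp))) h.1 h.2⟩

theorem tr_or {n : ℕ} {A B : Fm L (s.G n)} : s.Tr n (.or A B) ↔ s.Tr n A ∨ s.Tr n B := by
  constructor
  · intro h
    by_contra h'
    rw [not_or, ← tr_neg, ← tr_neg] at h'
    refine s.not_tr_bot n (s.tr_of_rprf (K := [.or A B, A.neg, B.neg]) ?_ (by simp [h, h']))
    exact .orE (A := A) (B := B) (.hyp (by simp))
      (.impE (A := A) (.hyp (by simp [Fm.neg])) (.hyp (by simp)))
      (.impE (A := B) (.hyp (by simp [Fm.neg])) (.hyp (by simp)))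
  · rintro (h | h)
    · exact s.tr_mp (.orI₁ (.hyp (by simp))) h
    · exact s.tr_mp (.orI₂ (.hyp (by simp))) h

theorem tr_ex {n : ℕ} {σ : Ty} {A : Fm L (σ :: s.G n)} :
    s.Tr n (.ex σ A) ↔
      ∃ m, ∃ h : n ≤ m, ∃ t, s.Tr m ((A.subst (Sub.lift (s.up h))).subst (Sub.inst t)) := by
  constructor
  · intro h
    exact (s.tr_henkin A).resolve_left fun h' => s.tr_neg.1 h' h
  · rintro ⟨m, hm, t, h⟩
    rw [← s.tr_up hm]
    exact s.tr_mp (.exI t (.hyp (by simp))) h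

theorem tr_all {n : ℕ} {σ : Ty} {A : Fm L (σ :: s.G n)} :
    s.Tr n (.all σ A) ↔
      ∀ m, ∀ h : n ≤ m, ∀ t, s.Tr m ((A.subst (Sub.lift (s.up h))).subst (Sub.inst t)) := by
  constructor
  · intro h m hm t
    rw [← s.tr_up hm] at h
    exact s.tr_mp (.allE (A := A.subst (Sub.lift (s.up hm))) (.hyp (by simp [Fm.subst])) t) h
  · intro h
    -- A true `∃ ¬A` would have a witness at a later stage, contradicting the assumption there.
    -- Classical logic turns its negation into `∀ A`.
    have : ¬ s.Tr n (.ex σ A.neg) := by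
      rw [tr_ex]
      rintro ⟨m, hm, t, h'⟩
      exact s.tr_neg.1 h' (h m hm t)
    rw [← tr_neg] at this
    refine s.tr_mp (.allI (.raa ?_)) this
    refine .impE (A := (Fm.ex σ A.neg).shift) (.hyp (.tail _ (.head _))) ?_
    refine .exI (.var .z) (.hyp ?_)
    rw [Fm.subst_subst]
    refine List.mem_cons.2 (.inl ((?_ : _ = _).trans A.neg.subst_id))
    congr 1; funext τ v; cases v <;> rfl

theorem tr_eq_symm {n : ℕ} {t u : Tm L (s.G n) N} (h : s.Tr n (.eq t u)) : s.Tr n (.eq u t) :=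
  s.tr_mp (.eqSymm (.hyp (by simp))) h

theorem tr_eq_trans {n : ℕ} {t u w : Tm L (s.G n) N} (h : s.Tr n (.eq t u))
    (h' : s.Tr n (.eq u w)) : s.Tr n (.eq t w) :=
  s.tr_mp₂ (.eqTrans (s := u) (.hyp (by simp)) (.hyp (by simp))) h h'

/-! ## The term model -/


/-- Terms with parameters that are indistinguishable in numerical contexts. -/
def termSetoid (τ : Ty) : Setoid (Σ n, Tm L (s.G n) τ) where
  r p q := ∀ k (hp : p.1 ≤ k) (hq : q.1 ≤ k) (r : Tm L (τ :: s.G k) N),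
    s.Tr k (.eq (r.subst (Sub.inst (p.2.subst (s.up hp))))
      (r.subst (Sub.inst (q.2.subst (s.up hq)))))
  iseqv := by
    refine ⟨fun p k _ _ r => s.tr_valid (.eqRefl _),
      fun h k hp hq r => s.tr_eq_symm (h k hq hp r), ?_⟩
    intro p q w h h' k hp hw r
    -- The middle term may live over a later stage than `k`, so the comparison is carried out at a
    -- stage that contains all three terms.
    rw [← s.tr_up (le_max_left k q.1)]
    have h1 := h (max k q.1) (hp.trans (le_max_left _ _)) (le_max_right _ _)
      (r.subst (Sub.lift (s.up (le_max_left _ _))))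
    have h2 := h' (max k q.1) (le_max_right _ _) (hw.trans (le_max_left _ _))
      (r.subst (Sub.lift (s.up (le_max_left _ _))))
    have := s.tr_eq_trans h1 h2
    simpa only [Fm.subst, Tm.inst_subst, tm_up_up] using this

def Carrier (τ : Ty) : Type := Quotient (s.termSetoid τ)

def cls (n : ℕ) {τ : Ty} (t : Tm L (s.G n) τ) : s.Carrier τ := Quotient.mk (s.termSetoid τ) ⟨n, t⟩

theorem cls_surj {τ : Ty} (a : s.Carrier τ) : ∃ n t, s.cls n t = a :=
  Quotient.inductionOn a fun p => ⟨p.1, p.2, rfl⟩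

theorem cls_eq_cls {n m : ℕ} {τ : Ty} {t : Tm L (s.G n) τ} {u : Tm L (s.G m) τ} :
    s.cls n t = s.cls m u ↔ ∀ k (hn : n ≤ k) (hm : m ≤ k) (r : Tm L (τ :: s.G k) N),
      s.Tr k (.eq (r.subst (Sub.inst (t.subst (s.up hn))))
        (r.subst (Sub.inst (u.subst (s.up hm))))) := Quotient.eq (r := s.termSetoid τ)

theorem cls_up {n m : ℕ} (h : n ≤ m) {τ : Ty} (t : Tm L (s.G n) τ) :
    s.cls m (t.subst (s.up h)) = s.cls n t := by
  rw [cls_eq_cls]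
  intro k hm hn r
  rw [tm_up_up]
  exact s.tr_valid (.eqRefl _)

/-- The implication is derived without hypotheses, so the rule of extensionality applies to it with
any numerical context as the term `r`. Truth of `A` then detaches the conclusion. -/
theorem cls_eq_of_leib {n : ℕ} {τ : Ty} {t u : Tm L (s.G n) τ} {A : Fm L (s.G n)} (hA : A.QF)
    (h : RPrf T [] (.imp A (eqT τ t u))) (hT : s.Tr n A) : s.cls n t = s.cls n u := by
  rw [cls_eq_cls]
  intro k hn _ r
  have h' := h.subst (s.up hn)
  simp only [Fm.subst, eqT_subst] at h'
  exact s.tr_mp (.impE (.qfER (hA.subst _) r h') (.hyp (by simp))) ((s.tr_up hn).2 hT)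

/-- One direction uses the trivial context. The other uses the rule of extensionality with the
equation itself as its quantifier-free premise. Thus `=` of type `0` is interpreted by identity. -/
theorem cls_eq_cls_nat {n : ℕ} {t u : Tm L (s.G n) N} : s.cls n t = s.cls n u ↔ s.Tr n (.eq t u) := by
  constructor
  · intro h
    have := s.cls_eq_cls.1 h n (le_refl n) (le_refl n) (.var .z)
    rwa [up_self, Tm.subst_id, Tm.subst_id] at this
  · intro h
    exact s.cls_eq_of_leib (A := .eq t u) trivial (.impI (.hyp (by simp [eqT]))) h

theorem app_respects {n m k : ℕ} {σ τ : Ty} {t : Tm L (s.G n) (σ ⇒ τ)} {u : Tm L (s.G m) (σ ⇒ τ)}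
    (h : s.cls n t = s.cls m u) (hn : n ≤ k) (hm : m ≤ k) (a : Tm L (s.G k) σ) :
    s.cls k (t.subst (s.up hn) ⬝ a) = s.cls k (u.subst (s.up hm) ⬝ a) := by
  rw [cls_eq_cls]
  intro l hk _ r
  have := s.cls_eq_cls.1 h l (hn.trans hk) (hm.trans hk)
    (r.subst (Sub.head (v0 ⬝ (a.subst (s.up hk)).shift)))
  simpa only [Tm.head_inst, Tm.subst, Tm.shift_inst, tm_up_up, v0, Sub.inst] using this

theorem arg_respects {n m k : ℕ} {σ τ : Ty} {t : Tm L (s.G n) σ} {u : Tm L (s.G m) σ}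
    (h : s.cls n t = s.cls m u) (hn : n ≤ k) (hm : m ≤ k) (f : Tm L (s.G k) (σ ⇒ τ)) :
    s.cls k (f ⬝ t.subst (s.up hn)) = s.cls k (f ⬝ u.subst (s.up hm)) := by
  rw [cls_eq_cls]
  intro l hk _ r
  have := s.cls_eq_cls.1 h l (hn.trans hk) (hm.trans hk)
    (r.subst (Sub.head ((f.subst (s.up hk)).shift ⬝ v0)))
  simpa only [Tm.head_inst, Tm.subst, Tm.shift_inst, tm_up_up, v0, Sub.inst] using this

noncomputable def preApp {σ τ : Ty} (p : Σ n, Tm L (s.G n) (σ ⇒ τ)) (q : Σ n, Tm L (s.G n) σ) : s.Carrier τ :=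
  s.cls (max p.1 q.1) (p.2.subst (s.up (le_max_left _ _)) ⬝ q.2.subst (s.up (le_max_right _ _)))

theorem preApp_eq {σ τ : Ty} {k : ℕ} (p : Σ n, Tm L (s.G n) (σ ⇒ τ)) (q : Σ n, Tm L (s.G n) σ)
    (hp : p.1 ≤ k) (hq : q.1 ≤ k) :
    s.preApp p q = s.cls k (p.2.subst (s.up hp) ⬝ q.2.subst (s.up hq)) := by
  rw [preApp, ← s.cls_up (max_le hp hq)]
  simp only [Tm.subst, tm_up_up]

noncomputable def tapp {σ τ : Ty} : s.Carrier (σ ⇒ τ) → s.Carrier σ → s.Carrier τ :=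
  Quotient.lift₂ (s₁ := s.termSetoid _) (s₂ := s.termSetoid _) s.preApp (by
    intro p q p' q' hp hq
    have hp : s.cls p.1 p.2 = s.cls p'.1 p'.2 := Quotient.sound (s := s.termSetoid _) hp
    have hq : s.cls q.1 q.2 = s.cls q'.1 q'.2 := Quotient.sound (s := s.termSetoid _) hq
    have h1 : p.1 ≤ max (max p.1 q.1) (max p'.1 q'.1) := by simp
    have h2 : q.1 ≤ max (max p.1 q.1) (max p'.1 q'.1) := by simp
    have h3 : p'.1 ≤ max (max p.1 q.1) (max p'.1 q'.1) := by simp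
    have h4 : q'.1 ≤ max (max p.1 q.1) (max p'.1 q'.1) := by simp
    rw [s.preApp_eq p q h1 h2, s.preApp_eq p' q' h3 h4, s.app_respects hp h1 h3,
      s.arg_respects hq h2 h4])

theorem tapp_mk {n : ℕ} {σ τ : Ty} (t : Tm L (s.G n) (σ ⇒ τ)) (u : Tm L (s.G n) σ) :
    s.tapp (s.cls n t) (s.cls n u) = s.cls n (t ⬝ u) := by
  refine (s.preApp_eq ⟨n, t⟩ ⟨n, u⟩ (le_refl n) (le_refl n)).trans ?_
  simp only [up_self, Tm.subst_id]

/-- The structure of terms with parameters. -/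
noncomputable def termPre : PreModel L where
  carrier := s.Carrier
  app := s.tapp
  cn c := s.cls 0 (.cn c)

theorem ev_mk {n : ℕ} {τ : Ty} (t : Tm L Γ τ) (f : Sub L Γ (s.G n)) :
    s.termPre.ev t (fun σ v => s.cls n (f σ v)) = s.cls n (t.subst f) := by
  induction t with
  | var v => rfl
  | cn c => exact (s.cls_up (Nat.zero_le n) (.cn c)).symm
  | app t u iht ihu =>
    change s.tapp (s.termPre.ev t _) (s.termPre.ev u _) = _
    rw [iht, ihu, tapp_mk]; rfl

theorem val_cons_mk {n m : ℕ} (h : n ≤ m) {σ : Ty} (t : Tm L (s.G m) σ) (f : Sub L Γ (s.G n)) :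
    (PreModel.Val.cons (M := s.termPre) (s.cls m t) fun σ v => s.cls n (f σ v)) =
      fun τ v => s.cls m (((Sub.lift f τ v).subst (Sub.lift (s.up h))).subst (Sub.inst t)) := by
  funext τ v
  cases v with
  | z => rfl
  | s v =>
    simp only [Sub.lift, Tm.shift_subst_lift, Tm.shift_inst]
    exact (s.cls_up h _).symm

/-- The truth lemma. For the quantifiers, every element of the structure is the class of a term over
some stage, and any two stages have a common later one. -/
theorem sat_iff_tr (A : Fm L Γ) {n : ℕ} (f : Sub L Γ (s.G n)) :
    s.termPre.sat A (fun σ v => s.cls n (f σ v)) ↔ s.Tr n (A.subst f) := by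
  induction A generalizing n with
  | eq t u =>
    rw [Fm.subst, ← s.cls_eq_cls_nat, ← s.ev_mk, ← s.ev_mk]; rfl
  | and A B ihA ihB => rw [Fm.subst, tr_and, ← ihA, ← ihB]; rfl
  | or A B ihA ihB => rw [Fm.subst, tr_or, ← ihA, ← ihB]; rfl
  | imp A B ihA ihB => rw [Fm.subst, tr_imp, ← ihA, ← ihB]; rfl
  | all σ A ih =>
    rw [Fm.subst, tr_all]
    constructor
    · intro h m hm t
      have := h (s.cls m t)
      rw [s.val_cons_mk hm, ih] at this
      simpa only [Fm.subst_subst, Tm.subst_subst] using this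
    · intro h a
      obtain ⟨m, t, rfl⟩ := s.cls_surj a
      rw [← s.cls_up (le_max_right n m), s.val_cons_mk (le_max_left n m), ih]
      simpa only [Fm.subst_subst, Tm.subst_subst] using h _ (le_max_left n m) _
  | ex σ A ih =>
    rw [Fm.subst, tr_ex]
    constructor
    · rintro ⟨a, h⟩
      obtain ⟨m, t, rfl⟩ := s.cls_surj a
      rw [← s.cls_up (le_max_right n m), s.val_cons_mk (le_max_left n m), ih] at h
      refine ⟨_, le_max_left n m, t.subst (s.up (le_max_right n m)), ?_⟩
      simpa only [Fm.subst_subst, Tm.subst_subst] using h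
    · rintro ⟨m, hm, t, h⟩
      refine ⟨s.cls m t, ?_⟩
      rw [s.val_cons_mk hm, ih]
      simpa only [Fm.subst_subst, Tm.subst_subst] using h

theorem val_surj (ρ : s.termPre.Val Γ) :
    ∃ n, ∃ f : Sub L Γ (s.G n), ρ = fun σ v => s.cls n (f σ v) := by
  induction Γ with
  | nil => exact ⟨0, Sub.nil, by funext τ v; cases v⟩
  | cons σ Γ ih =>
    obtain ⟨n, f, hf⟩ := ih fun τ v => ρ τ (.s v)
    obtain ⟨m, t, ht⟩ := s.cls_surj (ρ σ .z)
    refine ⟨max n m, fun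
      | _, .z => t.subst (s.up (le_max_right _ _))
      | _, .s v => (f _ v).subst (s.up (le_max_left _ _)), ?_⟩
    funext τ v
    cases v with
    | z => exact ht.symm.trans (s.cls_up _ _).symm
    | s v => exact (congrFun (congrFun hf τ) v).trans (s.cls_up _ _).symm

/-- The term model. -/
noncomputable def model : Model T where
  toPreModel := s.termPre
  sound h ρ := by
    obtain ⟨n, f, rfl⟩ := s.val_surj ρ
    rw [sat_iff_tr]
    exact s.tr_valid (h.subst f)
  leib hA _ _ _ h ρ hρ := by
    obtain ⟨n, f, rfl⟩ := s.val_surj ρ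
    rw [sat_iff_tr] at hρ
    rw [ev_mk, ev_mk]
    have h' := h.subst f
    simp only [Fm.subst, eqT_subst] at h'
    exact s.cls_eq_of_leib (hA.subst f) h' hρ
  con h := by
    obtain ⟨n, f, hf⟩ := s.val_surj (PreModel.Val.nil : s.termPre.Val [])
    rw [hf, sat_iff_tr] at h
    exact s.not_tr_bot n h

end Seed

/-- The completeness theorem. -/
theorem Prf.complete {T : Set (Fm L [])} {H : List (Fm L Γ)} {A : Fm L Γ}
    (h : ∀ (M : Model T) (ρ : M.Val Γ), (∀ B ∈ H, M.sat B ρ) → M.sat A ρ) : Prf T H A := by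
  by_contra hA
  -- If `A` is not derivable, then `¬A` is consistent with the hypotheses, and the term model built
  -- from them is a counterexample.
  let s : Seed T Γ := ⟨A.neg :: H, fun h => hA (.raa h.prf)⟩
  have e (B : Fm L Γ) : s.termPre.sat B (fun σ v => s.cls 0 (.var v)) ↔ s.Tr 0 B := by
    refine (s.sat_iff_tr (n := 0) B (fun _ v => .var v)).trans (Eq.to_iff ?_)
    exact congrArg (s.Tr 0) B.subst_id
  have h' := h s.model (fun σ v => s.cls 0 (.var v)) fun B hB =>
    (e B).2 (s.tr_hyp (n := 0) (List.mem_cons_of_mem _ hB))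
  exact s.tr_neg.1 (s.tr_hyp (n := 0) List.mem_cons_self) ((e A).1 h')

/-- Semantic consequence is invariant under substitution and under additional hypotheses, so
completeness yields the stable form of derivability. This form is what `Model.leib` asks for. -/
theorem RPrf.complete {T : Set (Fm L [])} {H : List (Fm L Γ)} {A : Fm L Γ}
    (h : ∀ (M : Model T) (ρ : M.Val Γ), (∀ B ∈ H, M.sat B ρ) → M.sat A ρ) : RPrf T H A := by
  intro Δ f K hK
  refine Prf.complete fun M ρ hρ => ?_
  rw [M.sat_subst]
  exact h M _ fun B hB => (M.sat_subst B f ρ).1 (hρ _ (hK B hB))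

/-- The rule of extensionality, for models: if `A` implies `s = t` in all models, then `s` and `t`
have the same value whenever `A` is true. -/
theorem Model.ev_eq_of_forall {T : Set (Fm L [])} (M : Model T) {A : Fm L Γ} (hA : A.QF) {τ : Ty}
    {s t : Tm L Γ τ} (h : ∀ (M : Model T) (ρ : M.Val Γ), M.sat A ρ → M.sat (eqT τ s t) ρ)
    {ρ : M.Val Γ} (hρ : M.sat A ρ) : M.ev s ρ = M.ev t ρ :=
  M.leib hA (RPrf.complete (A := .imp A (eqT τ s t)) fun M ρ _ => h M ρ) ρ hρ


/-! ### Evaluation rules and the basic operations on numbers in a structure -/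

namespace PreModel

variable (M : PreModel L)

section
variable {a b c d e : Ty} (p : M.carrier a) (q : M.carrier b) (r : M.carrier c) (s : M.carrier d)
  (t : M.carrier e) (ρ : M.Val Γ)

@[simp] theorem ev_v0 : M.ev v0 (ρ.cons p) = p := rfl
@[simp] theorem ev_v1 : M.ev v1 ((ρ.cons q).cons p) = q := rfl
@[simp] theorem ev_v2 : M.ev v2 (((ρ.cons r).cons q).cons p) = r := rfl
@[simp] theorem ev_v3 : M.ev v3 ((((ρ.cons s).cons r).cons q).cons p) = s := rfl
@[simp] theorem ev_v4 : M.ev v4 (((((ρ.cons t).cons s).cons r).cons q).cons p) = t := rfl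
end

@[simp] theorem ev_app {σ τ : Ty} (t : Tm L Γ (σ ⇒ τ)) (u : Tm L Γ σ) (ρ : M.Val Γ) :
    M.ev (t ⬝ u) ρ = M.app (M.ev t ρ) (M.ev u ρ) := rfl

@[simp] theorem ev_cn {τ : Ty} (c : Cn L τ) (ρ : M.Val Γ) : M.ev (.cn c) ρ = M.cn c := rfl

@[simp] theorem sat_eq (s t : Tm L Γ N) (ρ : M.Val Γ) :
    M.sat (.eq s t) ρ ↔ M.ev s ρ = M.ev t ρ := .rfl
@[simp] theorem sat_and (A B : Fm L Γ) (ρ : M.Val Γ) :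
    M.sat (.and A B) ρ ↔ M.sat A ρ ∧ M.sat B ρ := .rfl
@[simp] theorem sat_or (A B : Fm L Γ) (ρ : M.Val Γ) :
    M.sat (.or A B) ρ ↔ M.sat A ρ ∨ M.sat B ρ := .rfl
@[simp] theorem sat_imp (A B : Fm L Γ) (ρ : M.Val Γ) :
    M.sat (.imp A B) ρ ↔ (M.sat A ρ → M.sat B ρ) := .rfl
@[simp] theorem sat_all {σ : Ty} (A : Fm L (σ :: Γ)) (ρ : M.Val Γ) :
    M.sat (.all σ A) ρ ↔ ∀ a, M.sat A (ρ.cons a) := .rfl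
@[simp] theorem sat_ex {σ : Ty} (A : Fm L (σ :: Γ)) (ρ : M.Val Γ) :
    M.sat (.ex σ A) ρ ↔ ∃ a, M.sat A (ρ.cons a) := .rfl

instance : Zero (M.carrier N) := ⟨M.cn .zero⟩

/-- The successor function of the model. -/
def S (n : M.carrier N) : M.carrier N := M.app (M.cn .succ) n

instance : One (M.carrier N) := ⟨M.S 0⟩

/-- Recursion of type `0`. -/
def recN (n b : M.carrier N) (f : M.carrier (N ⇒ N ⇒ N)) : M.carrier N :=
  M.app (M.app (M.app (M.cn (.R [N] .z)) n) b) f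

instance : Add (M.carrier N) := ⟨fun a b => M.app (M.app (M.ev addT Val.nil) a) b⟩
instance : Mul (M.carrier N) := ⟨fun a b => M.app (M.app (M.ev mulT Val.nil) a) b⟩

@[simp] theorem ev_zero (ρ : M.Val Γ) : M.ev zero ρ = 0 := rfl
@[simp] theorem ev_succ (t : Tm L Γ N) (ρ : M.Val Γ) : M.ev (succ t) ρ = M.S (M.ev t ρ) := rfl
@[simp] theorem ev_recN (n b : Tm L Γ N) (f : Tm L Γ (N ⇒ N ⇒ N)) (ρ : M.Val Γ) :
    M.ev (ProofMining.recN n b f) ρ = M.recN (M.ev n ρ) (M.ev b ρ) (M.ev f ρ) := rfl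
@[simp] theorem ev_add (s t : Tm L Γ N) (ρ : M.Val Γ) :
    M.ev (add s t) ρ = M.ev s ρ + M.ev t ρ := by
  simp [add]; rfl
@[simp] theorem ev_mul (s t : Tm L Γ N) (ρ : M.Val Γ) :
    M.ev (mul s t) ρ = M.ev s ρ * M.ev t ρ := by
  simp [mul]; rfl

end PreModel

/-! ### Literal β-equality, recursion and induction in a model -/

namespace Model

open PreModel

variable {T : Set (Fm L [])} (M : Model T)

/-- The case of a trivially true premise: outright provable equations of every type hold as
identities in a model. -/
theorem ev_eq_of_eqT {τ : Ty} {s t : Tm L Γ τ} (h : RPrf T [] (eqT τ s t)) (ρ : M.Val Γ) :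
    M.ev s ρ = M.ev t ρ :=
  M.leib (A := .eq zero zero) (by simp [Fm.QF]) (.impI (h.mono (by simp))) ρ rfl

@[simp]
theorem app_K {ρ τ : Ty} (a : M.carrier ρ) (b : M.carrier τ) :
    M.app (M.app (M.cn (.K ρ τ)) a) b = a :=
  M.ev_eq_of_eqT (.combK v0 v1) ((Val.nil.cons b).cons a)

@[simp]
theorem app_S {δ ρ τ : Ty} (r : M.carrier (δ ⇒ ρ ⇒ τ)) (s : M.carrier (δ ⇒ ρ)) (t : M.carrier δ) :
    M.app (M.app (M.app (M.cn (.S δ ρ τ)) r) s) t = M.app (M.app r t) (M.app s t) :=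
  M.ev_eq_of_eqT (.combS v2 v1 v0) (((Val.nil.cons r).cons s).cons t)

@[simp]
-- The combinator axioms hold as identities at all types, so β-conversion is literal, although
-- functions of the model need not be determined by their values.
theorem app_lam {σ : Ty} : {τ : Ty} → (t : Tm L (σ :: Γ) τ) → (ρ : M.Val Γ) → (a : M.carrier σ) →
    M.app (M.ev (lam t) ρ) a = M.ev t (ρ.cons a)
  | _, .var .z, ρ, a => by simp [lam]; rfl
  | _, .var (.s v), ρ, a => by simp [lam]; rfl
  | _, .cn c, ρ, a => by simp [lam]
  | _, .app t u, ρ, a => by simp [lam, app_lam t, app_lam u]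

@[simp]
theorem recN_zero (b : M.carrier N) (f : M.carrier (N ⇒ N ⇒ N)) : M.recN 0 b f = b :=
  M.ev_eq_of_eqT (.recZero v0 v1) ((Val.nil.cons f).cons b)

@[simp]
theorem recN_S (n b : M.carrier N) (f : M.carrier (N ⇒ N ⇒ N)) :
    M.recN (M.S n) b f = M.app (M.app f (M.recN n b f)) n :=
  M.ev_eq_of_eqT (.recSucc v2 v0 v1) (((Val.nil.cons n).cons f).cons b)

@[simp]
theorem S_ne_zero (n : M.carrier N) : M.S n ≠ 0 :=
  fun h => M.con (M.sound (.succNe v0) (Val.nil.cons n) h)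

theorem S_inj {n m : M.carrier N} : M.S n = M.S m ↔ n = m :=
  ⟨M.sound (.succInj v0 v1) ((Val.nil.cons m).cons n), congrArg _⟩

/-- Induction is available only for properties defined by formulas with parameters, since the
numbers may be nonstandard. This is why the arithmetical laws below are first written as formulas.
-/
theorem ind (A : Fm L (N :: Γ)) (ρ : M.Val Γ) (h0 : M.sat A (ρ.cons 0))
    (hs : ∀ n, M.sat A (ρ.cons n) → M.sat A (ρ.cons (M.S n))) (n : M.carrier N) :
    M.sat A (ρ.cons n) := by
  refine M.sound (.induction A) ρ ⟨?_, fun n hn => ?_⟩ n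
  · rw [sat_subst, val_inst]; exact h0
  · rw [sat_subst]
    refine cast ?_ (hs n hn)
    congr 1; funext τ v; cases v <;> rfl


variable {M} in
-- Step functions with the same values may be different elements of the model; internal induction
-- shows that the recursor does not notice.
theorem recN_congr {f g : M.carrier (N ⇒ N ⇒ N)}
    (h : ∀ a n, M.app (M.app f a) n = M.app (M.app g a) n) (n b : M.carrier N) :
    M.recN n b f = M.recN n b g := by
  simpa using M.ind (.eq (ProofMining.recN v0 v1 v2) (ProofMining.recN v0 v1 v3))
    (((Val.nil.cons g).cons f).cons b) (by simp) (fun n hn => by simp_all) n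

variable {M} in
-- A step function written with `lam` is evaluated in an environment that contains the recursion
-- argument itself. Unfolding one recursion step changes that entry from `n + 1` to `n`, which this
-- lemma absorbs.
theorem recN_env {t : Tm L (N :: N :: Γ) N} {ρ ρ' : M.Val Γ}
    (h : ∀ a n, M.ev t ((ρ.cons a).cons n) = M.ev t ((ρ'.cons a).cons n)) (n b : M.carrier N) :
    M.recN n b (M.ev (lam (lam t)) ρ) = M.recN n b (M.ev (lam (lam t)) ρ') :=
  recN_congr (by simpa using h) n b

/-! ## The natural numbers of a model form an ordered semiring -/

variable {M}

theorem add_zero' (a : M.carrier N) : a + 0 = a :=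
  show M.app (M.app (M.ev addT Val.nil) a) 0 = a by simp [addT]

theorem add_S (a b : M.carrier N) : a + M.S b = M.S (a + b) := by
  have h := recN_env (M := M) (t := succ v1) (ρ := (Val.nil.cons a).cons (M.S b))
    (ρ' := (Val.nil.cons a).cons b) (by simp) b a
  change M.app (M.app (M.ev addT Val.nil) a) (M.S b) =
    M.S (M.app (M.app (M.ev addT Val.nil) a) b)
  simp only [addT, app_lam, PreModel.ev_recN, ev_v0, ev_v1, recN_S, PreModel.ev_succ, h]

theorem zero_add' (a : M.carrier N) : 0 + a = a := by
  simpa using M.ind (.eq (add zero v0) v0) Val.nil (by simp [add_zero'])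
    (fun n hn => by simp_all [add_S]) a

theorem S_add (a b : M.carrier N) : M.S a + b = M.S (a + b) := by
  simpa using M.ind (.eq (add (succ v1) v0) (succ (add v1 v0))) (Val.nil.cons a)
    (by simp [add_zero']) (fun n hn => by simp_all [add_S]) b

theorem add_comm' (a b : M.carrier N) : a + b = b + a := by
  simpa using M.ind (.eq (add v1 v0) (add v0 v1)) (Val.nil.cons a)
    (by simp [add_zero', zero_add']) (fun n hn => by simp_all [add_S, S_add]) b

theorem add_assoc' (a b c : M.carrier N) : a + b + c = a + (b + c) := by
  simpa using M.ind (.eq (add (add v2 v1) v0) (add v2 (add v1 v0))) ((Val.nil.cons a).cons b)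
    (by simp [add_zero']) (fun n hn => by simp_all [add_S]) c

theorem mul_zero' (a : M.carrier N) : a * 0 = 0 :=
  show M.app (M.app (M.ev mulT Val.nil) a) 0 = 0 by simp [mulT]

theorem mul_S (a b : M.carrier N) : a * M.S b = a * b + a := by
  have h := recN_env (M := M) (t := add v1 v3) (ρ := (Val.nil.cons a).cons (M.S b))
    (ρ' := (Val.nil.cons a).cons b) (by simp) b 0
  change M.app (M.app (M.ev mulT Val.nil) a) (M.S b) =
    M.app (M.app (M.ev mulT Val.nil) a) b + a
  simp only [mulT, app_lam, PreModel.ev_recN, ev_v0, ev_v1, ev_v3, recN_S, PreModel.ev_add,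
    PreModel.ev_zero, h]

theorem zero_mul' (a : M.carrier N) : 0 * a = 0 := by
  simpa using M.ind (.eq (mul zero v0) zero) Val.nil (by simp [mul_zero'])
    (fun n hn => by simp_all [mul_S, add_zero']) a

theorem S_mul (a b : M.carrier N) : M.S a * b = a * b + b := by
  simpa using M.ind (.eq (mul (succ v1) v0) (add (mul v1 v0) v0)) (Val.nil.cons a)
    (by simp [mul_zero', add_zero'])
    (fun n hn => by
      simp_all only [sat_eq, PreModel.ev_mul, PreModel.ev_add, PreModel.ev_succ, ev_v0, ev_v1,
        mul_S, add_S]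
      rw [add_assoc', add_assoc', add_comm' a]) b

theorem mul_comm' (a b : M.carrier N) : a * b = b * a := by
  simpa using M.ind (.eq (mul v1 v0) (mul v0 v1)) (Val.nil.cons a)
    (by simp [mul_zero', zero_mul']) (fun n hn => by simp_all [mul_S, S_mul]) b

theorem mul_add' (a b c : M.carrier N) : a * (b + c) = a * b + a * c := by
  simpa using M.ind (.eq (mul v2 (add v1 v0)) (add (mul v2 v1) (mul v2 v0)))
    ((Val.nil.cons a).cons b) (by simp [add_zero', mul_zero'])
    (fun n hn => by simp_all [add_S, mul_S, add_assoc']) c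

theorem mul_assoc' (a b c : M.carrier N) : a * b * c = a * (b * c) := by
  simpa using M.ind (.eq (mul (mul v2 v1) v0) (mul v2 (mul v1 v0))) ((Val.nil.cons a).cons b)
    (by simp [mul_zero']) (fun n hn => by simp_all [mul_S, mul_add']) c

theorem mul_one' (a : M.carrier N) : a * 1 = a := by
  change a * M.S 0 = a
  rw [mul_S, mul_zero', zero_add']

noncomputable instance : CommSemiring (M.carrier N) where
  add_assoc := add_assoc'
  zero_add := zero_add'
  add_zero := add_zero'
  add_comm := add_comm'
  mul_assoc := mul_assoc'
  one_mul a := by rw [mul_comm', mul_one']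
  mul_one := mul_one'
  mul_comm := mul_comm'
  zero_mul := zero_mul'
  mul_zero := mul_zero'
  left_distrib := mul_add'
  right_distrib a b c := by rw [mul_comm', mul_add', mul_comm' c, mul_comm' c]
  nsmul := nsmulRec
  npow := npowRec

theorem S_eq (a : M.carrier N) : M.S a = a + 1 := by
  change _ = a + M.S 0
  rw [add_S, add_zero]

theorem zero_or_S (a : M.carrier N) : a = 0 ∨ ∃ b, a = M.S b := by
  simpa using M.ind (.or (.eq v0 zero) (.ex N (.eq v1 (succ v0)))) Val.nil (by simp)
    (fun n _ => by simp) a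

theorem add_right_cancel' {a b c : M.carrier N} : a + c = b + c → a = b := by
  simpa using M.ind (.imp (.eq (add v2 v0) (add v1 v0)) (.eq v2 v1)) ((Val.nil.cons a).cons b)
    (by simp) (fun n hn => by simp_all [add_S, S_inj]) c

theorem eq_zero_of_add {a b : M.carrier N} (h : a + b = 0) : b = 0 := by
  rcases zero_or_S b with rfl | ⟨b, rfl⟩
  · rfl
  · simp [add_S] at h

instance : LE (M.carrier N) := ⟨fun a b => ∃ c, b = a + c⟩

theorem le_total' (a b : M.carrier N) : a ≤ b ∨ b ≤ a := by
  have := M.ind (.or (.ex N (.eq v1 (add v2 v0))) (.ex N (.eq v2 (add v1 v0)))) (Val.nil.cons a)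
    (.inr ⟨a, by simp⟩) (fun n hn => by
      rcases hn with ⟨c, hc⟩ | ⟨c, hc⟩
      · left
        refine ⟨M.S c, ?_⟩
        simp_all [add_S]
      · rcases zero_or_S c with rfl | ⟨c, rfl⟩
        · left
          refine ⟨1, ?_⟩
          simp_all [S_eq]
        · right
          refine ⟨c, ?_⟩
          simp_all [add_S, S_add]) b
  simp only [sat_or, sat_ex, sat_eq, PreModel.ev_add, ev_v0, ev_v1, ev_v2] at this
  exact this

open Classical in
noncomputable instance : LinearOrder (M.carrier N) where
  le_refl a := ⟨0, by simp⟩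
  le_trans := by
    rintro a _ _ ⟨c, rfl⟩ ⟨d, rfl⟩
    exact ⟨c + d, add_assoc _ _ _⟩
  le_antisymm := by
    rintro a _ ⟨c, rfl⟩ ⟨d, h⟩
    have : d + c = 0 := by
      apply add_right_cancel' (c := a)
      rw [zero_add, add_comm, add_comm d, ← add_assoc]
      exact h.symm
    rw [eq_zero_of_add this, add_zero]
  le_total := le_total'
  toDecidableLE := inferInstance

instance : IsOrderedCancelAddMonoid (M.carrier N) where
  add_le_add_left := by
    rintro a _ ⟨c, rfl⟩ b
    exact ⟨c, add_right_comm _ _ _⟩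
  le_of_add_le_add_left := by
    rintro a b c ⟨d, h⟩
    refine ⟨d, add_right_cancel' (c := a) ?_⟩
    rw [add_comm, h]; ring

instance : CanonicallyOrderedAdd (M.carrier N) where
  exists_add_of_le := fun ⟨c, h⟩ => ⟨c, h⟩
  le_self_add _ b := ⟨b, rfl⟩
  le_add_self _ b := ⟨b, add_comm _ _⟩

theorem lt_iff {a b : M.carrier N} : a < b ↔ ∃ c, b = a + c + 1 := by
  constructor
  · intro h
    obtain ⟨c, rfl⟩ := h.le
    rcases zero_or_S c with rfl | ⟨c, rfl⟩
    · simp at h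
    · exact ⟨c, by rw [S_eq, add_assoc]⟩
  · rintro ⟨c, rfl⟩
    refine lt_of_le_of_ne ⟨c + 1, add_assoc _ _ _⟩ fun h => ?_
    have h : 0 + a = M.S c + a := by rw [S_eq, zero_add, add_comm, ← add_assoc]; exact h
    exact M.S_ne_zero c (add_right_cancel' h).symm

instance : IsStrictOrderedRing (M.carrier N) where
  zero_le_one := zero_le
  exists_pair_ne := ⟨1, 0, M.S_ne_zero 0⟩
  mul_lt_mul_of_pos_left := by
    intro a ha b c h
    obtain ⟨d, rfl⟩ := lt_iff.1 ha
    obtain ⟨e, rfl⟩ := lt_iff.1 h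
    exact lt_iff.2 ⟨d * e + d + e, by ring⟩
  mul_lt_mul_of_pos_right := by
    intro a ha b c h
    obtain ⟨d, rfl⟩ := lt_iff.1 ha
    obtain ⟨e, rfl⟩ := lt_iff.1 h
    exact lt_iff.2 ⟨d * e + d + e, by ring⟩

theorem add_one_le_iff' {a b : M.carrier N} : a + 1 ≤ b ↔ a < b := by
  constructor
  · exact fun h => (lt_add_one a).trans_le h
  · intro h
    obtain ⟨c, rfl⟩ := lt_iff.1 h
    exact ⟨c, add_right_comm _ _ _⟩

end Model
end ProofMining

namespace ProofMining

/-! ## The ordered field of fractions of an ordered semiring -/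

section Differences

variable (A : Type) [CommSemiring A] [LinearOrder A] [IsStrictOrderedRing A]

/-- Pairs of elements, regarded as formal differences. -/
def diffSetoid : Setoid (A × A) where
  r p q := p.1 + q.2 = q.1 + p.2
  iseqv := by
    refine ⟨fun _ => rfl, fun h => h.symm, ?_⟩
    intro p q r h h'
    apply add_right_cancel (b := q.2)
    calc p.1 + r.2 + q.2 = p.1 + q.2 + r.2 := by ring
      _ = q.1 + r.2 + p.2 := by rw [h]; ring
      _ = r.1 + p.2 + q.2 := by rw [h']; ring

/-- The ring of differences. -/
def Diff : Type := Quotient (diffSetoid A)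

variable {A}

namespace Diff

def mk (a b : A) : Diff A := Quotient.mk (diffSetoid A) (a, b)

theorem mk_eq {a b c d : A} : mk a b = mk c d ↔ a + d = c + b :=
  Quotient.eq (r := diffSetoid A)

theorem ind {P : Diff A → Prop} (h : ∀ a b, P (mk a b)) (x : Diff A) : P x :=
  Quotient.ind (fun p => h p.1 p.2) x

instance : Zero (Diff A) := ⟨mk 0 0⟩
instance : One (Diff A) := ⟨mk 1 0⟩

instance : Add (Diff A) :=
  ⟨Quotient.map₂ (fun p q => (p.1 + q.1, p.2 + q.2)) (by
    intro p p' (h : _ = _) q q' (h' : _ = _)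
    change p.1 + q.1 + (p'.2 + q'.2) = p'.1 + q'.1 + (p.2 + q.2)
    rw [add_add_add_comm, h, h', add_add_add_comm])⟩

instance : Neg (Diff A) :=
  ⟨Quotient.map (fun p => (p.2, p.1)) (by
    intro p p' (h : _ = _)
    change p.2 + p'.1 = p'.2 + p.1
    rw [add_comm, ← h, add_comm])⟩

instance : Mul (Diff A) :=
  ⟨Quotient.map₂ (fun p q => (p.1 * q.1 + p.2 * q.2, p.1 * q.2 + p.2 * q.1)) (by
    intro p p' (h : _ = _) q q' (h' : _ = _)
    refine (diffSetoid A).iseqv.trans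
      (y := (p'.1 * q.1 + p'.2 * q.2, p'.1 * q.2 + p'.2 * q.1))
      (show p.1 * q.1 + p.2 * q.2 + (p'.1 * q.2 + p'.2 * q.1) =
        p'.1 * q.1 + p'.2 * q.2 + (p.1 * q.2 + p.2 * q.1) from ?_)
      (show p'.1 * q.1 + p'.2 * q.2 + (p'.1 * q'.2 + p'.2 * q'.1) =
        p'.1 * q'.1 + p'.2 * q'.2 + (p'.1 * q.2 + p'.2 * q.1) from ?_)
    · calc _ = (p.1 + p'.2) * q.1 + (p'.1 + p.2) * q.2 := by ring
        _ = (p'.1 + p.2) * q.1 + (p.1 + p'.2) * q.2 := by rw [h]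
        _ = _ := by ring
    · calc _ = p'.1 * (q.1 + q'.2) + p'.2 * (q'.1 + q.2) := by ring
        _ = p'.1 * (q'.1 + q.2) + p'.2 * (q.1 + q'.2) := by rw [h']
        _ = _ := by ring)⟩

theorem mk_add (a b c d : A) : mk a b + mk c d = mk (a + c) (b + d) := rfl
theorem mk_mul (a b c d : A) : mk a b * mk c d = mk (a * c + b * d) (a * d + b * c) := rfl
theorem neg_mk (a b : A) : -mk a b = mk b a := rfl
theorem zero_eq : (0 : Diff A) = mk 0 0 := rfl
theorem one_eq : (1 : Diff A) = mk 1 0 := rfl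

instance : CommRing (Diff A) where
  add_assoc x y z := by
    induction x using ind; induction y using ind; induction z using ind
    simp only [mk_add, add_assoc]
  zero_add x := by induction x using ind; simp only [zero_eq, mk_add, zero_add]
  add_zero x := by induction x using ind; simp only [zero_eq, mk_add, add_zero]
  add_comm x y := by
    induction x using ind; induction y using ind
    simp only [mk_add, add_comm]
  mul_assoc x y z := by
    induction x using ind; induction y using ind; induction z using ind
    simp only [mk_mul]; congr 1 <;> ring
  one_mul x := by induction x using ind; simp [one_eq, mk_mul]
  mul_one x := by induction x using ind; simp [one_eq, mk_mul]
  mul_comm x y := by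
    induction x using ind; induction y using ind
    simp only [mk_mul]; congr 1 <;> ring
  zero_mul x := by induction x using ind; simp [zero_eq, mk_mul]
  mul_zero x := by induction x using ind; simp [zero_eq, mk_mul]
  left_distrib x y z := by
    induction x using ind; induction y using ind; induction z using ind
    simp only [mk_mul, mk_add]; congr 1 <;> ring
  right_distrib x y z := by
    induction x using ind; induction y using ind; induction z using ind
    simp only [mk_mul, mk_add]; congr 1 <;> ring
  neg_add_cancel x := by
    induction x using ind
    simp only [neg_mk, mk_add, zero_eq, mk_eq]; ring
  nsmul := nsmulRec
  zsmul := zsmulRec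

/-- The inclusion of the semiring into its ring of differences. -/
def ι (A : Type) [CommSemiring A] [LinearOrder A] [IsStrictOrderedRing A] : A →+* Diff A where
  toFun a := mk a 0
  map_zero' := rfl
  map_one' := rfl
  map_add' a b := by simp [mk_add]
  map_mul' a b := by simp [mk_mul]

theorem ι_injective : Function.Injective (ι A) := fun a b h => by
  simpa using mk_eq.1 (show mk a 0 = mk b 0 from h)

variable [CanonicallyOrderedAdd A]

/-- In a canonical order the larger of two elements is the smaller one plus something, so every
formal difference is an element of the semiring up to sign. Questions about zero divisors and
positivity thereby reduce to the semiring. -/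
theorem exists_sign (x : Diff A) : ∃ a, x = ι A a ∨ x = -ι A a := by
  induction x using ind with
  | h a b =>
    rcases le_total a b with h | h <;> obtain ⟨c, rfl⟩ := exists_add_of_le h
    · exact ⟨c, .inr (mk_eq.2 (show a + c = 0 + (a + c) by rw [zero_add]))⟩
    · exact ⟨c, .inl (mk_eq.2 (show b + c + 0 = c + b by ring))⟩

instance : IsDomain (Diff A) := by
  have : Nontrivial (Diff A) := ⟨⟨ι A 0, ι A 1, fun h => zero_ne_one (ι_injective h)⟩⟩
  have : NoZeroDivisors (Diff A) := ⟨by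
    intro x y h
    obtain ⟨a, ha⟩ := exists_sign x
    obtain ⟨b, hb⟩ := exists_sign y
    have : ι A (a * b) = ι A 0 := by
      rw [map_mul, map_zero]
      rcases ha with rfl | rfl <;> rcases hb with rfl | rfl <;> simpa using h
    rcases mul_eq_zero.1 (ι_injective this) with rfl | rfl
    · left; simpa using ha
    · right; simpa using hb⟩
  exact NoZeroDivisors.to_isDomain _

end Diff

variable (A) in
/-- The inclusion of an ordered semiring into the field of fractions of its differences. -/
noncomputable def fracι : A →+* FractionRing (Diff A) :=
  (algebraMap (Diff A) (FractionRing (Diff A))).comp (Diff.ι A)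

theorem fracι_injective : Function.Injective (fracι A) :=
  (IsFractionRing.injective (Diff A) (FractionRing (Diff A))).comp Diff.ι_injective

theorem fracι_ne_zero {a : A} (h : a ≠ 0) : fracι A a ≠ 0 := by
  rw [Ne, map_eq_zero_iff _ fracι_injective]; exact h

variable [CanonicallyOrderedAdd A]

theorem exists_frac_sign (x : FractionRing (Diff A)) :
    ∃ a b, b ≠ 0 ∧ (x = fracι A a / fracι A b ∨ x = -(fracι A a / fracι A b)) := by
  obtain ⟨u, v, hv, rfl⟩ := IsFractionRing.div_surjective (A := Diff A) x
  obtain ⟨a, ha⟩ := Diff.exists_sign u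
  obtain ⟨b, hb⟩ := Diff.exists_sign v
  refine ⟨a, b, ?_, ?_⟩
  · rintro rfl
    refine nonZeroDivisors.ne_zero hv ?_
    simpa using hb
  · rcases ha with rfl | rfl <;> rcases hb with rfl | rfl <;> simp [fracι, neg_div, div_neg]

variable (A) in
/-- The fractions of elements of `A`. -/
noncomputable def fracCone : RingCone (FractionRing (Diff A)) where
  carrier := {x | ∃ a b, b ≠ 0 ∧ x = fracι A a / fracι A b}
  zero_mem' := ⟨0, 1, one_ne_zero, by simp⟩
  one_mem' := ⟨1, 1, one_ne_zero, by simp⟩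
  add_mem' := by
    rintro _ _ ⟨a, b, hb, rfl⟩ ⟨c, d, hd, rfl⟩
    refine ⟨a * d + b * c, b * d, mul_ne_zero hb hd, ?_⟩
    rw [div_add_div _ _ (fracι_ne_zero hb) (fracι_ne_zero hd)]
    simp
  mul_mem' := by
    rintro _ _ ⟨a, b, hb, rfl⟩ ⟨c, d, hd, rfl⟩
    exact ⟨a * c, b * d, mul_ne_zero hb hd, by rw [div_mul_div_comm]; simp⟩
  eq_zero_of_mem_of_neg_mem' := by
    rintro _ ⟨a, b, hb, rfl⟩ ⟨c, d, hd, h⟩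
    have hb' := fracι_ne_zero hb
    have hd' := fracι_ne_zero hd
    -- From `a/b = -(c/d)` one gets `ad + cb = 0` already in the semiring, where a vanishing sum has
    -- vanishing summands.
    have h : fracι A (a * d + c * b) = fracι A 0 := by
      field_simp at h
      simp only [map_add, map_mul, map_zero]
      linear_combination -h
    have := (fracι_injective h)
    have : a * d = 0 := (add_eq_zero.1 this).1
    rcases mul_eq_zero.1 this with rfl | rfl
    · simp
    · exact absurd rfl hd

open Classical in
/-- Every canonically ordered semiring that is linearly and strictly ordered embeds into an ordered
field whose elements are, up to the sign, fractions. -/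
theorem exists_ordered_field (A : Type) [CommSemiring A] [LinearOrder A] [IsStrictOrderedRing A]
    [CanonicallyOrderedAdd A] (hA : ∀ a : A, a ≠ 0 → 1 ≤ a) :
    ∃ (K : Type) (_ : Field K) (_ : LinearOrder K) (_ : IsStrictOrderedRing K) (ι : A →+* K),
      StrictMono ι ∧ ∀ x : K, ∃ a, x ≤ ι a := by
  have : HasMemOrNegMem (fracCone A) := ⟨fun x => by
    obtain ⟨a, b, hb, h | h⟩ := exists_frac_sign x
    · exact .inl ⟨a, b, hb, h⟩
    · exact .inr ⟨a, b, hb, by rw [h, neg_neg]⟩⟩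
  let _ : LinearOrder (FractionRing (Diff A)) := .mkOfAddGroupCone (fracCone A)
  have : IsOrderedRing (FractionRing (Diff A)) := IsOrderedRing.mkOfCone (fracCone A)
  have : IsStrictOrderedRing (FractionRing (Diff A)) := IsOrderedRing.toIsStrictOrderedRing _
  have hm : Monotone (fracι A) := by
    intro a b h
    obtain ⟨c, rfl⟩ := exists_add_of_le h
    exact ⟨c, 1, one_ne_zero, by simp⟩
  refine ⟨_, inferInstance, inferInstance, inferInstance, fracι A,
    hm.strictMono_of_injective fracι_injective, fun x => ?_⟩
  obtain ⟨a, b, hb, h⟩ := exists_frac_sign x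
  -- Nonzero denominators are at least `1` by discreteness, so a fraction is bounded by its
  -- numerator; this gives cofinality.
  have h1 : (1 : FractionRing (Diff A)) ≤ fracι A b := by
    rw [← map_one (fracι A)]
    exact hm (hA b hb)
  have ha : 0 ≤ fracι A a := by rw [← map_zero (fracι A)]; exact hm (zero_le)
  have h2 : fracι A a / fracι A b ≤ fracι A a := div_le_self ha h1
  refine ⟨a, ?_⟩
  rcases h with rfl | rfl
  · exact h2
  · exact (neg_nonpos.2 (div_nonneg ha (zero_le_one.trans h1))).trans ha

end Differences
end ProofMining

namespace ProofMining

/-! ## Limits of Cauchy functions on a linear order -/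

section Completion

variable {I K : Type} [LinearOrder I] [Field K] [LinearOrder K]

/-- Eventually `|f n| < ε`, for all `ε > 0`. -/
def IsNull (f : I → K) : Prop := ∀ ε > 0, ∃ m, ∀ n ≥ m, |f n| < ε

def IsCauchy (f : I → K) : Prop := ∀ ε > 0, ∃ m, ∀ n ≥ m, |f n - f m| < ε

theorem isCauchy_of_pair {f : I → K} (h : ∀ ε > 0, ∃ m, ∀ n ≥ m, ∀ k ≥ m, |f n - f k| < ε) :
    IsCauchy f := fun ε hε => (h ε hε).imp fun m hm n hn => hm n hn m (le_refl m)

variable [IsStrictOrderedRing K]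

theorem IsCauchy.pair {f : I → K} (hf : IsCauchy f) {ε : K} (hε : 0 < ε) :
    ∃ m, ∀ n ≥ m, ∀ k ≥ m, |f n - f k| < ε := by
  obtain ⟨m, hm⟩ := hf (ε / 2) (half_pos hε)
  refine ⟨m, fun n hn k hk => ?_⟩
  have h1 := abs_lt.1 (hm n hn)
  have h2 := abs_lt.1 (hm k hk)
  rw [abs_lt]; constructor <;> linarith

theorem IsCauchy.bounded {f : I → K} (hf : IsCauchy f) : ∃ B > 0, ∃ m, ∀ n ≥ m, |f n| < B := by
  obtain ⟨m, hm⟩ := hf 1 one_pos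
  refine ⟨|f m| + 1, by positivity, m, fun n hn => ?_⟩
  have := hm n hn
  have := abs_sub_abs_le_abs_sub (f n) (f m)
  linarith

theorem IsCauchy.max_zero {f : I → K} (hf : IsCauchy f) : IsCauchy fun n => max (f n) 0 := by
  intro ε hε
  obtain ⟨m, hm⟩ := hf ε hε
  refine ⟨m, fun n hn => (abs_max_sub_max_le_abs (f n) (f m) 0).trans_lt (hm n hn)⟩

/-- A Cauchy function without limit `0` is bounded away from `0`, with constant sign. -/
theorem IsCauchy.pos_or_neg {f : I → K} (hf : IsCauchy f) (h0 : ¬ IsNull f) :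
    ∃ ε > 0, ∃ m, (∀ n ≥ m, ε ≤ f n) ∨ ∀ n ≥ m, f n ≤ -ε := by
  unfold IsNull at h0
  push Not at h0
  obtain ⟨ε, hε, h⟩ := h0
  obtain ⟨m, hm⟩ := hf.pair (half_pos hε)
  obtain ⟨k, hk, hfk⟩ := h m
  refine ⟨ε / 2, half_pos hε, m, ?_⟩
  rcases le_abs.1 hfk with h | h
  · left; intro n hn
    have := abs_lt.1 (hm n hn k hk); linarith
  · right; intro n hn
    have := abs_lt.1 (hm n hn k hk); linarith

variable [Nonempty I]

variable (I K) in
/-- The ring of Cauchy functions. -/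
def cauchyRing : Subring (I → K) where
  carrier := {f | IsCauchy f}
  zero_mem' := fun ε hε => ⟨Classical.arbitrary I, fun n _ => by simpa using hε⟩
  one_mem' := fun ε hε => ⟨Classical.arbitrary I, fun n _ => by simpa using hε⟩
  add_mem' := by
    intro f g hf hg
    refine isCauchy_of_pair fun ε hε => ?_
    obtain ⟨m, hm⟩ := hf.pair (half_pos hε)
    obtain ⟨l, hl⟩ := hg.pair (half_pos hε)
    refine ⟨max m l, fun n hn k hk => ?_⟩
    have h1 := abs_lt.1 (hm n (le_of_max_le_left hn) k (le_of_max_le_left hk))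
    have h2 := abs_lt.1 (hl n (le_of_max_le_right hn) k (le_of_max_le_right hk))
    simp only [Pi.add_apply]
    rw [abs_lt]; constructor <;> linarith
  neg_mem' := by
    intro f hf ε hε
    obtain ⟨m, hm⟩ := hf ε hε
    refine ⟨m, fun n hn => ?_⟩
    rw [Pi.neg_apply, Pi.neg_apply, neg_sub_neg, abs_sub_comm]
    exact hm n hn
  mul_mem' := by
    intro f g hf hg
    refine isCauchy_of_pair fun ε hε => ?_
    obtain ⟨B, hB, a, ha⟩ := hf.bounded
    obtain ⟨C, hC, b, hb⟩ := hg.bounded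
    obtain ⟨m, hm⟩ := hf.pair (div_pos (half_pos hε) hC)
    obtain ⟨l, hl⟩ := hg.pair (div_pos (half_pos hε) hB)
    refine ⟨max (max a b) (max m l), fun n hn k hk => ?_⟩
    simp only [ge_iff_le, max_le_iff] at hn hk
    have h1 := hm n hn.2.1 k hk.2.1
    have h2 := hl n hn.2.2 k hk.2.2
    have h3 := ha n hn.1.1
    have h4 := hb k hk.1.2
    rw [lt_div_iff₀ (by assumption)] at h1 h2
    calc |f n * g n - f k * g k| = |(f n - f k) * g k + f n * (g n - g k)| := by ring_nf
      _ ≤ |f n - f k| * |g k| + |f n| * |g n - g k| := by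
        rw [← abs_mul, ← abs_mul]; exact abs_add_le _ _
      _ ≤ |f n - f k| * C + B * |g n - g k| := by gcongr
      _ < ε := by linarith

variable (I K) in
/-- The ideal of functions with limit `0`. -/
def nullIdeal : Ideal (cauchyRing I K) where
  carrier := {f | IsNull f.1}
  zero_mem' := fun ε hε => ⟨Classical.arbitrary I, fun n _ => by simpa using hε⟩
  add_mem' := by
    intro f g hf hg ε hε
    obtain ⟨m, hm⟩ := hf _ (half_pos hε)
    obtain ⟨l, hl⟩ := hg _ (half_pos hε)
    refine ⟨max m l, fun n hn => ?_⟩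
    have h1 := abs_lt.1 (hm n (le_of_max_le_left hn))
    have h2 := abs_lt.1 (hl n (le_of_max_le_right hn))
    change |f.1 n + g.1 n| < ε
    rw [abs_lt]; constructor <;> linarith
  smul_mem' := by
    intro f g hg ε hε
    obtain ⟨B, hB, a, ha⟩ := IsCauchy.bounded f.2
    obtain ⟨l, hl⟩ := hg _ (div_pos hε hB)
    refine ⟨max a l, fun n hn => ?_⟩
    have h1 := ha n (le_of_max_le_left hn)
    have h2 := hl n (le_of_max_le_right hn)
    change |f.1 n * g.1 n| < ε
    rw [lt_div_iff₀ hB] at h2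
    rw [abs_mul]
    calc |f.1 n| * |g.1 n| ≤ B * |g.1 n| := by gcongr
      _ < ε := by linarith

theorem mem_nullIdeal {f : cauchyRing I K} : f ∈ nullIdeal I K ↔ IsNull f.1 := .rfl

/-- A Cauchy function that is not null is eventually bounded away from `0`, so its pointwise
reciprocal is Cauchy and inverts it modulo null functions. Default values of the reciprocal at early
indices do not matter. -/
instance : (nullIdeal I K).IsMaximal := by
  rw [Ideal.isMaximal_iff]
  constructor
  · intro h
    obtain ⟨m, hm⟩ := h 1 one_pos
    simpa using hm m (le_refl m)
  · intro J f hJ hf hfJ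
    obtain ⟨ε, hε, m, h⟩ := IsCauchy.pos_or_neg f.2 hf
    have h : ∀ n ≥ m, ε ≤ |f.1 n| := by
      intro n hn
      rcases h with h | h
      · exact (h n hn).trans (le_abs_self _)
      · have := h n hn
        exact le_trans (by linarith) (neg_le_abs _)
    have hg : IsCauchy fun n => (f.1 n)⁻¹ := by
      refine isCauchy_of_pair fun δ hδ => ?_
      -- The precision `δε²` compensates the denominator in `|1/a - 1/b| = |a - b| / |ab|`, where
      -- `|a|, |b| ≥ ε`.
      obtain ⟨l, hl⟩ := IsCauchy.pair f.2 (mul_pos hδ (mul_pos hε hε))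
      refine ⟨max m l, fun n hn k hk => ?_⟩
      simp only [ge_iff_le, max_le_iff] at hn hk
      have h1 := h n hn.1
      have h2 := h k hk.1
      have h3 := hl k hk.2 n hn.2
      have hn0 : f.1 n ≠ 0 := abs_pos.1 (hε.trans_le h1)
      have hk0 : f.1 k ≠ 0 := abs_pos.1 (hε.trans_le h2)
      rw [inv_sub_inv hn0 hk0, abs_div, div_lt_iff₀ (abs_pos.2 (mul_ne_zero hn0 hk0)), abs_mul]
      refine h3.trans_le ?_
      gcongr
    have : 1 - (⟨_, hg⟩ : cauchyRing I K) * f ∈ nullIdeal I K := by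
      intro δ hδ
      refine ⟨m, fun n hn => ?_⟩
      have hn0 : f.1 n ≠ 0 := abs_pos.1 (hε.trans_le (h n hn))
      change |1 - (f.1 n)⁻¹ * f.1 n| < δ
      rw [inv_mul_cancel₀ hn0, sub_self, abs_zero]
      exact hδ
    have h1 := J.add_mem (hJ this) (J.mul_mem_left ⟨_, hg⟩ hfJ)
    rwa [sub_add_cancel] at h1

noncomputable instance : Field (cauchyRing I K ⧸ nullIdeal I K) := Ideal.Quotient.field _

variable (I K) in
/-- The limits of nonnegative Cauchy functions. -/
noncomputable def cauchyCone : RingCone (cauchyRing I K ⧸ nullIdeal I K) where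
  carrier := {x | ∃ f : cauchyRing I K, (∀ n, 0 ≤ f.1 n) ∧ x = Ideal.Quotient.mk _ f}
  zero_mem' := ⟨0, fun _ => le_refl _, by simp⟩
  one_mem' := ⟨1, fun _ => zero_le_one, by simp⟩
  add_mem' := by
    rintro _ _ ⟨f, hf, rfl⟩ ⟨g, hg, rfl⟩
    exact ⟨f + g, fun n => add_nonneg (hf n) (hg n), by simp⟩
  mul_mem' := by
    rintro _ _ ⟨f, hf, rfl⟩ ⟨g, hg, rfl⟩
    exact ⟨f * g, fun n => mul_nonneg (hf n) (hg n), by simp⟩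
  eq_zero_of_mem_of_neg_mem' := by
    rintro _ ⟨f, hf, rfl⟩ ⟨g, hg, h⟩
    have : f + g ∈ nullIdeal I K := by
      rw [← Ideal.Quotient.eq_zero_iff_mem, map_add, ← h, add_neg_cancel]
    rw [Ideal.Quotient.eq_zero_iff_mem]
    intro ε hε
    obtain ⟨m, hm⟩ := this ε hε
    -- Both representatives are pointwise nonnegative, so the first is dominated by their null sum.
    refine ⟨m, fun n hn => lt_of_le_of_lt ?_ (hm n hn)⟩
    rw [abs_of_nonneg (hf n)]
    exact (le_add_of_nonneg_right (hg n)).trans (le_abs_self (f.1 n + g.1 n))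

/-- Replacing `f` by `max f 0` makes it nonnegative everywhere and changes nothing from the index
`m` on. -/
theorem mem_cauchyCone_of_eventually {f : cauchyRing I K} {m : I} (h : ∀ n ≥ m, 0 ≤ f.1 n) :
    Ideal.Quotient.mk _ f ∈ cauchyCone I K := by
  refine ⟨⟨_, IsCauchy.max_zero f.2⟩, fun n => le_max_right _ _, ?_⟩
  rw [Ideal.Quotient.eq]
  refine fun ε hε => ⟨m, fun n hn => ?_⟩
  change |f.1 n - max (f.1 n) 0| < ε
  rw [max_eq_left (h n hn), sub_self, abs_zero]
  exact hε

instance : HasMemOrNegMem (cauchyCone I K) where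
  mem_or_neg_mem x := by
    obtain ⟨f, rfl⟩ := Ideal.Quotient.mk_surjective x
    by_cases h0 : IsNull f.1
    · left
      rw [Ideal.Quotient.eq_zero_iff_mem.2 (mem_nullIdeal.2 h0)]
      exact zero_mem _
    · obtain ⟨ε, hε, m, h | h⟩ := IsCauchy.pos_or_neg f.2 h0
      · exact .inl (mem_cauchyCone_of_eventually fun n hn => hε.le.trans (h n hn))
      · right
        rw [← map_neg]
        refine mem_cauchyCone_of_eventually (m := m) fun n hn => ?_
        have := h n hn
        change 0 ≤ -f.1 n
        linarith

variable (I K) in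
/-- The constant functions. -/
def cauchyConst : K →+* cauchyRing I K where
  toFun a := ⟨fun _ => a, fun ε hε => ⟨Classical.arbitrary I, fun n _ => by simpa using hε⟩⟩
  map_zero' := rfl
  map_one' := rfl
  map_add' _ _ := rfl
  map_mul' _ _ := rfl

open Classical in
variable (I K) in
/-- Every ordered field `K` is dense in an ordered field in which all Cauchy functions from `I` to
`K` have limits. -/
theorem exists_completion :
    ∃ (R : Type) (_ : Field R) (_ : LinearOrder R) (_ : IsStrictOrderedRing R) (κ : K →+* R),
      StrictMono κ ∧ (∀ r > 0, ∃ ε > 0, κ ε ≤ r) ∧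
      ∀ f : I → K, IsCauchy f → ∃ r, ∀ ε > 0, ∃ m, ∀ n ≥ m, |r - κ (f n)| ≤ κ ε := by
  let _ : LinearOrder (cauchyRing I K ⧸ nullIdeal I K) := .mkOfAddGroupCone (cauchyCone I K)
  have : IsOrderedRing (cauchyRing I K ⧸ nullIdeal I K) :=
    IsOrderedRing.mkOfCone (cauchyCone I K)
  have : IsStrictOrderedRing (cauchyRing I K ⧸ nullIdeal I K) :=
    IsOrderedRing.toIsStrictOrderedRing _
  have key : ∀ (f g : cauchyRing I K) (m : I), (∀ n ≥ m, f.1 n ≤ g.1 n) →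
      (Ideal.Quotient.mk (nullIdeal I K) f) ≤ Ideal.Quotient.mk _ g := by
    intro f g m h
    change _ - _ ∈ cauchyCone I K
    rw [← map_sub]
    exact mem_cauchyCone_of_eventually fun n hn => sub_nonneg.2 (h n hn)
  have hm : Monotone ((Ideal.Quotient.mk (nullIdeal I K)).comp (cauchyConst I K)) :=
    fun a b h => key _ _ (Classical.arbitrary I) fun _ _ => h
  refine ⟨cauchyRing I K ⧸ nullIdeal I K, inferInstance, inferInstance, inferInstance,
    (Ideal.Quotient.mk _).comp (cauchyConst I K), hm.strictMono_of_injective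
    (RingHom.injective _), ?_, ?_⟩
  · intro r hr
    obtain ⟨f, rfl⟩ := Ideal.Quotient.mk_surjective r
    have h0 : ¬ IsNull f.1 := fun h0 =>
      hr.ne' (Ideal.Quotient.eq_zero_iff_mem.2 (mem_nullIdeal.2 h0))
    obtain ⟨ε, hε, m, h | h⟩ := IsCauchy.pos_or_neg f.2 h0
    · exact ⟨ε, hε, key (cauchyConst I K ε) f m h⟩
    · refine absurd (key f 0 m fun n hn => (h n hn).trans (neg_nonpos.2 hε.le)) ?_
      rw [map_zero]
      exact not_le_of_gt hr
  · intro f hf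
    refine ⟨Ideal.Quotient.mk _ ⟨f, hf⟩, fun ε hε => ?_⟩
    obtain ⟨m, hm⟩ := hf.pair hε
    refine ⟨m, fun n hn => abs_le.2 ⟨?_, ?_⟩⟩
    · rw [neg_le_sub_iff_le_add]
      rw [RingHom.comp_apply, RingHom.comp_apply, ← map_add]
      refine key _ _ m fun k hk => ?_
      change f n ≤ f k + ε
      have := abs_lt.1 (hm n hn k hk); linarith
    · rw [sub_le_iff_le_add]
      rw [RingHom.comp_apply, RingHom.comp_apply, ← map_add]
      refine key _ _ m fun k hk => ?_
      change f k ≤ ε + f n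
      have := abs_lt.1 (hm n hn k hk); linarith

end Completion

/-! ### The arithmetical terms read in a structure -/

namespace PreModel

variable (M : PreModel L)

def pred (a : M.carrier N) : M.carrier N := M.app (M.ev predT Val.nil) a
instance : _root_.Sub (M.carrier N) := ⟨fun a b => M.app (M.app (M.ev monusT Val.nil) a) b⟩
def cond (r a b : M.carrier N) : M.carrier N :=
  M.app (M.app (M.app (M.ev condT Val.nil) r) a) b
def pow2 (a : M.carrier N) : M.carrier N := M.app (M.ev pow2T Val.nil) a
def parity (a : M.carrier N) : M.carrier N := M.app (M.ev parityT Val.nil) a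
def half (a : M.carrier N) : M.carrier N := M.app (M.ev halfT Val.nil) a
def pair (a b : M.carrier N) : M.carrier N := M.app (M.app (M.ev pairT Val.nil) a) b
def fst (a : M.carrier N) : M.carrier N := M.app (M.ev fstT Val.nil) a
def snd (a : M.carrier N) : M.carrier N := M.app (M.ev sndT Val.nil) a

variable (s t u : Tm L Γ N) (ρ : M.Val Γ)

@[simp] theorem ev_pred : M.ev (ProofMining.pred t) ρ = M.pred (M.ev t ρ) := by
  simp [ProofMining.pred, pred]
@[simp] theorem ev_monus : M.ev (monus s t) ρ = M.ev s ρ - M.ev t ρ := by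
  simp [monus]; rfl
@[simp] theorem ev_cond :
    M.ev (ProofMining.cond s t u) ρ = M.cond (M.ev s ρ) (M.ev t ρ) (M.ev u ρ) := by
  simp [ProofMining.cond, cond]
@[simp] theorem ev_pow2 : M.ev (ProofMining.pow2 t) ρ = M.pow2 (M.ev t ρ) := by
  simp [ProofMining.pow2, pow2]
@[simp] theorem ev_parity : M.ev (ProofMining.parity t) ρ = M.parity (M.ev t ρ) := by
  simp [ProofMining.parity, parity]
@[simp] theorem ev_half : M.ev (ProofMining.half t) ρ = M.half (M.ev t ρ) := by
  simp [ProofMining.half, half]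
@[simp] theorem ev_pair : M.ev (ProofMining.pair s t) ρ = M.pair (M.ev s ρ) (M.ev t ρ) := by
  simp [ProofMining.pair, pair]
@[simp] theorem ev_fst : M.ev (ProofMining.fst t) ρ = M.fst (M.ev t ρ) := by
  simp [ProofMining.fst, fst]
@[simp] theorem ev_snd : M.ev (ProofMining.snd t) ρ = M.snd (M.ev t ρ) := by
  simp [ProofMining.snd, snd]

/-- Simultaneous recursion for two functions of type `0(0)`. -/
def recNN (i : Var [N, N] N) (n b c : M.carrier N) (f g : M.carrier (N ⇒ N ⇒ N ⇒ N)) :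
    M.carrier N :=
  M.app (M.app (M.app (M.app (M.app (M.cn (.R [N, N] i)) n) b) c) f) g

end PreModel

namespace Model

open PreModel

variable {T : Set (Fm L [])} {M : Model T}

/-! ## Functions on the natural numbers of a model -/

@[simp] theorem S_zero : M.S 0 = 1 := rfl

@[simp] theorem ev_num (n : ℕ) (ρ : M.Val Γ) : M.ev (num n) ρ = (n : M.carrier N) := by
  induction n with
  | zero => simp [num]
  | succ n ih => simp [num, ih, S_eq]

theorem one_le_of_ne_zero {a : M.carrier N} (h : a ≠ 0) : 1 ≤ a := by
  rw [← zero_add (1 : M.carrier N), add_one_le_iff']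
  exact pos_iff_ne_zero.2 h

@[simp] theorem pred_zero : M.pred 0 = 0 := by simp [PreModel.pred, predT]

@[simp] theorem pred_S (a : M.carrier N) : M.pred (M.S a) = a := by simp [PreModel.pred, predT]

theorem monus_zero (a : M.carrier N) : a - 0 = a :=
  show M.app (M.app (M.ev monusT Val.nil) a) 0 = a by simp [monusT]

theorem monus_S (a b : M.carrier N) : a - M.S b = M.pred (a - b) := by
  have h := recN_env (M := M) (t := ProofMining.pred v1) (ρ := (Val.nil.cons a).cons (M.S b))
    (ρ' := (Val.nil.cons a).cons b) (by simp) b a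
  change M.app (M.app (M.ev monusT Val.nil) a) (M.S b) =
    M.pred (M.app (M.app (M.ev monusT Val.nil) a) b)
  simp only [monusT, app_lam, PreModel.ev_recN, ev_v0, ev_v1, recN_S, PreModel.ev_pred, h]

/-- Both cases are carried through a single induction on `b`; the induction switches from the first
to the second when the difference reaches `0`. -/
theorem monus_spec (a b : M.carrier N) :
    (∃ c, a = b + c ∧ a - b = c) ∨ ∃ c, b = a + c ∧ a - b = 0 := by
  have := M.ind (.or (.ex N (.and (.eq v2 (add v1 v0)) (.eq (monus v2 v1) v0)))
    (.ex N (.and (.eq v1 (add v2 v0)) (.eq (monus v2 v1) zero)))) (Val.nil.cons a)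
    (.inl ⟨a, by simp [monus_zero]⟩) (fun n hn => by
      simp only [sat_or, sat_ex, sat_and, sat_eq, PreModel.ev_add, PreModel.ev_monus,
        PreModel.ev_zero, ev_v0, ev_v1, ev_v2, monus_S] at hn ⊢
      rcases hn with ⟨c, hc, h⟩ | ⟨c, hc, h⟩
      · rcases zero_or_S c with rfl | ⟨c, rfl⟩
        · exact .inr ⟨1, by rw [hc, S_eq, add_zero], by rw [h, pred_zero]⟩
        · exact .inl ⟨c, by rw [hc, S_eq, S_eq]; ring, by rw [h, pred_S]⟩
      · exact .inr ⟨M.S c, by rw [hc, add_S], by rw [h, pred_zero]⟩) b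
  simpa only [sat_or, sat_ex, sat_and, sat_eq, PreModel.ev_add, PreModel.ev_monus,
    PreModel.ev_zero, ev_v0, ev_v1, ev_v2] using this

instance : OrderedSub (M.carrier N) where
  tsub_le_iff_right a b c := by
    rcases monus_spec a b with ⟨d, h, h'⟩ | ⟨d, h, h'⟩
    · rw [h', h, add_comm, add_le_add_iff_right]
    · rw [h', h]
      exact ⟨fun _ => (le_add_of_nonneg_right zero_le).trans (le_add_of_nonneg_left zero_le),
        fun _ => zero_le⟩

theorem cond_zero (a b : M.carrier N) : M.cond 0 a b = a := by
  simp [PreModel.cond, condT]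

theorem cond_of_ne {r : M.carrier N} (h : r ≠ 0) (a b : M.carrier N) : M.cond r a b = b := by
  obtain ⟨r, rfl⟩ := (zero_or_S r).resolve_left h
  simp [PreModel.cond, condT]

theorem pow2_zero : M.pow2 0 = 1 := by
  simp [PreModel.pow2, pow2T]

theorem pow2_S (a : M.carrier N) : M.pow2 (M.S a) = M.pow2 a + M.pow2 a := by
  have h := recN_env (M := M) (t := add v1 v1) (ρ := Val.nil.cons (M.S a))
    (ρ' := Val.nil.cons a) (by simp) a 1
  have e : ∀ a, M.pow2 a = M.recN a 1 (M.ev (lam (lam (add v1 v1))) (Val.nil.cons a)) := by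
    intro a; simp [PreModel.pow2, pow2T]
  rw [e, e, recN_S, h]
  simp

theorem lt_pow2 (a : M.carrier N) : a < M.pow2 a := by
  have := M.ind (.ex N (.eq (ProofMining.pow2 v1) (succ (add v1 v0)))) Val.nil
    ⟨0, by simp [pow2_zero]⟩ (fun n hn => by
      simp only [sat_ex, sat_eq, PreModel.ev_pow2, PreModel.ev_succ, PreModel.ev_add, ev_v0,
        ev_v1, pow2_S] at hn ⊢
      obtain ⟨c, hc⟩ := hn
      exact ⟨n + c + c, by rw [hc]; simp only [S_eq]; ring⟩) a
  simp only [sat_ex, sat_eq, PreModel.ev_pow2, PreModel.ev_succ, PreModel.ev_add, ev_v0,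
        ev_v1, S_eq] at this
  exact lt_iff.2 this

theorem pow2_add (a b : M.carrier N) : M.pow2 (a + b) = M.pow2 a * M.pow2 b := by
  have := M.ind (.eq (ProofMining.pow2 (add v1 v0))
    (mul (ProofMining.pow2 v1) (ProofMining.pow2 v0))) (Val.nil.cons a)
    (by simp [pow2_zero]) (fun n hn => by simp_all [pow2_S, add_S, mul_add]) b
  simpa using this

theorem parity_zero : M.parity 0 = 0 := by
  simp [PreModel.parity, parityT]

theorem parity_S (a : M.carrier N) : M.parity (M.S a) = 1 - M.parity a := by
  have h := recN_env (M := M) (t := monus (num 1) v1) (ρ := Val.nil.cons (M.S a))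
    (ρ' := Val.nil.cons a) (by simp) a 0
  have e : ∀ a, M.parity a = M.recN a 0 (M.ev (lam (lam (monus (num 1) v1))) (Val.nil.cons a)) := by
    intro a; simp [PreModel.parity, parityT]
  rw [e, e, recN_S, h]
  simp

theorem half_zero : M.half 0 = 0 := by
  simp [PreModel.half, halfT]

theorem half_S (a : M.carrier N) : M.half (M.S a) = M.half a + M.parity a := by
  have h := recN_env (M := M) (t := add v1 (ProofMining.parity v0)) (ρ := Val.nil.cons (M.S a))
    (ρ' := Val.nil.cons a) (by simp) a 0
  have e : ∀ a, M.half a =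
      M.recN a 0 (M.ev (lam (lam (add v1 (ProofMining.parity v0)))) (Val.nil.cons a)) := by
    intro a; simp [PreModel.half, halfT]
  rw [e, e, recN_S, h]
  simp

theorem half_parity (a : M.carrier N) :
    a = M.half a + M.half a + M.parity a ∧ (M.parity a = 0 ∨ M.parity a = 1) := by
  have := M.ind (.and (.eq v0 (add (add (ProofMining.half v0) (ProofMining.half v0))
    (ProofMining.parity v0))) (.or (.eq (ProofMining.parity v0) zero)
    (.eq (ProofMining.parity v0) (num 1)))) Val.nil
    (by simp [half_zero, parity_zero]) (fun n hn => by
      simp only [sat_and, sat_or, sat_eq, PreModel.ev_add, PreModel.ev_half, PreModel.ev_parity,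
        PreModel.ev_zero, ev_v0, ev_num, Nat.cast_one, half_S, parity_S] at hn ⊢
      obtain ⟨h1, h2 | h2⟩ := hn <;> rw [h2] at h1 ⊢
      · refine ⟨?_, .inr (tsub_zero 1)⟩
        rw [tsub_zero, S_eq, add_zero]
        nth_rewrite 1 [h1]
        ring
      · refine ⟨?_, .inl (tsub_self 1)⟩
        rw [tsub_self, S_eq]
        nth_rewrite 1 [h1]
        ring) a
  simpa using this

theorem half_of_eq {a b : M.carrier N} (h : a = b + b) : M.half a = b := by
  obtain ⟨h1, h2⟩ := half_parity a
  rcases lt_trichotomy (M.half a) b with hlt | heq | hlt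
  · obtain ⟨c, rfl⟩ := lt_iff.1 hlt
    have : M.half a + M.half a + M.parity a < M.half a + M.half a + (c + c + 1 + 1) := by
      gcongr
      rcases h2 with h2 | h2 <;> rw [h2]
      · exact pos_of_ne_zero (by rw [← S_eq]; exact M.S_ne_zero _)
      · exact lt_add_of_pos_left 1 (pos_of_ne_zero (by rw [← S_eq]; exact M.S_ne_zero _))
    refine absurd ?_ this.ne
    rw [← h1]; nth_rewrite 1 [h]; ring
  · exact heq
  · obtain ⟨c, hc⟩ := lt_iff.1 hlt
    refine absurd h (ne_of_gt ?_)
    rw [h1, hc]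
    exact lt_iff.2 ⟨c + c + 1 + M.parity a, by ring⟩

theorem add_self_inj {a b : M.carrier N} (h : a + a = b + b) : a = b :=
  ((half_of_eq h).symm.trans (half_of_eq rfl)).symm

theorem half_of_eq_add_one {a b : M.carrier N} (h : a = b + b + 1) : M.half (a + 1) = b + 1 :=
  half_of_eq (by rw [h]; ring)

theorem parity_of_eq {a b : M.carrier N} (h : a = b + b) : M.parity a = 0 := by
  have h1 := (half_parity a).1
  rw [half_of_eq h] at h1
  exact add_left_cancel (a := b + b) (by rw [← h1, add_zero, h])

theorem parity_of_eq_add_one {a b : M.carrier N} (h : a = b + b + 1) : M.parity a = 1 := by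
  rw [h, ← S_eq, parity_S, parity_of_eq rfl, tsub_zero]

/-- Since `s² + s` is even, the halving in the pairing function is exact. Doubling removes the
division from all later computations. -/
theorem two_pair (a b : M.carrier N) :
    M.pair a b + M.pair a b = (a + b) * (a + b) + (a + (a + a)) + b := by
  have h : M.pair a b = M.half ((a + b) * (a + b) + (a + (a + a)) + b) := by
    simp [PreModel.pair, pairT]
  have e := M.ind (.ex N (.eq (add (mul v1 v1) v1) (add v0 v0))) Val.nil ⟨0, by simp⟩
    (fun n hn => by
      simp only [sat_ex, sat_eq, PreModel.ev_mul, PreModel.ev_add, ev_v0, ev_v1] at hn ⊢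
      obtain ⟨c, hc⟩ := hn
      refine ⟨c + n + 1, ?_⟩
      calc M.S n * M.S n + M.S n = n * n + n + n + n + 1 + 1 := by rw [S_eq]; ring
        _ = _ := by rw [hc]; ring) (a + b)
  simp only [sat_ex, sat_eq, PreModel.ev_mul, PreModel.ev_add, ev_v0, ev_v1] at e
  obtain ⟨c, hc⟩ := e
  have : (a + b) * (a + b) + (a + (a + a)) + b = (c + a) + (c + a) := by
    calc _ = (a + b) * (a + b) + (a + b) + (a + a) := by ring
      _ = _ := by rw [hc]; ring
  rw [h, half_of_eq this, this]

/-- With `s = a + b`, twice the code is `s² + s + 2a` with `a ≤ s`. Codes on a smaller diagonal are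
therefore smaller, so the code determines `s`, and then `a`. -/
theorem pair_injective {a b c d : M.carrier N} (h : M.pair a b = M.pair c d) : a = c ∧ b = d := by
  have key : ∀ {a b c d : M.carrier N}, M.pair a b = M.pair c d → ¬ a + b < c + d := by
    intro a b c d h hlt
    obtain ⟨k, hk⟩ := lt_iff.1 hlt
    have h2 : (a + b) * (a + b) + (a + (a + a)) + b = (c + d) * (c + d) + (c + (c + c)) + d := by
      rw [← two_pair, ← two_pair, h]
    refine absurd h2 (ne_of_lt (lt_iff.2 ⟨b + b + (a + b) * k + (a + b) * k + k * k + k + k + k +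
      1 + (c + c), ?_⟩))
    calc (c + d) * (c + d) + (c + (c + c)) + d = (c + d) * (c + d) + (c + d) + (c + c) := by ring
      _ = _ := by rw [hk]; ring
  have hs : a + b = c + d :=
    le_antisymm (not_lt.1 (key h.symm)) (not_lt.1 (key h))
  have h2 : (a + b) * (a + b) + (a + b) + (a + a) = (c + d) * (c + d) + (c + d) + (c + c) := by
    calc _ = M.pair a b + M.pair a b := by rw [two_pair]; ring
      _ = M.pair c d + M.pair c d := by rw [h]
      _ = _ := by rw [two_pair]; ring
  rw [hs] at h2
  have h3 : a + a = c + c := add_left_cancel h2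
  have h4 : a = c := add_self_inj h3
  subst h4
  exact ⟨rfl, add_left_cancel hs⟩

theorem recNN_zero (i : Var [N, N] N) (b c : M.carrier N) (f g : M.carrier (N ⇒ N ⇒ N ⇒ N)) :
    M.recNN i 0 b c f g = match i with
      | .z => b
      | .s _ => c := by
  have := M.ev_eq_of_eqT (τ := N) (.recNN_zero i v0 v1 v2 v3)
    ((((Val.nil.cons g).cons f).cons c).cons b)
  cases i with
  | z => exact this
  | s i => cases i with
    | z => exact this
    | s i => cases i

theorem recNN_S (i : Var [N, N] N) (n b c : M.carrier N) (f g : M.carrier (N ⇒ N ⇒ N ⇒ N)) :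
    M.recNN i (M.S n) b c f g = M.app (M.app (M.app (match i with
      | .z => f
      | .s _ => g) (M.recNN .z n b c f g)) (M.recNN (.s .z) n b c f g)) n := by
  have := M.ev_eq_of_eqT (τ := N) (.recNN_succ i (.var .z) (.var (.s .z)) (.var (.s (.s .z)))
    (.var (.s (.s (.s .z)))) (.var (.s (.s (.s (.s .z))))))
    (((((Val.nil.cons g).cons f).cons c).cons b).cons n)
  cases i with
  | z => exact this
  | s i => cases i with
    | z => exact this
    | s i => cases i

theorem fst_eq (n : M.carrier N) : M.fst n =
    M.recNN .z n 0 0 (M.ev pairStep₁ Val.nil) (M.ev pairStep₂ Val.nil) := by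
  simp [PreModel.fst, fstT, PreModel.recNN]

theorem snd_eq (n : M.carrier N) : M.snd n =
    M.recNN (.s .z) n 0 0 (M.ev pairStep₁ Val.nil) (M.ev pairStep₂ Val.nil) := by
  simp [PreModel.snd, sndT, PreModel.recNN]

theorem fst_zero : M.fst 0 = 0 := (fst_eq 0).trans (recNN_zero _ _ _ _ _)
theorem snd_zero : M.snd 0 = 0 := (snd_eq 0).trans (recNN_zero _ _ _ _ _)

theorem fst_S (n : M.carrier N) : M.fst (M.S n) = M.cond (M.snd n) 0 (M.S (M.fst n)) := by
  rw [fst_eq, recNN_S, ← fst_eq, ← snd_eq]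
  simp [pairStep₁]

theorem snd_S (n : M.carrier N) :
    M.snd (M.S n) = M.cond (M.snd n) (M.S (M.fst n)) (M.pred (M.snd n)) := by
  rw [snd_eq, recNN_S, ← fst_eq, ← snd_eq]
  simp [pairStep₂]

/-- Induction along the enumeration: the code grows by one both when moving along a diagonal and
when passing to the start of the next. -/
theorem pair_fst_snd (n : M.carrier N) : M.pair (M.fst n) (M.snd n) = n := by
  have := M.ind (.eq (ProofMining.pair (ProofMining.fst v0) (ProofMining.snd v0)) v0) Val.nil
    (by simp [fst_zero, snd_zero]; exact add_self_inj (by rw [two_pair]; simp)) (fun n hn => by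
      simp only [sat_eq, PreModel.ev_pair, PreModel.ev_fst, PreModel.ev_snd, ev_v0, fst_S,
        snd_S] at hn ⊢
      apply add_self_inj
      rcases zero_or_S (M.snd n) with h | ⟨k, h⟩
      · rw [h] at hn ⊢
        have h2 := two_pair (M.fst n) 0
        rw [hn] at h2
        rw [cond_zero, cond_zero, two_pair, S_eq, S_eq]
        calc _ = (M.fst n + 0) * (M.fst n + 0) + (M.fst n + (M.fst n + M.fst n)) + 0 + 1 + 1 := by
              ring
          _ = _ := by rw [← h2]; ring
      · rw [h] at hn ⊢
        have h2 := two_pair (M.fst n) (M.S k)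
        rw [hn, S_eq] at h2
        rw [cond_of_ne (M.S_ne_zero k), cond_of_ne (M.S_ne_zero k), pred_S, two_pair, S_eq, S_eq]
        calc _ = (M.fst n + (k + 1)) * (M.fst n + (k + 1)) + (M.fst n + (M.fst n + M.fst n)) +
              (k + 1) + 1 + 1 := by ring
          _ = _ := by rw [← h2]; ring) n
  simpa using this

/-- Apply the previous identity to the code of `(a, b)` and use injectivity of pairing. -/
theorem fst_pair (a b : M.carrier N) : M.fst (M.pair a b) = a :=
  (pair_injective (pair_fst_snd (M.pair a b))).1

theorem snd_pair (a b : M.carrier N) : M.snd (M.pair a b) = b :=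
  (pair_injective (pair_fst_snd (M.pair a b))).2

end Model

/-! ### Codes of rational numbers in a structure -/

namespace PreModel

variable (M : PreModel L)

def qpos (q : M.carrier N) : M.carrier N := M.app (M.ev qposT Val.nil) q
def qneg (q : M.carrier N) : M.carrier N := M.app (M.ev qnegT Val.nil) q
def qden (q : M.carrier N) : M.carrier N := M.S (M.snd q)
def qmk (a b d : M.carrier N) : M.carrier N :=
  M.app (M.app (M.app (M.ev qmkT Val.nil) a) b) d
def qadd (q r : M.carrier N) : M.carrier N := M.app (M.app (M.ev qaddT Val.nil) q) r
def qopp (q : M.carrier N) : M.carrier N := M.app (M.ev qoppT Val.nil) q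
def qabs (q : M.carrier N) : M.carrier N := M.app (M.ev qabsT Val.nil) q
def qmul (q r : M.carrier N) : M.carrier N := M.app (M.app (M.ev qmulT Val.nil) q) r
def qinv (q : M.carrier N) : M.carrier N := M.app (M.ev qinvT Val.nil) q
def qle (q r : M.carrier N) : M.carrier N := M.app (M.app (M.ev qleT Val.nil) q) r
def qlt (q r : M.carrier N) : M.carrier N := M.app (M.app (M.ev qltT Val.nil) q) r

variable (s t u : Tm L Γ N) (ρ : M.Val Γ)

@[simp] theorem ev_qpos : M.ev (ProofMining.qpos t) ρ = M.qpos (M.ev t ρ) := by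
  simp [ProofMining.qpos, qpos]
@[simp] theorem ev_qneg : M.ev (ProofMining.qneg t) ρ = M.qneg (M.ev t ρ) := by
  simp [ProofMining.qneg, qneg]
@[simp] theorem ev_qden : M.ev (ProofMining.qden t) ρ = M.qden (M.ev t ρ) := by
  simp [ProofMining.qden, qden]
@[simp] theorem ev_qmk :
    M.ev (ProofMining.qmk s t u) ρ = M.qmk (M.ev s ρ) (M.ev t ρ) (M.ev u ρ) := by
  simp [ProofMining.qmk, qmk]
@[simp] theorem ev_qadd : M.ev (ProofMining.qadd s t) ρ = M.qadd (M.ev s ρ) (M.ev t ρ) := by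
  simp [ProofMining.qadd, qadd]
@[simp] theorem ev_qopp : M.ev (ProofMining.qopp t) ρ = M.qopp (M.ev t ρ) := by
  simp [ProofMining.qopp, qopp]
@[simp] theorem ev_qabs : M.ev (ProofMining.qabs t) ρ = M.qabs (M.ev t ρ) := by
  simp [ProofMining.qabs, qabs]
@[simp] theorem ev_qmul : M.ev (ProofMining.qmul s t) ρ = M.qmul (M.ev s ρ) (M.ev t ρ) := by
  simp [ProofMining.qmul, qmul]
@[simp] theorem ev_qinv : M.ev (ProofMining.qinv t) ρ = M.qinv (M.ev t ρ) := by
  simp [ProofMining.qinv, qinv]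
@[simp] theorem ev_qleChar : M.ev (qleChar s t) ρ = M.qle (M.ev s ρ) (M.ev t ρ) := by
  simp [qleChar, qle]
@[simp] theorem ev_qltChar : M.ev (qltChar s t) ρ = M.qlt (M.ev s ρ) (M.ev t ρ) := by
  simp [qltChar, qlt]

end PreModel

namespace Model

open PreModel

variable {T : Set (Fm L [])} {M : Model T}

/-! ## The rational numbers of a model -/

theorem exists_Q (M : Model T) :
    ∃ (K : Type) (_ : Field K) (_ : LinearOrder K) (_ : IsStrictOrderedRing K)
      (ι : M.carrier N →+* K), StrictMono ι ∧ ∀ x : K, ∃ a, x ≤ ι a :=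
  exists_ordered_field (M.carrier N) fun _ => one_le_of_ne_zero

variable (M) in
/-- An ordered field that contains the natural numbers of the model as a cofinal subset. -/
def Q : Type := M.exists_Q.choose

noncomputable instance : Field M.Q := M.exists_Q.choose_spec.choose
noncomputable instance : LinearOrder M.Q := M.exists_Q.choose_spec.choose_spec.choose
instance : IsStrictOrderedRing M.Q := M.exists_Q.choose_spec.choose_spec.choose_spec.choose

variable (M) in
/-- The inclusion of the natural numbers of the model. -/
noncomputable def ι : M.carrier N →+* M.Q :=
  M.exists_Q.choose_spec.choose_spec.choose_spec.choose_spec.choose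

theorem ι_strictMono : StrictMono M.ι :=
  M.exists_Q.choose_spec.choose_spec.choose_spec.choose_spec.choose_spec.1

theorem exists_le_ι (x : M.Q) : ∃ a, x ≤ M.ι a :=
  M.exists_Q.choose_spec.choose_spec.choose_spec.choose_spec.choose_spec.2 x

theorem ι_nonneg (a : M.carrier N) : 0 ≤ M.ι a := by
  rw [← map_zero M.ι]; exact ι_strictMono.monotone zero_le

theorem ι_pos {a : M.carrier N} (h : a ≠ 0) : 0 < M.ι a := by
  rw [← map_zero M.ι]; exact ι_strictMono (pos_of_ne_zero h)

/-- One of the two truncated differences is `0`, so splitting a difference into positive and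
negative part keeps its value. -/
theorem ι_tsub (a b : M.carrier N) : M.ι (a - b) - M.ι (b - a) = M.ι a - M.ι b := by
  rcases le_total a b with h | h <;> obtain ⟨c, rfl⟩ := exists_add_of_le h
  · rw [add_tsub_cancel_left, tsub_eq_zero_of_le h]; simp
  · rw [add_tsub_cancel_left, tsub_eq_zero_of_le h]; simp

variable (M) in
/-- The value of a code of a rational number. -/
noncomputable def rv (q : M.carrier N) : M.Q := (M.ι (M.qpos q) - M.ι (M.qneg q)) / M.ι (M.qden q)

theorem qpos_eq (q : M.carrier N) : M.qpos q = M.cond (M.parity (M.fst q)) (M.half (M.fst q)) 0 := by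
  simp [PreModel.qpos, qposT]

theorem qneg_eq (q : M.carrier N) :
    M.qneg q = M.cond (M.parity (M.fst q)) 0 (M.half (M.S (M.fst q))) := by
  simp [PreModel.qneg, qnegT]

theorem qpos_or_qneg (q : M.carrier N) : M.qpos q = 0 ∨ M.qneg q = 0 := by
  by_cases h : M.parity (M.fst q) = 0
  · right; rw [qneg_eq, h, cond_zero]
  · left; rw [qpos_eq, cond_of_ne h]

theorem qden_pos (q : M.carrier N) : 0 < M.ι (M.qden q) := ι_pos (M.S_ne_zero _)

theorem qmk_eq (a b d : M.carrier N) : M.qmk a b d =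
    M.pair (M.cond (b - a) ((2 : ℕ) * (a - b)) (M.pred ((2 : ℕ) * (b - a)))) (M.pred d) := by
  simp [PreModel.qmk, qmkT]

/-- The denominator is stored as its predecessor, so a denominator `0` is read as `1`. The
reciprocal of `0` depends on this case. -/
theorem rv_qmk' (a b d : M.carrier N) :
    M.rv (M.qmk a b d) = (M.ι a - M.ι b) / M.ι (M.S (M.pred d)) := by
  rw [rv, ← ι_tsub a b, PreModel.qden, qpos_eq, qneg_eq, qmk_eq, fst_pair, snd_pair]
  congr 1
  rcases le_or_gt b a with h | h
  · have h0 : b - a = 0 := tsub_eq_zero_of_le h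
    have e : ((2 : ℕ) : M.carrier N) * (a - b) = (a - b) + (a - b) := by push_cast; ring
    rw [h0, cond_zero, parity_of_eq e, cond_zero, cond_zero, half_of_eq e]
  · have h0 : b - a ≠ 0 := (tsub_pos_of_lt h).ne'
    obtain ⟨c, hc⟩ := (zero_or_S (b - a)).resolve_left h0
    have e : M.pred ((2 : ℕ) * (b - a)) = c + c + 1 := by
      rw [hc, show ((2 : ℕ) : M.carrier N) * M.S c = M.S (c + c + 1) by
        simp only [S_eq]; push_cast; ring, pred_S]
    rw [cond_of_ne h0, parity_of_eq_add_one e, cond_of_ne one_ne_zero, cond_of_ne one_ne_zero,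
      S_eq, half_of_eq_add_one e, tsub_eq_zero_of_le h.le, hc, S_eq]

theorem rv_qmk (a b : M.carrier N) {d : M.carrier N} (hd : d ≠ 0) :
    M.rv (M.qmk a b d) = (M.ι a - M.ι b) / M.ι d := by
  obtain ⟨d, rfl⟩ := (zero_or_S d).resolve_left hd
  rw [rv_qmk', pred_S]

theorem qden_ne_zero (q : M.carrier N) : M.qden q ≠ 0 := M.S_ne_zero _

theorem qden_mul_ne (q r : M.carrier N) : M.qden q * M.qden r ≠ 0 :=
  mul_ne_zero (M.S_ne_zero _) (M.S_ne_zero _)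

theorem rv_qadd (q r : M.carrier N) : M.rv (M.qadd q r) = M.rv q + M.rv r := by
  have h : M.qadd q r = M.qmk (M.qpos q * M.qden r + M.qpos r * M.qden q)
      (M.qneg q * M.qden r + M.qneg r * M.qden q) (M.qden q * M.qden r) := by
    simp [PreModel.qadd, qaddT]
  have h1 := (qden_pos q).ne'
  have h2 := (qden_pos r).ne'
  rw [h, rv_qmk _ _ (qden_mul_ne q r), rv, rv]
  simp only [map_add, map_mul]
  field_simp
  ring

theorem rv_qopp (q : M.carrier N) : M.rv (M.qopp q) = -M.rv q := by
  have h : M.qopp q = M.qmk (M.qneg q) (M.qpos q) (M.qden q) := by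
    simp [PreModel.qopp, qoppT]
  rw [h, rv_qmk _ _ (qden_ne_zero q), rv, ← neg_div, neg_sub]

theorem rv_qabs (q : M.carrier N) : M.rv (M.qabs q) = |M.rv q| := by
  have h : M.qabs q = M.qmk (M.qpos q + M.qneg q) 0 (M.qden q) := by
    simp [PreModel.qabs, qabsT]
  rw [h, rv_qmk _ _ (qden_ne_zero q), rv, abs_div, abs_of_pos (qden_pos q)]
  congr 1
  rcases qpos_or_qneg q with h | h <;> rw [h] <;> simp [abs_of_nonneg, ι_nonneg]

theorem rv_qmul (q r : M.carrier N) : M.rv (M.qmul q r) = M.rv q * M.rv r := by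
  have h : M.qmul q r = M.qmk (M.qpos q * M.qpos r + M.qneg q * M.qneg r)
      (M.qpos q * M.qneg r + M.qneg q * M.qpos r) (M.qden q * M.qden r) := by
    simp [PreModel.qmul, qmulT]
  have h1 := (qden_pos q).ne'
  have h2 := (qden_pos r).ne'
  rw [h, rv_qmk _ _ (qden_mul_ne q r), rv, rv]
  simp only [map_add, map_mul]
  field_simp
  ring

theorem rv_qinv (q : M.carrier N) : M.rv (M.qinv q) = (M.rv q)⁻¹ := by
  have h : M.qinv q = M.qmk (M.cond (M.qpos q) 0 (M.qden q)) (M.cond (M.qneg q) 0 (M.qden q))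
      (M.qpos q + M.qneg q) := by
    simp [PreModel.qinv, qinvT]
  have h1 := (qden_pos q).ne'
  rw [h]
  by_cases hp : M.qpos q = 0
  · by_cases hn : M.qneg q = 0
    -- For a code of `0` the term produces `0` over the denominator `0`, read as `1`; this agrees
    -- with `0⁻¹ = 0`.
    · rw [hp, hn, cond_zero, rv_qmk', rv, hp, hn]; simp
    · rw [rv_qmk _ _ (by rwa [hp, zero_add]), rv, hp, cond_zero, cond_of_ne hn]
      simp [neg_div]
  · have hn := (qpos_or_qneg q).resolve_left hp
    rw [rv_qmk _ _ (by rwa [hn, add_zero]), rv, hn, cond_zero, cond_of_ne hp]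
    simp

theorem qle_eq_zero {q r : M.carrier N} : M.qle q r = 0 ↔ M.rv q ≤ M.rv r := by
  have h : M.qle q r = (M.qpos q * M.qden r + M.qneg r * M.qden q) -
      (M.qpos r * M.qden q + M.qneg q * M.qden r) := by
    simp [PreModel.qle, qleT]
  rw [h, tsub_eq_zero_iff_le, ← ι_strictMono.le_iff_le, rv, rv,
    div_le_div_iff₀ (qden_pos q) (qden_pos r)]
  simp only [map_add, map_mul]
  constructor <;> intro h <;> linarith

theorem qlt_eq_zero {q r : M.carrier N} : M.qlt q r = 0 ↔ M.rv q < M.rv r := by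
  have h : M.qlt q r = M.S (M.qpos q * M.qden r + M.qneg r * M.qden q) -
      (M.qpos r * M.qden q + M.qneg q * M.qden r) := by
    simp [PreModel.qlt, qltT]
  rw [h, tsub_eq_zero_iff_le, S_eq, add_one_le_iff', ← ι_strictMono.lt_iff_lt, rv, rv,
    div_lt_div_iff₀ (qden_pos q) (qden_pos r)]
  simp only [map_add, map_mul]
  constructor <;> intro h <;> linarith

variable (M) in
/-- The rational number `2⁻ⁿ`. -/
noncomputable def eps (n : M.carrier N) : M.Q := (M.ι (M.pow2 n))⁻¹

theorem pow2_ne_zero (n : M.carrier N) : M.pow2 n ≠ 0 := (zero_le.trans_lt (lt_pow2 n)).ne'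

theorem eps_pos (n : M.carrier N) : 0 < M.eps n := inv_pos.2 (ι_pos (pow2_ne_zero n))

@[simp] theorem eps_zero : M.eps 0 = 1 := by simp [eps, pow2_zero]

@[simp] theorem eps_S (n : M.carrier N) : M.eps (M.S n) = M.eps n / 2 := by
  rw [eps, pow2_S, map_add, ← two_mul, mul_inv, eps]; ring

theorem eps_add (n m : M.carrier N) : M.eps (n + m) = M.eps n * M.eps m := by
  rw [eps, pow2_add, map_mul, mul_inv, eps, eps]

theorem eps_le_one (n : M.carrier N) : M.eps n ≤ 1 := by
  rw [eps]
  apply inv_le_one_of_one_le₀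
  rw [← map_one M.ι]
  exact ι_strictMono.monotone (one_le_of_ne_zero (pow2_ne_zero n))

theorem eps_anti {n m : M.carrier N} (h : n ≤ m) : M.eps m ≤ M.eps n := by
  obtain ⟨c, rfl⟩ := exists_add_of_le h
  rw [eps_add]
  exact mul_le_of_le_one_right (eps_pos n).le (eps_le_one c)

/-- Some number `a` of the model bounds `x⁻¹`, and `a < 2^a`. Thus the powers `2⁻ⁿ` with `n` in the
model are coinitial among the positive elements, also when the field is not archimedean. -/
theorem exists_eps_lt {x : M.Q} (h : 0 < x) : ∃ n, M.eps n < x := by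
  obtain ⟨a, ha⟩ := exists_le_ι x⁻¹
  refine ⟨a, inv_lt_of_inv_lt₀ h (ha.trans_lt (ι_strictMono (lt_pow2 a)))⟩

@[simp] theorem rv_q2neg (t : Tm L Γ N) (ρ : M.Val Γ) :
    M.rv (M.ev (q2neg t) ρ) = M.eps (M.ev t ρ) := by
  rw [q2neg, ev_qmk, PreModel.ev_pow2, rv_qmk _ _ (pow2_ne_zero _)]
  simp [eps]

end Model

/-! ### Operations on representatives of real numbers in a structure -/

namespace PreModel

variable (M : PreModel L)

def good (f : M.carrier N1) (n : M.carrier N) : M.carrier N :=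
  M.app (M.app (M.ev goodT Val.nil) f) n
def hat (f : M.carrier N1) (n : M.carrier N) : M.carrier N :=
  M.app (M.app (M.ev hatT Val.nil) f) n
def addR (f g : M.carrier N1) : M.carrier N1 := M.app (M.app (M.ev addRT Val.nil) f) g
def negR (f : M.carrier N1) : M.carrier N1 := M.app (M.ev negRT Val.nil) f
def absR (f : M.carrier N1) : M.carrier N1 := M.app (M.ev absRT Val.nil) f
def mulShift (f g : M.carrier N1) : M.carrier N := M.app (M.app (M.ev mulShiftT Val.nil) f) g
def mulR (f g : M.carrier N1) : M.carrier N1 := M.app (M.app (M.ev mulRT Val.nil) f) g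
def invR (f : M.carrier N1) (l : M.carrier N) : M.carrier N1 :=
  M.app (M.app (M.ev invRT Val.nil) f) l

variable (f g : Tm L Γ N1) (t : Tm L Γ N) (ρ : M.Val Γ)

@[simp] theorem ev_hat : M.ev (ProofMining.hat f t) ρ = M.hat (M.ev f ρ) (M.ev t ρ) := by
  simp [ProofMining.hat, hat]
@[simp] theorem ev_addR : M.ev (ProofMining.addR f g) ρ = M.addR (M.ev f ρ) (M.ev g ρ) := by
  simp [ProofMining.addR, addR]
@[simp] theorem ev_negR : M.ev (ProofMining.negR f) ρ = M.negR (M.ev f ρ) := by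
  simp [ProofMining.negR, negR]
@[simp] theorem ev_absR : M.ev (ProofMining.absR f) ρ = M.absR (M.ev f ρ) := by
  simp [ProofMining.absR, absR]
@[simp] theorem ev_mulR : M.ev (ProofMining.mulR f g) ρ = M.mulR (M.ev f ρ) (M.ev g ρ) := by
  simp [ProofMining.mulR, mulR]
@[simp] theorem ev_invR : M.ev (ProofMining.invR f t) ρ = M.invR (M.ev f ρ) (M.ev t ρ) := by
  simp [ProofMining.invR, invR]

end PreModel

namespace Model

open PreModel

variable {T : Set (Fm L [])} {M : Model T}

/-! ## The real numbers of a model -/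

theorem exists_R (M : Model T) :
    ∃ (R : Type) (_ : Field R) (_ : LinearOrder R) (_ : IsStrictOrderedRing R)
      (κ : M.Q →+* R), StrictMono κ ∧ (∀ r > 0, ∃ ε > 0, κ ε ≤ r) ∧
        ∀ f : M.carrier N → M.Q, IsCauchy f → ∃ r, ∀ ε > 0, ∃ m, ∀ n ≥ m, |r - κ (f n)| ≤ κ ε :=
  exists_completion (M.carrier N) M.Q

variable (M) in
/-- An ordered field that contains the limits of the Cauchy sequences of the model. -/
def R : Type := M.exists_R.choose

noncomputable instance : Field M.R := M.exists_R.choose_spec.choose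
noncomputable instance : LinearOrder M.R := M.exists_R.choose_spec.choose_spec.choose
instance : IsStrictOrderedRing M.R := M.exists_R.choose_spec.choose_spec.choose_spec.choose

variable (M) in
/-- The inclusion of the rational numbers. -/
noncomputable def κ : M.Q →+* M.R :=
  M.exists_R.choose_spec.choose_spec.choose_spec.choose_spec.choose

theorem κ_strictMono : StrictMono M.κ :=
  M.exists_R.choose_spec.choose_spec.choose_spec.choose_spec.choose_spec.1

theorem exists_κ_le {r : M.R} (h : 0 < r) : ∃ ε > 0, M.κ ε ≤ r :=
  M.exists_R.choose_spec.choose_spec.choose_spec.choose_spec.choose_spec.2.1 r h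

theorem exists_limit {f : M.carrier N → M.Q} (h : IsCauchy f) :
    ∃ r, ∀ ε > 0, ∃ m, ∀ n ≥ m, |r - M.κ (f n)| ≤ M.κ ε :=
  M.exists_R.choose_spec.choose_spec.choose_spec.choose_spec.choose_spec.2.2 f h

theorem κ_abs (x : M.Q) : M.κ |x| = |M.κ x| := by
  rcases le_total 0 x with h | h
  · rw [abs_of_nonneg h, abs_of_nonneg (by simpa using κ_strictMono.monotone h)]
  · rw [abs_of_nonpos h, abs_of_nonpos (by simpa using κ_strictMono.monotone h), map_neg]

variable (M) in
/-- The real number `2⁻ⁿ`. -/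
noncomputable def δ (n : M.carrier N) : M.R := M.κ (M.eps n)

theorem δ_pos (n : M.carrier N) : 0 < M.δ n := by
  simpa [δ] using κ_strictMono (eps_pos n)

@[simp] theorem δ_S (n : M.carrier N) : M.δ (M.S n) = M.δ n / 2 := by
  rw [δ, eps_S, map_div₀, map_ofNat, δ]

theorem δ_add (n m : M.carrier N) : M.δ (n + m) = M.δ n * M.δ m := by simp [δ, eps_add]

theorem δ_anti {n m : M.carrier N} (h : n ≤ m) : M.δ m ≤ M.δ n := κ_strictMono.monotone (eps_anti h)

theorem exists_δ_lt {r : M.R} (h : 0 < r) : ∃ n, M.δ n < r := by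
  obtain ⟨ε, hε, h⟩ := exists_κ_le h
  obtain ⟨n, hn⟩ := exists_eps_lt hε
  exact ⟨n, (κ_strictMono hn).trans_le h⟩

/-- Precision `2⁻ⁿ` up to a fixed factor is enough to identify elements, because `2⁻ⁿ` falls below
every positive element. -/
theorem eq_of_abs_sub_le {r r' C : M.R} (h : ∀ n, |r - r'| ≤ C * M.δ n) : r = r' := by
  by_contra hne
  have hp : 0 < |r - r'| := abs_pos.2 (sub_ne_zero.2 hne)
  have hC : 0 < C := by
    have := hp.trans_le (h 0)
    exact pos_of_mul_pos_left this (δ_pos _).le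
  obtain ⟨n, hn⟩ := exists_δ_lt (div_pos hp hC)
  have := h n
  rw [lt_div_iff₀' hC] at hn
  exact absurd this hn.not_ge

theorem good_zero (f : M.carrier N1) : M.good f 0 = 0 := by
  simp [PreModel.good, goodT]

theorem good_S (f : M.carrier N1) (k : M.carrier N) : M.good f (M.S k) =
    M.cond ((k - M.good f k) + M.qlt (M.qabs (M.qadd (M.app f k) (M.qopp (M.app f (M.S k)))))
      (M.ev (q2neg v0) (Val.nil.cons (M.S k)))) (M.S k) (M.good f k) := by
  have h := recN_env (M := M) (t := ProofMining.cond (add (monus v0 v1) (qltChar (qabs (qadd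
      (v3 ⬝ v0) (qopp (v3 ⬝ succ v0)))) (q2neg (succ v0)))) (succ v0) v1)
    (ρ := (Val.nil.cons f).cons (M.S k)) (ρ' := (Val.nil.cons f).cons k)
    (fun a n => by simp [q2neg]) k 0
  have e : ∀ k, M.good f k = M.recN k 0 (M.ev (lam (lam (ProofMining.cond (add (monus v0 v1)
      (qltChar (qabs (qadd (v3 ⬝ v0) (qopp (v3 ⬝ succ v0)))) (q2neg (succ v0)))) (succ v0) v1)))
      ((Val.nil.cons f).cons k)) := by
    intro k; simp [PreModel.good, goodT]
  rw [e, e, recN_S, h]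
  simp [q2neg]

theorem good_eq (f : M.carrier N1) (n : M.carrier N) :
    M.app (M.app (M.ev goodT Val.nil) f) n = M.good f n := rfl

theorem good_le (f : M.carrier N1) (n : M.carrier N) : M.good f n ≤ n := by
  have := M.ind (.eq (monus (cl goodT ⬝ v1 ⬝ v0) v0) zero) (Val.nil.cons f)
    (by simp [good_eq, good_zero]) (fun n h => by
      simp only [sat_eq, ev_monus, ev_app, ev_cl, ev_v1, ev_v0, ev_zero, good_eq,
        tsub_eq_zero_iff_le] at h ⊢
      rw [good_S]
      by_cases hc : n - M.good f n + M.qlt (M.qabs (M.qadd (M.app f n)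
        (M.qopp (M.app f (M.S n))))) (M.ev (q2neg v0) (Val.nil.cons (M.S n))) = 0
      · rw [hc, cond_zero]
      · rw [cond_of_ne hc]
        exact h.trans (by rw [S_eq]; exact le_self_add)) n
  simpa [good_eq, tsub_eq_zero_iff_le] using this

theorem hat_eq (f : M.carrier N1) (n : M.carrier N) : M.hat f n = M.app f (M.good f n) := by
  simp [PreModel.hat, hatT, PreModel.good]

variable (M) in
/-- The terms of a sequence of rational numbers. -/
noncomputable def tv (f : M.carrier N1) (n : M.carrier N) : M.Q := M.rv (M.app f n)

variable (M) in
/-- The terms of the regularized sequence of rational numbers. -/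
noncomputable def hv (f : M.carrier N1) (n : M.carrier N) : M.Q := M.rv (M.hat f n)

theorem hv_eq (f : M.carrier N1) (n : M.carrier N) : M.rv (M.hat f n) = M.hv f n := rfl

theorem good_S_test {f : M.carrier N1} {k : M.carrier N} :
    (k - M.good f k) + M.qlt (M.qabs (M.qadd (M.app f k) (M.qopp (M.app f (M.S k)))))
      (M.ev (q2neg v0) (Val.nil.cons (M.S k))) = 0 ↔
    M.good f k = k ∧ |M.tv f k - M.tv f (M.S k)| < M.eps (M.S k) := by
  rw [add_eq_zero, tsub_eq_zero_iff_le, qlt_eq_zero, rv_qabs, rv_qadd, rv_qopp, rv_q2neg,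
    ← sub_eq_add_neg]
  exact and_congr_left fun _ => ⟨fun h => le_antisymm (good_le f k) h, fun h => h.ge⟩

/-- Either the test succeeds, which is exactly the desired bound, or the last good index stays put
and the two regularized terms coincide. -/
theorem abs_hv_sub_S (f : M.carrier N1) (k : M.carrier N) :
    |M.hv f k - M.hv f (M.S k)| < M.eps (M.S k) := by
  by_cases h : M.good f k = k ∧ |M.tv f k - M.tv f (M.S k)| < M.eps (M.S k)
  · rw [hv, hv, hat_eq, hat_eq, good_S, good_S_test.2 h, cond_zero, h.1]
    exact h.2
  · rw [hv, hv, hat_eq, hat_eq, good_S, cond_of_ne (mt good_S_test.1 h), sub_self, abs_zero]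
    exact eps_pos _

/-- Regularization does not change a sequence that converges fast already, so the values of the
arithmetical terms can be computed from their literal terms. -/
theorem hv_eq_tv {f : M.carrier N1} (h : ∀ k, |M.tv f k - M.tv f (M.S k)| < M.eps (M.S k))
    (n : M.carrier N) : M.hv f n = M.tv f n := by
  have := M.ind (.eq (cl goodT ⬝ v1 ⬝ v0) v0) (Val.nil.cons f)
    (by simp [good_eq, good_zero]) (fun n hn => by
      simp only [sat_eq, ev_app, ev_cl, ev_v1, ev_v0, good_eq] at hn ⊢
      rw [good_S, good_S_test.2 ⟨hn, h n⟩, cond_zero]) n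
  simp only [sat_eq, ev_app, ev_cl, ev_v1, ev_v0, good_eq] at this
  rw [hv, hat_eq, this, tv]

/-- The telescoping sum may have nonstandard length and is handled by internal induction. Keeping
the subtracted term `2⁻⁽ⁿ⁺ʲ⁾` makes the bound inductive. -/
theorem abs_hv_sub_add (f : M.carrier N1) (n j : M.carrier N) :
    |M.hv f n - M.hv f (n + j)| ≤ M.eps n - M.eps (n + j) := by
  have := M.ind (.eq (qleChar (qabs (qadd (ProofMining.hat v2 v1)
      (qopp (ProofMining.hat v2 (add v1 v0))))) (qadd (q2neg v1) (qopp (q2neg (add v1 v0))))) zero)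
    ((Val.nil.cons f).cons n)
    (by simp [qle_eq_zero, rv_qabs, rv_qadd, rv_qopp]) (fun j hj => by
      simp only [sat_eq, ev_qleChar, ev_zero, qle_eq_zero, ev_qabs, ev_qadd, ev_qopp, rv_qabs,
        rv_qadd, rv_qopp, ev_hat, ev_v2, ev_v1, ev_v0, ev_add, rv_q2neg, add_S] at hj ⊢
      have h := abs_hv_sub_S f (n + j)
      rw [hv, hv] at h
      rw [eps_S] at h ⊢
      rw [abs_le] at hj ⊢
      rw [abs_lt] at h
      constructor <;> linarith) j
  simp only [sat_eq, ev_qleChar, ev_zero, qle_eq_zero, ev_qabs, ev_qadd, ev_qopp, rv_qabs,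
        rv_qadd, rv_qopp, ev_hat, ev_v2, ev_v1, ev_v0, ev_add, rv_q2neg, ← sub_eq_add_neg] at this
  exact this

theorem abs_hv_sub_lt (f : M.carrier N1) {n m : M.carrier N} (h : n ≤ m) :
    |M.hv f n - M.hv f m| < M.eps n := by
  obtain ⟨j, rfl⟩ := exists_add_of_le h
  exact (abs_hv_sub_add f n j).trans_lt (sub_lt_self _ (eps_pos _))

theorem isCauchy_hv (f : M.carrier N1) : IsCauchy (M.hv f) := fun ε hε => by
  obtain ⟨m, hm⟩ := exists_eps_lt hε
  exact ⟨m, fun n hn => by rw [abs_sub_comm]; exact (abs_hv_sub_lt f hn).trans hm⟩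

variable (M) in
/-- The real number represented by an object of type `1`. -/
noncomputable def val (f : M.carrier N1) : M.R := (exists_limit (isCauchy_hv f)).choose

theorem abs_val_sub_le (f : M.carrier N1) (n : M.carrier N) :
    |M.val f - M.κ (M.hv f n)| ≤ M.δ n := by
  refine le_of_forall_pos_le_add fun e he => ?_
  obtain ⟨ε, hε, hle⟩ := exists_κ_le he
  obtain ⟨m, hm⟩ := (exists_limit (isCauchy_hv f)).choose_spec ε hε
  have h1 := hm (max n m) (le_max_right _ _)
  have h2 := κ_strictMono (abs_hv_sub_lt f (le_max_left n m))
  rw [κ_abs, map_sub, abs_lt] at h2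
  rw [abs_le] at h1 ⊢
  change -_ ≤ M.val f - _ ∧ M.val f - _ ≤ _ at h1
  rw [δ]
  constructor <;> linarith

/-- Comparing with the next term makes the error strict. The strict test in the definition of `=_ℝ`
needs this. -/
theorem abs_val_sub_lt (f : M.carrier N1) (n : M.carrier N) :
    |M.val f - M.κ (M.hv f n)| < M.δ n := by
  have h1 := abs_val_sub_le f (M.S n)
  have h2 := κ_strictMono (abs_hv_sub_S f n)
  rw [κ_abs, map_sub, ← δ, abs_lt] at h2
  rw [δ_S] at h1 h2
  rw [abs_le] at h1
  rw [abs_lt]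
  constructor <;> linarith

theorem val_eq_of_hv {f : M.carrier N1} {r C : M.R}
    (h : ∀ n, |r - M.κ (M.hv f n)| ≤ C * M.δ n) : M.val f = r := by
  refine eq_of_abs_sub_le (C := C + 1) fun n => ?_
  have h1 := abs_val_sub_le f n
  have h2 := h n
  rw [abs_le] at *
  constructor <;> linarith

/-- The value of a sequence of rational numbers that converges fast. -/
theorem val_eq {f : M.carrier N1} {r : M.R} (C : M.R)
    (hf : ∀ k, |M.tv f k - M.tv f (M.S k)| < M.eps (M.S k))
    (h : ∀ n, |r - M.κ (M.tv f n)| ≤ C * M.δ n) : M.val f = r :=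
  val_eq_of_hv (C := C) fun n => by rw [hv_eq_tv hf]; exact h n

theorem val_ratR (q : Tm L Γ N) (ρ : M.Val Γ) : M.val (M.ev (ratR q) ρ) = M.κ (M.rv (M.ev q ρ)) := by
  have h : ∀ k, M.tv (M.ev (ratR q) ρ) k = M.rv (M.ev q ρ) := fun k => by simp [tv, ratR]
  refine val_eq 0 (fun k => ?_) fun n => ?_
  · simp only [h, sub_self, abs_zero, eps_pos]
  · simp [h]

@[simp] theorem val_zeroR (ρ : M.Val Γ) : M.val (M.ev zeroR ρ) = 0 := by
  rw [zeroR, val_ratR, ev_qmk, ev_num, Nat.cast_one, rv_qmk _ _ one_ne_zero]; simp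

@[simp] theorem val_oneR (ρ : M.Val Γ) : M.val (M.ev oneR ρ) = 1 := by
  rw [oneR, val_ratR, ev_qmk, ev_num, Nat.cast_one, rv_qmk _ _ one_ne_zero]; simp

@[simp] theorem val_halfR (ρ : M.Val Γ) : M.val (M.ev halfR ρ) = 2⁻¹ := by
  rw [halfR, val_ratR, ev_qmk, ev_num, ev_num, rv_qmk _ _ (by simp)]; simp [map_ofNat M.ι, map_ofNat M.κ]

@[simp] theorem val_quarterR (ρ : M.Val Γ) : M.val (M.ev quarterR ρ) = 4⁻¹ := by
  rw [quarterR, val_ratR, ev_qmk, ev_num, ev_num, rv_qmk _ _ (by simp)]; simp [map_ofNat M.ι, map_ofNat M.κ]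

@[simp] theorem val_r2neg (t : Tm L Γ N) (ρ : M.Val Γ) : M.val (M.ev (r2neg t) ρ) = M.δ (M.ev t ρ) := by
  rw [r2neg, val_ratR, rv_q2neg, δ]

theorem abs_val_sub_lt' (f : M.carrier N1) (n : M.carrier N) :
    -M.δ n < M.val f - M.κ (M.hv f n) ∧ M.val f - M.κ (M.hv f n) < M.δ n :=
  abs_lt.1 (abs_val_sub_lt f n)

theorem abs_hv_sub_S' (f : M.carrier N1) (n : M.carrier N) :
    -(M.eps n / 2) < M.hv f n - M.hv f (M.S n) ∧ M.hv f n - M.hv f (M.S n) < M.eps n / 2 := by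
  rw [← eps_S]; exact abs_lt.1 (abs_hv_sub_S f n)

@[simp] theorem val_addR (f g : M.carrier N1) : M.val (M.addR f g) = M.val f + M.val g := by
  have h : ∀ k, M.tv (M.addR f g) k = M.hv f (M.S k) + M.hv g (M.S k) := fun k => by
    simp [tv, PreModel.addR, addRT, rv_qadd, hv]
  refine val_eq 1 (fun k => ?_) fun n => ?_
  · rw [h, h, eps_S, abs_lt]
    have h1 := abs_hv_sub_S' f (M.S k)
    have h2 := abs_hv_sub_S' g (M.S k)
    rw [eps_S] at h1 h2
    constructor <;> linarith [h1.1, h1.2, h2.1, h2.2]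
  · rw [h, map_add, abs_le]
    have h1 := abs_val_sub_lt' f (M.S n)
    have h2 := abs_val_sub_lt' g (M.S n)
    rw [δ_S] at h1 h2
    constructor <;> linarith [h1.1, h1.2, h2.1, h2.2]

@[simp] theorem val_negR (f : M.carrier N1) : M.val (M.negR f) = -M.val f := by
  have h : ∀ k, M.tv (M.negR f) k = -M.hv f k := fun k => by
    simp [tv, PreModel.negR, negRT, rv_qopp, hv]
  refine val_eq 1 (fun k => ?_) fun n => ?_
  · rw [h, h, ← abs_neg]
    simpa [neg_add_eq_sub, abs_sub_comm] using abs_hv_sub_S f k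
  · have := (abs_val_sub_lt f n).le
    rw [← abs_neg] at this
    rwa [h, map_neg, one_mul, ← neg_sub']

@[simp] theorem val_absR (f : M.carrier N1) : M.val (M.absR f) = |M.val f| := by
  have h : ∀ k, M.tv (M.absR f) k = |M.hv f k| := fun k => by
    simp [tv, PreModel.absR, absRT, rv_qabs, hv]
  refine val_eq 1 (fun k => ?_) fun n => ?_
  · rw [h, h]
    exact (abs_abs_sub_abs_le_abs_sub _ _).trans_lt (abs_hv_sub_S f k)
  · rw [h, one_mul, κ_abs]
    exact (abs_abs_sub_abs_le_abs_sub _ _).trans (abs_val_sub_lt f n).le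

@[simp] theorem val_subR (f g : Tm L Γ N1) (ρ : M.Val Γ) :
    M.val (M.ev (subR f g) ρ) = M.val (M.ev f ρ) - M.val (M.ev g ρ) := by
  simp [subR, sub_eq_add_neg]

/-- The terms with index `n + 1` are each off by less than `2⁻⁽ⁿ⁺¹⁾`, so the difference compared
with `2⁻ⁿ` is off by less than `2⁻ⁿ`. -/
theorem sat_ltR (f g : Tm L Γ N1) (ρ : M.Val Γ) :
    M.sat (ltR f g) ρ ↔ M.val (M.ev f ρ) < M.val (M.ev g ρ) := by
  simp only [ltR, sat_ex, sat_eq, ev_qleChar, ev_zero, qle_eq_zero, rv_q2neg, ev_qadd, ev_qopp,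
    rv_qadd, rv_qopp, ev_hat, ev_shift, ev_succ, ev_v0, hv_eq]
  constructor
  · rintro ⟨n, h⟩
    have h1 := abs_val_sub_lt' (M.ev f ρ) (M.S n)
    have h2 := abs_val_sub_lt' (M.ev g ρ) (M.S n)
    have h := κ_strictMono.monotone h
    rw [← δ, map_add, map_neg] at h
    rw [δ_S] at h1 h2
    linarith [h1.1, h1.2, h2.1, h2.2]
  · intro h
    -- Half of the gap absorbs the approximation error; the other half exceeds the tested bound
    -- `2⁻ⁿ`.
    obtain ⟨n, hn⟩ := exists_δ_lt (half_pos (sub_pos.2 h))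
    refine ⟨n, κ_strictMono.le_iff_le.1 ?_⟩
    have h1 := abs_val_sub_lt' (M.ev f ρ) (M.S n)
    have h2 := abs_val_sub_lt' (M.ev g ρ) (M.S n)
    rw [← δ, map_add, map_neg]
    rw [δ_S] at h1 h2
    linarith [h1.1, h1.2, h2.1, h2.2]

theorem sat_neg (A : Fm L Γ) (ρ : M.Val Γ) : M.sat A.neg ρ ↔ ¬ M.sat A ρ := by
  have : (0 : M.carrier N) ≠ 1 := zero_ne_one
  simp [Fm.neg, Fm.bot, this]

theorem sat_leR (f g : Tm L Γ N1) (ρ : M.Val Γ) :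
    M.sat (leR f g) ρ ↔ M.val (M.ev f ρ) ≤ M.val (M.ev g ρ) := by
  rw [leR, sat_neg, sat_ltR, not_lt]

theorem sat_eqR (f g : Tm L Γ N1) (ρ : M.Val Γ) :
    M.sat (eqR f g) ρ ↔ M.val (M.ev f ρ) = M.val (M.ev g ρ) := by
  simp only [eqR, sat_all, sat_eq, ev_qltChar, ev_zero, qlt_eq_zero, rv_q2neg, ev_qadd, ev_qopp,
    ev_qabs, rv_qabs, rv_qadd, rv_qopp, ev_hat, ev_shift, ev_succ, ev_v0, hv_eq]
  constructor
  · intro h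
    refine eq_of_abs_sub_le (C := 2) fun n => ?_
    have h1 := abs_val_sub_lt' (M.ev f ρ) (M.S n)
    have h2 := abs_val_sub_lt' (M.ev g ρ) (M.S n)
    have h := κ_strictMono (h n)
    rw [← δ, κ_abs, map_add, map_neg, abs_lt] at h
    rw [δ_S] at h1 h2
    rw [abs_le]
    constructor <;> linarith [h1.1, h1.2, h2.1, h2.2, h.1, h.2]
  · intro h n
    refine κ_strictMono.lt_iff_lt.1 ?_
    have h1 := abs_val_sub_lt' (M.ev f ρ) (M.S n)
    have h2 := abs_val_sub_lt' (M.ev g ρ) (M.S n)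
    rw [← δ, κ_abs, map_add, map_neg, abs_lt]
    rw [δ_S] at h1 h2
    constructor <;> linarith [h1.1, h1.2, h2.1, h2.2]

theorem abs_rv_le (q : M.carrier N) : |M.rv q| ≤ M.ι (M.qpos q) + M.ι (M.qneg q) := by
  have h1 : 1 ≤ M.ι (M.qden q) := by
    rw [← map_one M.ι]; exact ι_strictMono.monotone (one_le_of_ne_zero (qden_ne_zero q))
  rw [rv, abs_div, abs_of_pos (qden_pos q)]
  refine (div_le_self (abs_nonneg _) h1).trans ?_
  rw [abs_le]
  constructor <;> linarith [ι_nonneg (M.qpos q), ι_nonneg (M.qneg q)]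

theorem abs_hv_le (f : M.carrier N1) (n : M.carrier N) : |M.hv f n| ≤ |M.hv f 0| + 1 := by
  have h := abs_hv_sub_lt f (zero_le (a := n))
  rw [eps_zero, abs_sub_comm] at h
  have := abs_sub_abs_le_abs_sub (M.hv f n) (M.hv f 0)
  linarith

/-- The shift is one more than a bound for the sum of the initial absolute values. A second unit
comes from `a + 1 ≤ 2^a`; together they give the summand `2`. -/
theorem eps_mulShift (f g : M.carrier N1) :
    (|M.hv f 0| + |M.hv g 0| + 2) * M.eps (M.mulShift f g) ≤ 1 := by
  have h : M.mulShift f g = M.S ((M.qpos (M.hat f 0) + M.qneg (M.hat f 0)) +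
      (M.qpos (M.hat g 0) + M.qneg (M.hat g 0))) := by
    simp [PreModel.mulShift, mulShiftT]
  have h1 := abs_rv_le (M.hat f 0)
  have h2 := abs_rv_le (M.hat g 0)
  have h3 := add_one_le_iff'.2 (lt_pow2 (M.mulShift f g))
  have h4 := ι_strictMono.monotone h3
  have h5 : |M.hv f 0| + |M.hv g 0| + 2 ≤ M.ι (M.pow2 (M.mulShift f g)) := by
    refine le_trans ?_ h4
    rw [h, S_eq]
    simp only [map_add, map_one]
    rw [hv, hv]
    linarith
  rw [eps, mul_inv_le_iff₀ (ι_pos (pow2_ne_zero _)), one_mul]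
  exact h5

@[simp] theorem val_mulR (f g : M.carrier N1) : M.val (M.mulR f g) = M.val f * M.val g := by
  have h : ∀ k, M.tv (M.mulR f g) k =
      M.hv f (k + M.mulShift f g) * M.hv g (k + M.mulShift f g) := fun k => by
    simp [tv, PreModel.mulR, mulRT, rv_qmul, hv, PreModel.mulShift]
  -- In the product estimate the terms of `f` are bounded by `|f 0| + 1`, and the other factor is
  -- the limit of `g` itself.
  refine val_eq (M.κ (|M.hv f 0| + 1) + |M.val g|) (fun k => ?_) fun n => ?_
  · rw [h, h, S_add]
    set i := k + M.mulShift f g with hi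
    have e1 := abs_hv_le f i
    have e2 := abs_hv_le g (M.S i)
    have e3 := abs_hv_sub_S f i
    have e4 := abs_hv_sub_S g i
    calc |M.hv f i * M.hv g i - M.hv f (M.S i) * M.hv g (M.S i)|
        = |M.hv f i * (M.hv g i - M.hv g (M.S i)) + (M.hv f i - M.hv f (M.S i)) * M.hv g (M.S i)| := by
          congr 1; ring
      _ ≤ |M.hv f i| * |M.hv g i - M.hv g (M.S i)| + |M.hv f i - M.hv f (M.S i)| * |M.hv g (M.S i)| := by
          rw [← abs_mul, ← abs_mul]; exact abs_add_le _ _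
      _ ≤ (|M.hv f 0| + 1) * |M.hv g i - M.hv g (M.S i)| +
            |M.hv f i - M.hv f (M.S i)| * (|M.hv g 0| + 1) := by gcongr
      _ < (|M.hv f 0| + 1) * M.eps (M.S i) + M.eps (M.S i) * (|M.hv g 0| + 1) := by gcongr
      _ = ((|M.hv f 0| + |M.hv g 0| + 2) * M.eps (M.mulShift f g)) * M.eps (M.S k) := by
          rw [hi, eps_S, eps_S, eps_add]; ring
      _ ≤ M.eps (M.S k) := mul_le_of_le_one_left (eps_pos _).le (eps_mulShift f g)
  · rw [h, map_mul]
    set i := n + M.mulShift f g with hi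
    have hi : M.δ i ≤ M.δ n := δ_anti le_self_add
    have e1 := κ_strictMono.monotone (abs_hv_le f i)
    rw [κ_abs] at e1
    have e3 := (abs_val_sub_le f i).trans hi
    have e4 := (abs_val_sub_le g i).trans hi
    calc |M.val f * M.val g - M.κ (M.hv f i) * M.κ (M.hv g i)|
        = |M.κ (M.hv f i) * (M.val g - M.κ (M.hv g i)) + (M.val f - M.κ (M.hv f i)) * M.val g| := by
          congr 1; ring
      _ ≤ |M.κ (M.hv f i)| * |M.val g - M.κ (M.hv g i)| + |M.val f - M.κ (M.hv f i)| * |M.val g| := by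
          rw [← abs_mul, ← abs_mul]; exact abs_add_le _ _
      _ ≤ M.κ (|M.hv f 0| + 1) * M.δ n + M.δ n * |M.val g| := by
          gcongr
          exact (abs_nonneg _).trans e1
      _ = _ := by ring

/-- The index shift `2l + 2` gives precision `2⁻ᵏ · 4⁻ˡ / 4`. The approximations then stay above
`(3/4)·2⁻ˡ`, and dividing by two such numbers costs a factor of only `(16/9)·4ˡ`, so the reciprocals
converge fast. -/
theorem val_invR {f : M.carrier N1} {l : M.carrier N} (hl : M.δ l < M.val f) :
    M.val (M.invR f l) = (M.val f)⁻¹ := by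
  have h : ∀ k, M.tv (M.invR f l) k = (M.hv f (k + M.S (M.S (l + l))))⁻¹ := fun k => by
    simp [tv, PreModel.invR, invRT, rv_qinv, hv]
  have hδ : ∀ k, M.δ (k + M.S (M.S (l + l))) = M.δ k * (M.δ l * M.δ l) / 4 := fun k => by
    rw [δ_add, δ_S, δ_S, δ_add]; ring
  have h0 := δ_pos l
  have h1 : M.δ l ≤ 1 := by simpa [δ] using κ_strictMono.monotone (eps_le_one l)
  have hlow : ∀ k, 3 / 4 * M.δ l < M.κ (M.hv f (k + M.S (M.S (l + l)))) := fun k => by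
    have e1 := (abs_val_sub_lt' f (k + M.S (M.S (l + l)))).2
    have e2 : M.δ k ≤ 1 := by simpa [δ] using κ_strictMono.monotone (eps_le_one k)
    have e3 : M.δ k * (M.δ l * M.δ l) ≤ M.δ l := by
      calc M.δ k * (M.δ l * M.δ l) ≤ 1 * (1 * M.δ l) := by gcongr
        _ = _ := by ring
    rw [hδ] at e1
    linarith
  have key : ∀ a b e c : M.R, 0 < e → 0 < c → c < a → c < b → |a - b| < e * (c * c) →
      |a⁻¹ - b⁻¹| < e := by
    intro a b e c he hc ha hb hab
    have ha0 := hc.trans ha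
    have hb0 := hc.trans hb
    rw [inv_sub_inv ha0.ne' hb0.ne', abs_div, abs_of_pos (mul_pos ha0 hb0), abs_sub_comm,
      div_lt_iff₀ (mul_pos ha0 hb0)]
    exact hab.trans (by gcongr)
  refine val_eq 1 (fun k => ?_) fun n => ?_
  · refine κ_strictMono.lt_iff_lt.1 ?_
    rw [κ_abs, map_sub, h, h, map_inv₀, map_inv₀, S_add]
    have e1 := hlow k
    have e2 := hlow (M.S k)
    have e3 := κ_strictMono (abs_hv_sub_S f (k + M.S (M.S (l + l))))
    rw [κ_abs, map_sub, ← δ, δ_S, hδ] at e3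
    rw [S_add] at e2
    refine key _ _ _ _ (δ_pos _) (by linarith) e1 e2 (e3.trans ?_)
    rw [← δ, δ_S]
    have := mul_pos (δ_pos k) (mul_pos h0 h0)
    linarith
  · rw [h, map_inv₀, one_mul]
    refine (key _ _ _ _ (δ_pos _) (by linarith) (lt_trans (by linarith) hl) (hlow n)
      ((abs_val_sub_lt f _).trans ?_)).le
    rw [hδ]
    have := mul_pos (δ_pos n) (mul_pos h0 h0)
    linarith

end Model

/-! ### Operations of the abstract type in a structure -/

namespace PreModel

variable (M : PreModel L)

def addX (x y : M.carrier X) : M.carrier X := M.app (M.app (M.cn .addX) x) y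
def negX (x : M.carrier X) : M.carrier X := M.app (M.cn .negX) x
def smulX (f : M.carrier N1) (x : M.carrier X) : M.carrier X := M.app (M.app (M.cn .smulX) f) x
def normX (x : M.carrier X) : M.carrier N1 := M.app (M.cn .normX) x
/-- `u ∈ A x` in a structure. -/
def Mem (u x : M.carrier X) : Prop := M.app (M.app (M.cn .chi) x) u = 0
def J (f : M.carrier N1) (x : M.carrier X) : M.carrier X := M.app (M.app (M.cn .J) f) x

variable (x y : Tm L Γ X) (f : Tm L Γ N1) (ρ : M.Val Γ)

@[simp] theorem ev_addX : M.ev (ProofMining.addX x y) ρ = M.addX (M.ev x ρ) (M.ev y ρ) := rfl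
@[simp] theorem ev_negX : M.ev (ProofMining.negX x) ρ = M.negX (M.ev x ρ) := rfl
@[simp] theorem ev_subX :
    M.ev (ProofMining.subX x y) ρ = M.addX (M.ev x ρ) (M.negX (M.ev y ρ)) := rfl
@[simp] theorem ev_smulX : M.ev (ProofMining.smulX f x) ρ = M.smulX (M.ev f ρ) (M.ev x ρ) := rfl
@[simp] theorem ev_normX : M.ev (ProofMining.normX x) ρ = M.normX (M.ev x ρ) := rfl
@[simp] theorem ev_res : M.ev (res f x) ρ = M.J (M.ev f ρ) (M.ev x ρ) := rfl
@[simp] theorem sat_mem : M.sat (mem x y) ρ ↔ M.Mem (M.ev x ρ) (M.ev y ρ) := Iff.rfl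

end PreModel

namespace Model

open PreModel

variable {T : Set (Fm L [])} {M : Model T}

theorem sat_ax (M : Model T) {A : Fm L []} (hA : A ∈ T) : M.sat A Val.nil := by
  have := M.sound (RPrf.ax (H := []) (Γ := []) hA) Val.nil
  rwa [Fm.cl, sat_subst, M.val_nil (fun τ v => M.ev (Sub.nil τ v) Val.nil)] at this

/-! ## The normed space of a model -/

variable (M) in
/-- Equality of type `X`. -/
def EqX (x y : M.carrier X) : Prop := M.val (M.normX (M.addX x (M.negX y))) = 0

theorem sat_eqX (x y : Tm L Γ X) (ρ : M.Val Γ) :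
    M.sat (eqX x y) ρ ↔ M.EqX (M.ev x ρ) (M.ev y ρ) := by
  rw [eqX, eqT, sat_eqR, val_zeroR]; rfl

variable [hT : Fact (normedSpace L ⊆ T)]

variable (M) in
theorem normedSpace_sat :
    (∀ x y z, M.EqX (M.addX (M.addX x y) z) (M.addX x (M.addX y z))) ∧
    (∀ x y, M.EqX (M.addX x y) (M.addX y x)) ∧
    (∀ x, M.EqX (M.addX x (M.cn .zeroX)) x) ∧
    (∀ x, M.EqX (M.addX x (M.negX x)) (M.cn .zeroX)) ∧
    (∀ f x y, M.EqX (M.smulX f (M.addX x y)) (M.addX (M.smulX f x) (M.smulX f y))) ∧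
    (∀ f g x, M.EqX (M.smulX (M.addR f g) x) (M.addX (M.smulX f x) (M.smulX g x))) ∧
    (∀ f g x, M.EqX (M.smulX (M.mulR f g) x) (M.smulX f (M.smulX g x))) ∧
    (∀ x, M.EqX (M.smulX (M.ev oneR (Val.nil.cons x)) x) x) ∧
    (∀ x, M.EqX x x) ∧
    (∀ x y, M.val (M.normX (M.addX x (M.negX y))) = M.val (M.normX (M.addX y (M.negX x)))) ∧
    (∀ x y z, M.val (M.normX (M.addX x (M.negX z))) ≤
      M.val (M.normX (M.addX x (M.negX y))) + M.val (M.normX (M.addX y (M.negX z)))) ∧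
    (∀ f x y, M.val (M.normX (M.addX (M.smulX f x) (M.negX (M.smulX f y)))) =
      |M.val f| * M.val (M.normX (M.addX x (M.negX y)))) ∧
    (∀ f g x, M.val (M.normX (M.addX (M.smulX f x) (M.negX (M.smulX g x)))) =
      |M.val f - M.val g| * M.val (M.normX x)) ∧
    (∀ x y u v, M.val (M.normX (M.addX (M.addX x y) (M.negX (M.addX u v)))) ≤
      M.val (M.normX (M.addX x (M.negX u))) + M.val (M.normX (M.addX y (M.negX v)))) ∧
    (∀ x y, M.val (M.normX (M.addX (M.negX x) (M.negX (M.negX y)))) =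
      M.val (M.normX (M.addX x (M.negX y)))) ∧
    (∀ x y, |M.val (M.normX x) - M.val (M.normX y)| ≤ M.val (M.normX (M.addX x (M.negX y)))) := by
  have h : ∀ A ∈ normedSpace L, M.sat A Val.nil := fun A hA => M.sat_ax (hT.out hA)
  simp only [normedSpace, Set.mem_ofPred_eq, List.forall_mem_cons, sat_all, sat_eqX, sat_eqR,
    sat_leR, ev_addX, ev_negX, ev_subX, ev_smulX, ev_normX, ev_v0, ev_v1, ev_v2, ev_v3, ev_cn,
    ev_addR, ev_mulR, ev_absR, val_subR, val_addR, val_mulR, val_absR, val_zeroR] at h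
  obtain ⟨h1, h2, h3, h4, h5, h6, h7, h8, h9, h10, h11, h12, h13, h14, h15, h16, -⟩ := h
  exact ⟨h1, h2, h3, h4, h5, h6, h7, h8, h9, h10, h11, h12, h13, h14, h15, h16⟩

/-- The triangle inequality and symmetry give `0 = ‖x - x‖ ≤ 2‖x - y‖`. -/
theorem norm_sub_nonneg (x y : M.carrier X) : 0 ≤ M.val (M.normX (M.addX x (M.negX y))) := by
  obtain ⟨-, -, -, -, -, -, -, -, h9, h10, h11, -⟩ := M.normedSpace_sat
  have h1 := h9 x
  have h2 := h11 x y x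
  rw [h10 y x, h1] at h2
  linarith

variable (M) in
/-- Equality of type `X` is an equivalence relation. -/
def setoidX : Setoid (M.carrier X) where
  r := M.EqX
  iseqv := by
    obtain ⟨-, -, -, -, -, -, -, -, h9, h10, h11, -⟩ := M.normedSpace_sat
    refine ⟨h9, fun {x y} h => (h10 y x).trans h, fun {x y z} h h' => ?_⟩
    refine le_antisymm ((h11 x y z).trans_eq ?_) (norm_sub_nonneg x z)
    rw [h, h', add_zero]

variable (M) in
/-- The normed space of a model: the objects of type `X` modulo equality. -/
def V : Type := Quotient (setoidX M)

/-- The vector given by an object of type `X`. -/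
def vec (x : M.carrier X) : M.V := Quotient.mk (setoidX M) x

theorem vec_eq {x y : M.carrier X} : vec x = vec y ↔ M.EqX x y := Quotient.eq (r := setoidX M)

theorem vec_surj (v : M.V) : ∃ x : M.carrier X, vec x = v := Quotient.exists_rep v

instance : Zero M.V := ⟨vec (M.cn .zeroX)⟩

instance : Neg M.V := ⟨Quotient.map (sa := setoidX M) (sb := setoidX M) M.negX fun x y h => by
  obtain ⟨-, -, -, -, -, -, -, -, -, -, -, -, -, -, h15, -⟩ := M.normedSpace_sat
  exact (h15 x y).trans h⟩

instance : Add M.V := ⟨Quotient.map₂ (sa := setoidX M) (sb := setoidX M) (sc := setoidX M)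
  M.addX fun x y h x' y' h' => by
  obtain ⟨-, -, -, -, -, -, -, -, -, -, -, -, -, h14, -⟩ := M.normedSpace_sat
  refine le_antisymm ((h14 x x' y y').trans_eq ?_) (norm_sub_nonneg _ _)
  change M.EqX x y at h
  change M.EqX x' y' at h'
  rw [h, h', add_zero]⟩

theorem vec_add (x y : M.carrier X) : vec (M.addX x y) = vec x + vec y := rfl
theorem vec_neg (x : M.carrier X) : vec (M.negX x) = -vec x := rfl

instance : AddCommGroup M.V :=
  have comm : ∀ v w : M.V, v + w = w + v := fun v w => by
    obtain ⟨x, rfl⟩ := vec_surj v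
    obtain ⟨y, rfl⟩ := vec_surj w
    exact vec_eq.2 (M.normedSpace_sat.2.1 x y)
  { AddGroup.ofLeftAxioms (G := M.V)
      (fun u v w => by
        obtain ⟨x, rfl⟩ := vec_surj u
        obtain ⟨y, rfl⟩ := vec_surj v
        obtain ⟨z, rfl⟩ := vec_surj w
        exact vec_eq.2 (M.normedSpace_sat.1 x y z))
      (fun v => by
        rw [comm]
        obtain ⟨x, rfl⟩ := vec_surj v
        exact vec_eq.2 (M.normedSpace_sat.2.2.1 x))
      (fun v => by
        rw [comm]
        obtain ⟨x, rfl⟩ := vec_surj v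
        exact vec_eq.2 (M.normedSpace_sat.2.2.2.1 x)) with
    add_comm := comm }

theorem vec_sub (x y : M.carrier X) : vec (M.addX x (M.negX y)) = vec x - vec y := by
  rw [sub_eq_add_neg]; rfl

/-- The norm. -/
noncomputable def nrm (v : M.V) : M.R :=
  Quotient.lift (s := setoidX M) (fun x => M.val (M.normX x)) (fun x y h => by
    obtain ⟨-, -, -, -, -, -, -, -, -, -, -, -, -, -, -, h16⟩ := M.normedSpace_sat
    have := h16 x y
    change M.EqX x y at h
    rw [h] at this
    exact sub_eq_zero.1 (abs_nonpos_iff.1 this)) v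

theorem val_normX (x : M.carrier X) : M.val (M.normX x) = nrm (vec x) := rfl

theorem nrm_sub_eq_zero {v w : M.V} : nrm (v - w) = 0 ↔ v = w := by
  obtain ⟨x, rfl⟩ := vec_surj v
  obtain ⟨y, rfl⟩ := vec_surj w
  rw [vec_eq, ← vec_sub, ← val_normX]; rfl

theorem nrm_eq_zero {v : M.V} : nrm v = 0 ↔ v = 0 := by
  rw [← nrm_sub_eq_zero, sub_zero]

theorem nrm_nonneg (v : M.V) : 0 ≤ nrm v := by
  obtain ⟨x, rfl⟩ := vec_surj v
  have := norm_sub_nonneg x (M.cn .zeroX)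
  rwa [val_normX, vec_sub, show vec (M.cn .zeroX) = (0 : M.V) from rfl, sub_zero] at this

/-- Multiplication by the real number represented by an object of type `1`. -/
def sm (f : M.carrier N1) : M.V →+ M.V :=
  AddMonoidHom.mk' (Quotient.map (sa := setoidX M) (sb := setoidX M) (M.smulX f) fun x y h => by
    obtain ⟨-, -, -, -, -, -, -, -, -, -, -, h12, -⟩ := M.normedSpace_sat
    have := h12 f x y
    change M.EqX x y at h
    rw [h, mul_zero] at this
    exact this) fun v w => by
    obtain ⟨-, -, -, -, h5, -⟩ := M.normedSpace_sat
    obtain ⟨x, rfl⟩ := vec_surj v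
    obtain ⟨y, rfl⟩ := vec_surj w
    exact vec_eq.2 (h5 f x y)

theorem vec_smulX (f : M.carrier N1) (x : M.carrier X) : vec (M.smulX f x) = sm f (vec x) := rfl

/-- Scalars are objects of type `1`, because the ordered field may contain elements that none of
them represents. The axiom `‖αx - βx‖ = |α - β|‖x‖` makes the action depend on the represented value
alone. -/
theorem sm_congr {f g : M.carrier N1} (h : M.val f = M.val g) (v : M.V) : sm f v = sm g v := by
  obtain ⟨-, -, -, -, -, -, -, -, -, -, -, -, h13, -⟩ := M.normedSpace_sat
  obtain ⟨x, rfl⟩ := vec_surj v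
  have := h13 f g x
  rw [h, sub_self, abs_zero, zero_mul] at this
  exact vec_eq.2 this

theorem sm_addR (f g : M.carrier N1) (v : M.V) : sm (M.addR f g) v = sm f v + sm g v := by
  obtain ⟨x, rfl⟩ := vec_surj v
  exact vec_eq.2 (M.normedSpace_sat.2.2.2.2.2.1 f g x)

theorem sm_mulR (f g : M.carrier N1) (v : M.V) : sm (M.mulR f g) v = sm f (sm g v) := by
  obtain ⟨x, rfl⟩ := vec_surj v
  exact vec_eq.2 (M.normedSpace_sat.2.2.2.2.2.2.1 f g x)

theorem sm_of_val_eq_one {f : M.carrier N1} (h : M.val f = 1) (v : M.V) : sm f v = v := by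
  obtain ⟨x, rfl⟩ := vec_surj v
  rw [sm_congr (h.trans (val_oneR (Val.nil.cons x)).symm)]
  exact vec_eq.2 (M.normedSpace_sat.2.2.2.2.2.2.2.1 x)

/-- The sum `f + f` has the same value as `f`, hence `fv = fv + fv`. -/
theorem sm_of_val_eq_zero {f : M.carrier N1} (h : M.val f = 0) (v : M.V) : sm f v = 0 := by
  have := sm_addR f f v
  rw [sm_congr (show M.val (M.addR f f) = M.val f by rw [val_addR, h, add_zero])] at this
  exact left_eq_add.1 this

theorem sm_negR (f : M.carrier N1) (v : M.V) : sm (M.negR f) v = -sm f v := by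
  refine eq_neg_of_add_eq_zero_left ?_
  rw [← sm_addR, sm_of_val_eq_zero]
  simp

theorem sm_sm_of_mul_eq_one {f g : M.carrier N1} (h : M.val f * M.val g = 1) (v : M.V) :
    sm f (sm g v) = v := by
  rw [← sm_mulR, sm_of_val_eq_one]
  rw [val_mulR, h]

theorem nrm_sm (f : M.carrier N1) (v : M.V) : nrm (sm f v) = |M.val f| * nrm v := by
  obtain ⟨-, -, -, -, -, -, -, -, -, -, -, h12, -⟩ := M.normedSpace_sat
  obtain ⟨x, rfl⟩ := vec_surj v
  have := h12 f x (M.cn .zeroX)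
  rwa [val_normX, val_normX, vec_sub, vec_sub, vec_smulX, vec_smulX,
    show vec (M.cn .zeroX) = (0 : M.V) from rfl, map_zero, sub_zero, sub_zero] at this

/-- The inner product. -/
noncomputable def inr (v w : M.V) : M.R :=
  4⁻¹ * (nrm (v + w) * nrm (v + w) - nrm (v - w) * nrm (v - w))

theorem val_normSq (x : Tm L Γ X) (ρ : M.Val Γ) :
    M.val (M.ev (normSq x) ρ) = nrm (vec (M.ev x ρ)) * nrm (vec (M.ev x ρ)) := by
  rw [normSq, ev_mulR, val_mulR, ev_normX, val_normX]

theorem val_innerX (x y : Tm L Γ X) (ρ : M.Val Γ) :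
    M.val (M.ev (innerX x y) ρ) = inr (vec (M.ev x ρ)) (vec (M.ev y ρ)) := by
  rw [innerX, ev_mulR, val_mulR, val_quarterR, val_subR, val_normSq, val_normSq, ev_addX, ev_subX,
    vec_add, vec_sub, inr]

/-- The inner product of `-γ v` and `v`. -/
theorem inr_sm_neg (f : M.carrier N1) (v : M.V) :
    inr (-sm f v) v = -M.val f * (nrm v * nrm v) := by
  -- Both vectors in the polarization formula are multiples of `v`, by `1 - γ` and `-γ - 1`.
  -- Homogeneity of the norm evaluates it, without bilinearity.
  have h1 : -sm f v + v = sm (M.addR (M.negR f) (M.ev oneR Val.nil)) v := by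
    rw [sm_addR, sm_negR, sm_of_val_eq_one (val_oneR _)]
  have h2 : -sm f v - v = sm (M.addR (M.negR f) (M.negR (M.ev oneR Val.nil))) v := by
    rw [sm_addR, sm_negR, sm_negR, sm_of_val_eq_one (val_oneR _), sub_eq_add_neg]
  have h3 : ∀ a b : M.R, |a| * b * (|a| * b) = a * a * (b * b) := fun a b => by
    rw [mul_mul_mul_comm, abs_mul_abs_self]
  rw [inr, h1, h2, nrm_sm, nrm_sm, h3, h3]
  simp only [val_addR, val_negR, val_oneR]
  ring

end Model

/-! ### Resolvent membership and the index `1` in a structure -/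

namespace PreModel

variable (M : PreModel L)

/-- `γ⁻¹ (x - p) ∈ A p` in a structure. -/
def ResIn (f : M.carrier N1) (l : M.carrier N) (x p : M.carrier X) : Prop :=
  M.Mem (M.smulX (M.invR f l) (M.addX x (M.negX p))) p

/-- The number `1` as an object of type `1`. -/
def oneR : M.carrier N1 := M.ev ProofMining.oneR Val.nil

variable (f : Tm L Γ N1) (l : Tm L Γ N) (x p : Tm L Γ X) (ρ : M.Val Γ)

@[simp] theorem ev_oneR : M.ev ProofMining.oneR ρ = M.oneR := by
  simp [ProofMining.oneR, oneR, ratR, num]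

end PreModel

namespace Model

open PreModel

variable {T : Set (Fm L [])} {M : Model T}

@[simp] theorem val_one : M.val M.oneR = 1 := val_oneR _

@[simp] theorem sat_resIn (f : Tm L Γ N1) (l : Tm L Γ N) (x p : Tm L Γ X) (ρ : M.Val Γ) :
    M.sat (resIn f l x p) ρ ↔ M.ResIn (M.ev f ρ) (M.ev l ρ) (M.ev x ρ) (M.ev p ρ) := by
  simp [resIn, PreModel.ResIn]

@[simp] theorem sat_posW (f : Tm L Γ N1) (l : Tm L Γ N) (ρ : M.Val Γ) :
    M.sat (posW f l) ρ ↔ M.δ (M.ev l ρ) < M.val (M.ev f ρ) := by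
  rw [posW, sat_ltR, val_r2neg]

@[simp] theorem sat_domJ (f : Tm L Γ N1) (l : Tm L Γ N) (x : Tm L Γ X) (ρ : M.Val Γ) :
    M.sat (domJ f l x) ρ ↔ ∃ y, M.ResIn (M.ev f ρ) (M.ev l ρ) (M.ev x ρ) y := by
  simp [domJ, ev_shift]

@[simp] theorem sat_strongDomJ (f : Tm L Γ N1) (x : Tm L Γ X) (ρ : M.Val Γ) :
    M.sat (strongDomJ f x) ρ ↔
      ∃ y z, M.Mem z y ∧ M.EqX (M.ev x ρ) (M.addX y (M.smulX (M.ev f ρ) z)) := by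
  simp [strongDomJ, ev_shift, sat_eqX]

/-! ## The principles in a model -/

variable (M) in
/-- Extensionality of `A`. -/
def ExtA : Prop := ∀ x y x' y', M.EqX x x' → M.EqX y y' →
  M.app (M.app (M.cn .chi) x) y = M.app (M.app (M.cn .chi) x') y'

variable (M) in
/-- The strong domain principle for the index `f` with the bound `l`. -/
def StrongDomainAt (f : M.carrier N1) (l : M.carrier N) : Prop :=
  ∀ x y z, M.Mem z y → M.EqX x (M.addX y (M.smulX f z)) → M.ResIn f l x (M.J f x)

variable (M) in
/-- The partial resolvent principle for the index `f` with the bound `l`. -/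
def PartialResAt (f : M.carrier N1) (l : M.carrier N) : Prop :=
  ∀ x y, M.ResIn f l x y → M.ResIn f l x (M.J f x)

variable (M) in
/-- The strong partial resolvent principle for the index `f` with the bound `l`. -/
def StrongPartialResAt (f : M.carrier N1) (l : M.carrier N) : Prop :=
  ∀ x p y, M.ResIn f l x y → M.EqX p (M.J f x) → M.ResIn f l x p

theorem sat_extA (ρ : M.Val []) : M.sat extA ρ ↔ M.ExtA := by
  simp [extA, sat_eqX, ExtA]

theorem ExtA.mem (h : M.ExtA) {u u' x x' : M.carrier X} (hx : M.EqX x x') (hu : M.EqX u u')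
    (hm : M.Mem u x) : M.Mem u' x' := (h x u x' u' hx hu).symm.trans hm

theorem mul_inv_index {f : M.carrier N1} {l : M.carrier N} (hl : M.δ l < M.val f) :
    M.val f * M.val (M.invR f l) = 1 := by
  rw [val_invR hl, mul_inv_cancel₀ ((δ_pos l).trans hl).ne']

/-- The axiom only gives `γ̃ ≥ 2^(-m)`; adding one to the exponent yields the strict bound under
which the reciprocal term is correct. -/
theorem cancel_gam (hg : gamPos ∈ T) (M : Model T) :
    M.δ (M.S (M.cn .mGam)) < M.val (M.cn .gam) := by
  have := M.sat_ax hg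
  rw [gamPos, sat_leR, val_r2neg] at this
  rw [δ_S]
  exact (half_lt_self (δ_pos _)).trans_le this

theorem δ_one_lt (M : Model T) : M.δ 1 < M.val M.oneR := by
  rw [← S_zero, δ_S, val_one, δ, eps_zero, map_one]
  exact half_lt_self one_pos

/-- Provably equal terms of type `X` have the same value. -/
theorem ev_eq_of_eqX {Γ : List Ty} {s t : Tm L Γ X}
    (h : ∀ (M : Model T) (ρ : M.Val Γ), M.EqX (M.ev s ρ) (M.ev t ρ)) (M : Model T) (ρ : M.Val Γ) :
    M.ev s ρ = M.ev t ρ :=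
  M.ev_eq_of_forall (A := .eq zero zero) (by simp [Fm.QF]) (fun M ρ _ => (sat_eqX s t ρ).2 (h M ρ)) rfl

variable [hT : Fact (normedSpace L ⊆ T)]

theorem EqX.rfl' {x : M.carrier X} : M.EqX x x := vec_eq.1 rfl

theorem EqX.symm {x y : M.carrier X} (h : M.EqX x y) : M.EqX y x := vec_eq.1 (vec_eq.2 h).symm

variable (M) in
/-- The uniqueness property of the resolvent for the index `f`. -/
def UniqueAt (f : M.carrier N1) : Prop :=
  ∀ p q u v, M.Mem u p → M.Mem v q → vec p - vec q = -sm f (vec u - vec v) → vec p = vec q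

theorem sm_invR {f : M.carrier N1} {l : M.carrier N} (hl : M.δ l < M.val f) (v : M.V) :
    sm f (sm (M.invR f l) v) = v := sm_sm_of_mul_eq_one (mul_inv_index hl) v

theorem invR_sm {f : M.carrier N1} {l : M.carrier N} (hl : M.δ l < M.val f) (v : M.V) :
    sm (M.invR f l) (sm f v) = v :=
  sm_sm_of_mul_eq_one ((mul_comm _ _).trans (mul_inv_index hl)) v

/-- From `x = y + γz` one has `z = γ⁻¹(x - y)` up to equality, so extensionality turns `z ∈ Ay` into
membership of `x` in the domain of `J_γ`. -/
theorem ExtA.strongDomainAt (h : M.ExtA) {f : M.carrier N1} {l : M.carrier N}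
    (hl : M.δ l < M.val f) (hp : M.PartialResAt f l) : M.StrongDomainAt f l := by
  intro x y z hz hx
  refine hp x y (h.mem EqX.rfl' ?_ hz)
  rw [← vec_eq, vec_add, vec_smulX] at hx
  rw [← vec_eq, vec_smulX, vec_sub, hx, add_sub_cancel_left, invR_sm hl]

theorem ExtA.strongPartialResAt (h : M.ExtA) {f : M.carrier N1} {l : M.carrier N}
    (hp : M.PartialResAt f l) : M.StrongPartialResAt f l := by
  intro x p y hy hpJ
  refine h.mem hpJ.symm ?_ (hp x y hy)
  rw [← vec_eq] at hpJ ⊢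
  rw [vec_smulX, vec_smulX, vec_sub, vec_sub, hpJ]

/-- In the presence of extensionality of `A`, the index only matters up to equality. -/
theorem ExtA.resIn_congr (h : M.ExtA) {f g : M.carrier N1} {l : M.carrier N} {x p : M.carrier X}
    (hl : M.δ l < M.val f) (hfg : M.val f = M.val g) (hr : M.ResIn f l x p) : M.ResIn g l x p := by
  refine h.mem EqX.rfl' ?_ hr
  rw [← vec_eq, vec_smulX, vec_smulX]
  exact sm_congr (by rw [val_invR hl, val_invR (hfg ▸ hl), hfg]) _

/-- With `u = γ⁻¹(x - p)` and `v = γ⁻¹(x - q)`, subtraction gives `p - q = -γ(u - v)`, which is the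
situation excluded for distinct points. -/
theorem resolvent_unique {f g : M.carrier N1} {l : M.carrier N} {x x' p q : M.carrier X}
    (hl : M.δ l < M.val f) (hu : M.UniqueAt f) (hfg : M.val f = M.val g) (hx : M.EqX x x')
    (hp : M.ResIn f l x p) (hq : M.ResIn g l x' q) : M.EqX p q := by
  rw [← vec_eq] at hx ⊢
  refine hu p q _ _ hp hq ?_
  rw [vec_smulX, vec_smulX, vec_sub, vec_sub, map_sub, sm_invR hl, sm_congr hfg,
    sm_invR (hfg ▸ hl), hx]
  abel

/-- The pair `J_f x`, `f⁻¹(x - J_f x)` witnesses the strong domain condition for `x'` at the index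
`g`, because that condition is phrased with equality. Uniqueness then compares the two resolvents.
-/
theorem StrongDomainAt.ext {f g : M.carrier N1} {l : M.carrier N} {x x' : M.carrier X}
    (h : M.StrongDomainAt g l) (hl : M.δ l < M.val f) (hu : M.UniqueAt f)
    (hp : M.PartialResAt f l) (hfg : M.val f = M.val g) (hx : M.EqX x x')
    (hd : ∃ y, M.ResIn f l x y) : M.EqX (M.J f x) (M.J g x') := by
  obtain ⟨y, hy⟩ := hd
  have hJ := hp x y hy
  refine resolvent_unique hl hu hfg hx hJ (h x' _ _ hJ ?_)
  rw [← vec_eq] at hx ⊢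
  rw [vec_add, vec_smulX, vec_smulX, vec_sub, sm_congr hfg.symm, sm_invR hl, ← hx]
  abel

/-- The principles for a single index imply extensionality of `A`, if the reciprocal cancels
literally. -/
theorem extA_of_strong {f : M.carrier N1} {l : M.carrier N} (hl : M.δ l < M.val f)
    (hu : M.UniqueAt f) (hchi : ∀ x y, M.app (M.app (M.cn .chi) x) y ≤ 1)
    (hlit : ∀ x y, M.smulX (M.invR f l) (M.addX (M.addX x (M.smulX f y)) (M.negX x)) = y)
    (hd : M.StrongDomainAt f l) (hr : M.StrongPartialResAt f l) : M.ExtA := by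
  have key : ∀ x y x' y', M.EqX x x' → M.EqX y y' → M.Mem y x → M.Mem y' x' := by
    intro x y x' y' hx hy hm
    -- The point is formed from the primed objects, while the membership witness uses the unprimed
    -- ones. The strong domain principle allows this, since it asks only for `x' + γy' = x + γy`.
    have hJ := hd (M.addX x' (M.smulX f y')) x y hm (by
      rw [← vec_eq] at hx hy ⊢
      rw [vec_add, vec_add, vec_smulX, vec_smulX, hx, hy])
    have hxJ := hu x _ y _ hm hJ (by
      rw [← vec_eq] at hx hy
      rw [vec_smulX, vec_sub, vec_add, vec_smulX, map_sub, sm_invR hl, hx, hy]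
      abel)
    have := hr _ x' _ hJ (vec_eq.1 ((vec_eq.2 hx).symm.trans hxJ))
    -- The replacement takes place inside `χ_A`, so identity of the two elements is required;
    -- equality in the sense of `=_X` would presuppose the claim.
    rwa [PreModel.ResIn, hlit] at this
  -- Values of `χ_A` are at most `1`, so two of them agree once they vanish simultaneously.
  have hone : ∀ a b : M.carrier N, a ≤ 1 → b ≤ 1 → (a = 0 ↔ b = 0) → a = b := by
    intro a b ha hb hab
    by_cases h : a = 0
    · rw [h, hab.1 h]
    · rw [le_antisymm ha (one_le_of_ne_zero h), le_antisymm hb (one_le_of_ne_zero (mt hab.2 h))]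
  intro x y x' y' hx hy
  exact hone _ _ (hchi _ _) (hchi _ _) ⟨key _ _ _ _ hx hy, key _ _ _ _ hx.symm hy.symm⟩

/-! ## Literal equalities, from the quantifier-free rule of extensionality -/

/-- Positivity of the constant is an axiom, so the equation holds in every model and needs no
premise. For a variable index the premise `γ > 2⁻ˡ` would be existential, outside the scope of the
quantifier-free rule. -/
theorem lit_gam (hg : gamPos ∈ T) (M : Model T) (x y : M.carrier X) :
    M.smulX (M.invR (M.cn .gam) (M.S (M.cn .mGam)))
      (M.addX (M.addX x (M.smulX (M.cn .gam) y)) (M.negX x)) = y := by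
  refine ev_eq_of_eqX (s := smulX (invR (.cn .gam) (succ (.cn .mGam)))
    (subX (addX v1 (smulX (.cn .gam) v0)) v1)) (t := v0) (fun M ρ => ?_) M
    ((Val.nil.cons x).cons y) |> fun h => by simpa using h
  rw [← vec_eq]
  simp only [ev_smulX, ev_invR, ev_cn, ev_subX, ev_addX, PreModel.ev_succ, vec_smulX, vec_neg,
    vec_add, add_neg_cancel_comm, invR_sm (cancel_gam hg M)]

theorem lit_one (M : Model T) (x y : M.carrier X) :
    M.smulX (M.invR M.oneR 1) (M.addX (M.addX x (M.smulX M.oneR y)) (M.negX x)) = y := by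
  have := ev_eq_of_eqX (T := T) (s := smulX (invR oneR (succ zero))
    (subX (addX v1 (smulX oneR v0)) v1)) (t := v0) (fun M ρ => by
      rw [← vec_eq]
      simp only [ev_smulX, ev_invR, ev_oneR, ev_subX, ev_addX, PreModel.ev_succ, ev_zero, S_zero,
        vec_smulX, vec_neg, vec_add, add_neg_cancel_comm, invR_sm (δ_one_lt M)]) M
    ((Val.nil.cons x).cons y)
  simpa using this

theorem smul_inv_one (M : Model T) (x : M.carrier X) : M.smulX (M.invR M.oneR 1) x = x := by
  have := ev_eq_of_eqX (T := T) (s := smulX (invR oneR (succ zero)) v0) (t := v0) (fun M ρ => by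
      rw [← vec_eq]
      simp only [ev_smulX, ev_invR, ev_oneR, PreModel.ev_succ, ev_zero, S_zero, vec_smulX]
      rw [sm_of_val_eq_one]
      rw [val_invR (δ_one_lt M), val_one, inv_one]) M (Val.nil.cons x)
  simpa using this

theorem smul_inv_abs_one (M : Model T) (x : M.carrier X) :
    M.smulX (M.invR (M.absR M.oneR) 1) x = x := by
  have := ev_eq_of_eqX (T := T) (s := smulX (invR (absR oneR) (succ zero)) v0) (t := v0)
    (fun M ρ => by
      have h : M.val (M.absR M.oneR) = 1 := by simp
      rw [← vec_eq]
      simp only [ev_smulX, ev_invR, ev_absR, ev_oneR, PreModel.ev_succ, ev_zero, S_zero, vec_smulX]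
      rw [sm_of_val_eq_one]
      rw [val_invR (by rw [h]; simpa using δ_one_lt M), h, inv_one]) M (Val.nil.cons x)
  simpa using this

end Model

/-! ### Axioms and principles read in a model, and uniqueness of resolvents -/

namespace Model

open PreModel

section

variable {T : Set (Fm L [])} {M : Model T}

theorem sat_iff (A B : Fm L Γ) (ρ : M.Val Γ) : M.sat (Fm.iff A B) ρ ↔ (M.sat A ρ ↔ M.sat B ρ) := by
  rw [Fm.iff, sat_and, sat_imp, sat_imp, ← iff_iff_implies_and_implies]

theorem sat_partialRes (ρ : M.Val []) :
    M.sat partialRes ρ ↔ ∀ f l, M.δ l < M.val f → M.PartialResAt f l := by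
  simp only [partialRes, sat_all, sat_imp, sat_and, sat_posW, sat_domJ, sat_resIn, ev_v0, ev_v1,
    ev_v2, ev_res, PartialResAt, forall_exists_index, and_imp]
  exact ⟨fun h f l hl x y => h f x l hl y, fun h f x l hl y => h f l hl x y⟩

theorem sat_strongDomain (ρ : M.Val []) :
    M.sat strongDomain ρ ↔ ∀ f l, M.δ l < M.val f → M.StrongDomainAt f l := by
  simp only [strongDomain, sat_all, sat_imp, sat_and, sat_posW, sat_strongDomJ, sat_resIn, ev_v0,
    ev_v1, ev_v2, ev_res, StrongDomainAt, forall_exists_index, and_imp]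
  exact ⟨fun h f l hl x y z => h f x l hl y z, fun h f x l hl y z => h f l hl x y z⟩

theorem sat_strongPartialRes (ρ : M.Val []) :
    M.sat strongPartialRes ρ ↔ ∀ f l, M.δ l < M.val f → ∀ x p y, M.ResIn f l x y →
      M.EqX p (M.J f x) → M.ResIn (M.absR f) l x p := by
  simp only [strongPartialRes, sat_all, sat_imp, sat_and, sat_posW, sat_domJ, sat_resIn, ev_v0,
    ev_v1, ev_v2, ev_v3, ev_res, ev_absR, sat_eqX, forall_exists_index, and_imp]
  exact ⟨fun h f l hl x p y => h x p f l hl y, fun h x p f l hl y => h f l hl x p y⟩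

theorem sat_strongDomainOne (ρ : M.Val []) :
    M.sat strongDomainOne ρ ↔ ∀ x y z, M.Mem z y → M.EqX x (M.addX y z) →
      M.Mem (M.addX x (M.negX (M.J M.oneR x))) (M.J M.oneR x) := by
  simp [strongDomainOne, sat_eqX]

theorem sat_strongPartialResOne (ρ : M.Val []) :
    M.sat strongPartialResOne ρ ↔ ∀ x p l, M.δ l < 1 → ∀ y, M.ResIn M.oneR l x y →
      M.EqX p (M.J M.oneR x) → M.Mem (M.addX x (M.negX p)) p := by
  simp [strongPartialResOne, sat_eqX]

theorem sat_strongExtJ (ρ : M.Val []) :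
    M.sat strongExtJ ρ ↔ ∀ x x' f g l, M.δ l < M.val f → (∃ y, M.ResIn f l x y) →
      M.val f = M.val g → M.EqX x x' → M.EqX (M.J f x) (M.J g x') := by
  simp only [strongExtJ, sat_all, sat_imp, sat_and, sat_posW, sat_domJ, sat_eqR, ev_v0,
    ev_v1, ev_v2, ev_v3, ev_v4, ev_res, sat_eqX, and_imp]

theorem chi_le_one (h : chiLeOne ∈ T) (M : Model T) (x y : M.carrier X) :
    M.app (M.app (M.cn .chi) x) y ≤ 1 := by
  have := M.sat_ax h
  simp only [chiLeOne, sat_all, sat_eq, ev_monus, ev_app, ev_cn, ev_v0, ev_v1, ev_num, ev_zero,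
    tsub_eq_zero_iff_le, Nat.cast_one] at this
  exact this x y

theorem nrm_zero' [Fact (normedSpace L ⊆ T)] : nrm (0 : M.V) = 0 := nrm_eq_zero.2 rfl

/-- For `λ = γ` the vector `p - q + λ(u - v)` vanishes, so accretivity bounds `‖p - q‖` by `0`. -/
theorem uniqueAt_of_accretivity [Fact (normedSpace L ⊆ T)] (h : accretivity ∈ T) (M : Model T)
    {f : M.carrier N1} (hf : 0 < M.val f) : M.UniqueAt f := by
  have := M.sat_ax h
  simp only [accretivity, sat_all, sat_imp, sat_and, sat_mem, sat_leR, ev_normX, ev_subX, ev_addX,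
    ev_smulX, ev_absR, ev_v0, ev_v1, ev_v2, ev_v3, ev_v4] at this
  intro p q u v hu hv hpq
  have h := this p q u v f ⟨hu, hv⟩
  rw [val_normX, val_normX, vec_add (M.addX p _), vec_sub, vec_smulX, vec_sub,
    sm_congr (g := f) (by rw [val_absR, abs_of_pos hf]), hpq, neg_add_cancel, nrm_zero', ← hpq] at h
  exact nrm_sub_eq_zero.1 (le_antisymm h (nrm_nonneg _))

end

section

variable {T : Set (Fm .comonotone [])} {M : Model T}

/-- Inserting `p - q = -γ(u - v)` into comonotonicity gives `(ρ̃ + γ)‖u - v‖² ≤ 0`. Since `ρ̃ + γ >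
0`, this forces `u = v`, and then `p = q`. -/
theorem uniqueAt_of_comonotonicity [Fact (normedSpace .comonotone ⊆ T)] (h : comonotonicity ∈ T)
    (M : Model T) {f : M.carrier N1} (hf : -M.val f < M.val (M.cn .rho)) : M.UniqueAt f := by
  have := M.sat_ax h
  simp only [comonotonicity, sat_all, sat_imp, sat_and, sat_mem, sat_leR, val_innerX, ev_subX,
    ev_mulR, val_mulR, val_normSq, ev_v0, ev_v1, ev_v2, ev_v3, ev_cn, vec_sub] at this
  intro p q u v hu hv hpq
  have h := this p q u v ⟨hu, hv⟩
  rw [hpq, inr_sm_neg] at h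
  have h0 : nrm (vec u - vec v) * nrm (vec u - vec v) = 0 := by
    refine le_antisymm (le_of_mul_le_mul_left ?_ (sub_pos.2 hf)) (mul_self_nonneg _)
    linarith
  rw [mul_self_eq_zero, nrm_eq_zero] at h0
  rwa [h0, map_zero, neg_zero, sub_eq_zero] at hpq

theorem sat_rhoGt (f : Tm .comonotone Γ N1) (ρ : M.Val Γ) :
    M.sat (rhoGt Γ f) ρ ↔ -M.val (M.ev f ρ) < M.val (M.cn .rho) := by
  rw [rhoGt, sat_ltR, ev_negR, val_negR, ev_cn]

theorem sat_rhoGtHalf (f : Tm .comonotone Γ N1) (ρ : M.Val Γ) :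
    M.sat (rhoGtHalf Γ f) ρ ↔ -(M.val (M.ev f ρ) * 2⁻¹) < M.val (M.cn .rho) := by
  rw [rhoGtHalf, sat_ltR, ev_negR, val_negR, ev_mulR, val_mulR, val_halfR, ev_cn]

theorem sat_partialResHalf (ρ : M.Val []) :
    M.sat partialResHalf ρ ↔ ∀ f l, -(M.val f * 2⁻¹) < M.val (M.cn .rho) → M.δ l < M.val f →
      M.PartialResAt f l := by
  simp only [partialResHalf, sat_all, sat_imp, sat_and, sat_posW, sat_domJ, sat_resIn, ev_v0,
    ev_v1, ev_v2, ev_res, PartialResAt, forall_exists_index, and_imp, sat_rhoGtHalf]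
  exact ⟨fun h f l hc hl x y => h f x l hc hl y, fun h f x l hc hl y => h f l hc hl x y⟩

variable (M) in
/-- The condition `C` on indices is interpreted by the predicate `c`. -/
def Interprets (C : IndexCond) (c : M.R → Prop) : Prop :=
  ∀ (Γ : List Ty) (f : Tm .comonotone Γ N1) (ρ : M.Val Γ),
    M.sat (C Γ f) ρ ↔ c (M.val (M.ev f ρ))

variable {C : IndexCond} {c : M.R → Prop}

theorem sat_strongDomainOn (hC : M.Interprets C c) (ρ : M.Val []) :
    M.sat (strongDomainOn C) ρ ↔
      ∀ f l, M.δ l < M.val f → c (M.val f) → M.StrongDomainAt f l := by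
  simp only [strongDomainOn, sat_all, sat_imp, sat_and, sat_posW, hC _ _ _, sat_strongDomJ, sat_resIn,
    ev_v0, ev_v1, ev_v2, ev_res, StrongDomainAt, forall_exists_index, and_imp]
  exact ⟨fun h f l hl hc x y z => h f x l hl hc y z, fun h f x l hl hc y z => h f l hl hc x y z⟩

theorem sat_strongPartialResOn (hC : M.Interprets C c) (ρ : M.Val []) :
    M.sat (strongPartialResOn C) ρ ↔
      ∀ f l, M.δ l < M.val f → c (M.val f) → M.StrongPartialResAt f l := by
  simp only [strongPartialResOn, sat_all, sat_imp, sat_and, sat_posW, hC _ _ _, sat_domJ, sat_resIn,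
    ev_v0, ev_v1, ev_v2, ev_v3, ev_res, sat_eqX, StrongPartialResAt, forall_exists_index, and_imp]
  exact ⟨fun h f l hl hc x p y => h x p f l hl hc y, fun h x p f l hl hc y => h f l hl hc x p y⟩

theorem sat_strongExtJOn (hC : M.Interprets C c) (ρ : M.Val []) :
    M.sat (strongExtJOn C) ρ ↔ ∀ x x' f g l, M.δ l < M.val f → c (M.val f) →
      (∃ y, M.ResIn f l x y) → M.val f = M.val g → M.EqX x x' → M.EqX (M.J f x) (M.J g x') := by
  simp only [strongExtJOn, sat_all, sat_imp, sat_and, sat_posW, hC _ _ _, sat_domJ, sat_eqR, ev_v0,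
    ev_v1, ev_v2, ev_v3, ev_v4, ev_res, sat_eqX, and_imp]

end

end Model

open Model

/-! ## Accretive operators -/

section Accretive

variable {T : Set (Fm .accretive [])}

theorem fact_of_Vp (hT : Vp ⊆ T) : Fact (normedSpace .accretive ⊆ T) :=
  ⟨Set.subset_union_left.trans hT⟩

/-- Extensionality also absorbs the passage from `γ⁻¹` to `|γ|⁻¹`. For the converse only the index
`1` is used, where `|1|⁻¹z` and `1⁻¹z` are both literally `z`. -/
theorem extA_iff_strong (hT : Vp ⊆ T) (M : Model T) :
    M.sat extA PreModel.Val.nil ↔ M.sat (.and strongDomain strongPartialRes) PreModel.Val.nil := by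
  have := fact_of_Vp hT
  have hp := (sat_partialRes _).1 (M.sat_ax (hT (Or.inr (by simp) : partialRes ∈ Vp)))
  have ha : accretivity ∈ T := hT (Or.inr (by simp))
  have hc : chiLeOne ∈ T := hT (Or.inr (by simp))
  rw [PreModel.sat_and, sat_extA, sat_strongDomain, sat_strongPartialRes]
  refine ⟨fun h => ⟨fun f l hl => h.strongDomainAt hl (hp f l hl), fun f l hl x p y hy hpJ => ?_⟩,
    fun ⟨h1, h2⟩ => ?_⟩
  · refine h.resIn_congr hl ?_ (h.strongPartialResAt (hp f l hl) x p y hy hpJ)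
    rw [val_absR, abs_of_pos ((δ_pos l).trans hl)]
  · have hl := δ_one_lt M
    refine extA_of_strong hl (uniqueAt_of_accretivity ha M (by simp)) (chi_le_one hc M)
      (lit_one M) (h1 _ _ hl) fun x p y hy hpJ => ?_
    have := h2 _ _ hl x p y hy hpJ
    rw [PreModel.ResIn, smul_inv_abs_one] at this
    rwa [PreModel.ResIn, smul_inv_one]

theorem extA_iff_strongOne (hT : Vp ⊆ T) (M : Model T) :
    M.sat extA PreModel.Val.nil ↔
      M.sat (.and strongDomainOne strongPartialResOne) PreModel.Val.nil := by
  have := fact_of_Vp hT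
  have hp := (sat_partialRes _).1 (M.sat_ax (hT (Or.inr (by simp) : partialRes ∈ Vp)))
  have ha : accretivity ∈ T := hT (Or.inr (by simp))
  have hc : chiLeOne ∈ T := hT (Or.inr (by simp))
  have hl := δ_one_lt M
  -- The factor `1⁻¹` disappears by a literal equality, so the two forms are equivalent without
  -- extensionality of `A`.
  have hres : ∀ x p, M.ResIn M.oneR 1 x p ↔ M.Mem (M.addX x (M.negX p)) p := fun x p => by
    rw [PreModel.ResIn, smul_inv_one]
  have hone : ∀ x y z, M.EqX x (M.addX y z) ↔ M.EqX x (M.addX y (M.smulX M.oneR z)) := by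
    intro x y z
    rw [← vec_eq, ← vec_eq, vec_add, vec_add, vec_smulX, sm_of_val_eq_one val_one]
  rw [PreModel.sat_and, sat_extA, sat_strongDomainOne, sat_strongPartialResOne]
  refine ⟨fun h => ⟨fun x y z hm hx => ?_, fun x p l hl' y hy hpJ => ?_⟩, fun ⟨h1, h2⟩ => ?_⟩
  · exact (hres _ _).1 (h.strongDomainAt hl (hp _ _ hl) x y z hm ((hone _ _ _).1 hx))
  -- Here the bound `l` is arbitrary and the literal equality is not at hand; extensionality removes
  -- the reciprocal instead.
  · rw [← val_one (M := M)] at hl'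
    refine h.mem EqX.rfl' ?_ (h.strongPartialResAt (hp _ _ hl') x p y hy hpJ)
    rw [← vec_eq, vec_smulX, sm_of_val_eq_one]
    rw [val_invR hl', val_one, inv_one]
  · refine extA_of_strong hl (uniqueAt_of_accretivity ha M (by simp)) (chi_le_one hc M)
      (lit_one M) (fun x y z hm hx => ?_) fun x p y hy hpJ => ?_
    · exact (hres _ _).2 (h1 x y z hm ((hone _ _ _).2 hx))
    · exact (hres _ _).2 (h2 x p 1 (by simpa using hl) y hy hpJ)

theorem strongExtJ_of_strongDomain (hT : Vp ⊆ T) (M : Model T)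
    (h : M.sat strongDomain PreModel.Val.nil) :
    M.sat strongExtJ PreModel.Val.nil := by
  have := fact_of_Vp hT
  have hp := (sat_partialRes _).1 (M.sat_ax (hT (Or.inr (by simp) : partialRes ∈ Vp)))
  have ha : accretivity ∈ T := hT (Or.inr (by simp))
  rw [sat_strongDomain] at h
  rw [sat_strongExtJ]
  intro x x' f g l hl hd hfg hx
  exact (h g l (hfg ▸ hl)).ext hl (uniqueAt_of_accretivity ha M ((δ_pos l).trans hl)) (hp f l hl)
    hfg hx hd

end Accretive

/-! ## Comonotone operators -/

section Comonotone

variable {T : Set (Fm .comonotone [])} [Fact (normedSpace .comonotone ⊆ T)] (M : Model T)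
  {C : IndexCond} {c : M.R → Prop}

/-- The converse is run at the index `γ̃`, which satisfies the condition by assumption, whereas `1`
need not. -/
theorem extA_iff_strongOn
    (hC : M.Interprets C c) (hp : ∀ f l, M.δ l < M.val f → c (M.val f) → M.PartialResAt f l)
    (hu : ∀ f, 0 < M.val f → c (M.val f) → M.UniqueAt f)
    (hc : chiLeOne ∈ T) (hg : gamPos ∈ T) (hγ : c (M.val (M.cn .gam))) :
    M.sat extA PreModel.Val.nil ↔
      M.sat (.and (strongDomainOn C) (strongPartialResOn C)) PreModel.Val.nil := by
  rw [PreModel.sat_and, sat_extA, sat_strongDomainOn hC, sat_strongPartialResOn hC]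
  have hl := cancel_gam hg M
  exact ⟨fun h => ⟨fun f l hl hf => h.strongDomainAt hl (hp f l hl hf),
    fun f l hl hf => h.strongPartialResAt (hp f l hl hf)⟩, fun ⟨h1, h2⟩ =>
    extA_of_strong hl (hu _ ((δ_pos _).trans hl) hγ) (chi_le_one hc M) (lit_gam hg M)
      (h1 _ _ hl hγ) (h2 _ _ hl hγ)⟩

theorem strongExtJOn_of_strongDomainOn
    (hC : M.Interprets C c) (hp : ∀ f l, M.δ l < M.val f → c (M.val f) → M.PartialResAt f l)
    (hu : ∀ f, 0 < M.val f → c (M.val f) → M.UniqueAt f)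
    (h : M.sat (strongDomainOn C) PreModel.Val.nil) :
    M.sat (strongExtJOn C) PreModel.Val.nil := by
  rw [sat_strongDomainOn hC] at h
  rw [sat_strongExtJOn hC]
  intro x x' f g l hl hf hd hfg hx
  exact (h g l (hfg ▸ hl) (hfg ▸ hf)).ext hl (hu f ((δ_pos l).trans hl) hf) (hp f l hl hf)
    hfg hx hd

end Comonotone

/-! ### Transfer from models to provability -/

theorem Provable.of_models {T : Set (Fm L [])} {A : Fm L []}
    (h : ∀ M : Model T, M.sat A PreModel.Val.nil) : Provable T A :=
  Prf.complete fun M ρ _ => M.val_nil ρ ▸ h M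

/-- Stated for all extensions of `Vp`, so that adding the parallelogram law is covered by the same
argument. -/
theorem accretive_main {T : Set (Fm .accretive [])} (hT : Vp ⊆ T) :
    Provable T (Fm.iff extA (Fm.and strongDomain strongPartialRes)) ∧
    Provable T (Fm.iff (Fm.and strongDomain strongPartialRes)
      (Fm.and strongDomainOne strongPartialResOne)) ∧
    Provable T (Fm.iff (Fm.and strongDomainOne strongPartialResOne) extA) ∧
    Provable T (Fm.imp strongDomain strongExtJ) := by
  refine ⟨.of_models fun M => ?_, .of_models fun M => ?_, .of_models fun M => ?_,
    .of_models fun M => strongExtJ_of_strongDomain hT M⟩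
  · exact (sat_iff _ _ _).2 (extA_iff_strong hT M)
  · exact (sat_iff _ _ _).2 ((extA_iff_strong hT M).symm.trans (extA_iff_strongOne hT M))
  · exact (sat_iff _ _ _).2 (extA_iff_strongOne hT M).symm

theorem Up_main :
    Provable Up (Fm.iff extA (Fm.and (strongDomainOn rhoGt) (strongPartialResOn rhoGt))) ∧
    Provable Up (Fm.imp (strongDomainOn rhoGt) (strongExtJOn rhoGt)) := by
  have : Fact (normedSpace .comonotone ⊆ Up) := ⟨Set.subset_union_left⟩
  have hp : ∀ (M : Model Up) f l, M.δ l < M.val f → -M.val f < M.val (M.cn .rho) →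
      M.PartialResAt f l := fun M f l hl _ =>
    (sat_partialRes _).1 (M.sat_ax (Or.inr (by simp) : partialRes ∈ Up)) f l hl
  have hu : ∀ (M : Model Up) f, 0 < M.val f → -M.val f < M.val (M.cn .rho) → M.UniqueAt f :=
    fun M f _ hf => uniqueAt_of_comonotonicity (Or.inr (by simp)) M hf
  refine ⟨.of_models fun M => (sat_iff _ _ _).2 ?_, .of_models fun M h => ?_⟩
  · refine extA_iff_strongOn M (c := fun r => -r < M.val (M.cn .rho)) (fun _ => sat_rhoGt)
      (hp M) (hu M) (Or.inr (by simp)) (Or.inr (by simp)) ?_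
    have := M.sat_ax (Or.inr (by simp) : rhoGam ∈ Up)
    rw [rhoGam, sat_leR, PreModel.ev_addR, PreModel.ev_negR, val_addR, val_negR, val_r2neg] at this
    have h := δ_pos (M.ev (.cn .nGam) PreModel.Val.nil)
    -- The positive summand `2^(-n)` in the axiom on `ρ̃` makes the condition strict at the index
    -- `γ̃`.
    exact lt_of_lt_of_le (lt_add_of_pos_right _ h) this
  · exact strongExtJOn_of_strongDomainOn M (c := fun r => -r < M.val (M.cn .rho))
      (fun _ => sat_rhoGt) (hp M) (hu M) h

theorem Ustarp_main :
    Provable Ustarp (Fm.iff extA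
      (Fm.and (strongDomainOn rhoGtHalf) (strongPartialResOn rhoGtHalf))) ∧
    Provable Ustarp (Fm.imp (strongDomainOn rhoGtHalf) (strongExtJOn rhoGtHalf)) := by
  have : Fact (normedSpace .comonotone ⊆ Ustarp) := ⟨Set.subset_union_left⟩
  have hp : ∀ (M : Model Ustarp) f l, M.δ l < M.val f → -(M.val f * 2⁻¹) < M.val (M.cn .rho) →
      M.PartialResAt f l := fun M f l hl hf =>
    (sat_partialResHalf _).1 (M.sat_ax (Or.inr (by simp) : partialResHalf ∈ Ustarp)) f l hf hl
  have hu : ∀ (M : Model Ustarp) f, 0 < M.val f → -(M.val f * 2⁻¹) < M.val (M.cn .rho) →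
      M.UniqueAt f :=
    -- For `γ > 0` the condition `ρ̃ > -γ/2` implies `ρ̃ > -γ`, which is all that uniqueness needs.
    fun M f h0 hf => uniqueAt_of_comonotonicity (Or.inr (by simp)) M (by linarith)
  refine ⟨.of_models fun M => (sat_iff _ _ _).2 ?_, .of_models fun M h => ?_⟩
  · refine extA_iff_strongOn M (c := fun r => -(r * 2⁻¹) < M.val (M.cn .rho))
      (fun _ => sat_rhoGtHalf) (hp M) (hu M) (Or.inr (by simp)) (Or.inr (by simp)) ?_
    have := M.sat_ax (Or.inr (by simp) : rhoGamHalf ∈ Ustarp)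
    rw [rhoGamHalf, sat_leR, PreModel.ev_addR, PreModel.ev_negR, val_addR, val_negR, val_r2neg, PreModel.ev_mulR,
      val_mulR, val_halfR] at this
    have h := δ_pos (M.ev (.cn .nGam) PreModel.Val.nil)
    exact lt_of_lt_of_le (lt_add_of_pos_right _ h) this
  · exact strongExtJOn_of_strongDomainOn M (c := fun r => -(r * 2⁻¹) < M.val (M.cn .rho))
      (fun _ => sat_rhoGtHalf) (hp M) (hu M) h

end ProofMining

open ProofMining
theorem mainTheorem6 :
    (∀ T ∈ ({Vp, Tp} : Set (Set (Fm Lang.accretive []))),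
      Provable T (Fm.iff extA (Fm.and strongDomain strongPartialRes)) ∧
      Provable T (Fm.iff (Fm.and strongDomain strongPartialRes)
        (Fm.and strongDomainOne strongPartialResOne)) ∧
      Provable T (Fm.iff (Fm.and strongDomainOne strongPartialResOne) extA) ∧
      Provable T (Fm.imp strongDomain strongExtJ)) ∧
    (Provable Up (Fm.iff extA
        (Fm.and (strongDomainOn rhoGt) (strongPartialResOn rhoGt))) ∧
      Provable Up (Fm.imp (strongDomainOn rhoGt) (strongExtJOn rhoGt))) ∧
    (Provable Ustarp (Fm.iff extA
        (Fm.and (strongDomainOn rhoGtHalf) (strongPartialResOn rhoGtHalf))) ∧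
      Provable Ustarp (Fm.imp (strongDomainOn rhoGtHalf) (strongExtJOn rhoGtHalf))) := by
  refine ⟨?_, Up_main, Ustarp_main⟩
  rintro T (rfl | rfl)
  · exact accretive_main subset_rfl
  · exact accretive_main Set.subset_union_left
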